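/- Let $(K,d)$ be a complete metric space (not necessarily separable) and let $\mathcal M=(K_{i(e)},w_e,p_e)_{e\in E}$ be a countable Markov system on $K$: $(K_j)_{j\in N}$, $1\in N\subset\mathbb N$, is a partition of $K$ into non-empty Borel sets, $E$ is at most countable, $i,t:E\to N$ with $i$ surjective, and, for every $e\in E$, $w_e:K_{i(e)}\to K_{t(e)}$ and $p_e:K_{i(e)}\to[0,1]$ are Borel measurable, $p_e$ is not identically zero, and $\sum_{i(e)=j}p_e=1$ on $K_j$ for every $j\in N$. Extend $p_e$ to $K$ by zero and $w_e$ to $K$ in an arbitrary Borel measurable way. Let $Uf:=\sum_{e}p_e\,f\circ w_e$, let $U^*\nu(f):=\int Uf\,d\nu$, and let $P(\mathcal M)$ be the set of Borel probability measures $\mu$ on $K$ with $U^*\mu=\mu$. Let $\bar E:=E\cup\{\infty\}$ be the one-point compactification of the discrete space $E$, with $i(\infty)=t(\infty)=1$, $w_\infty=\mathrm{id}$, $p_\infty=0$. Let $\bar\Sigma:=\bar E^{\mathbb Z}$ with its product (= Borel) $\sigma$-algebra, $S$ the left shift, $P_S(\bar\Sigma)$ the set of $S$-invariant probability measures, ${}_m[e_m,\dots,e_n]:=\{\sigma\in\bar\Sigma:\sigma_k=e_k,\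 m\le k\le n\}$, $\mathcal F$ the $\sigma$-algebra generated by all cylinder sets ${}_m[e_m,\dots,e_0]$, $m\le0$, and $\Sigma_G:=\{\sigma: \sigma_n\in E,\ i(\sigma_{n+1})=t(\sigma_n)\text{ for all }n\in\mathbb Z\}$. Fix $x_j\in K_j$ for all $j\in N$. Let $D$ be the set of all $\sigma\in\Sigma_G$ for which $\lim_{m\to-\infty}w_{\sigma_0}\circ\cdots\circ w_{\sigma_m}(x_{i(\sigma_m)})$ exists. Let $F(\sigma)$ be this limit if $\sigma\in D$ and $F(\sigma):=x_{t(\sigma_0)}$ otherwise, and put $F(\Lambda)(B):=\Lambda(F^{-1}(B))$ for measures $\Lambda$ on $\bar\Sigma$. Define the equilibrium states $$E(\mathcal M):=\{\Lambda\in P_S(\bar\Sigma):\Lambda(D)=1,\ E_\Lambda(1_{{}_1[e]}|\mathcal F)=p_e\circ F\ \Lambda\text{-a.e. for all }e\in E\}.$$ When all $p_e|_{K_{i(e)}}$ are uniformly continuous, let $\bar p_e$ be the continuous extension of $p_e|_{K_{i(e)}}$ to $\overline{K_{i(e)}}$, extended by zero to $K$, let $T_j:=\{\sigma\in\Sigma_G: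 t(\sigma_0)=j\}$, and define the asymptotic states $$\tilde E(\mathcal M):=\{\Lambda\in P_S(\bar\Sigma):\Lambda(D)=1,\ E_\Lambda(1_{{}_1[e]}|\mathcal F)=\bar p_e\circ F\,1_{T_{i(e)}}\ \Lambda\text{-a.e. for all }e\in E\}.$$ $\mathcal M$ is called non-degenerate if for every $\Lambda\in\tilde E(\mathcal M)$ there is $j\in N$ with $\Lambda(T_j\cap F^{-1}(K_j))>0$. For $\mu\in P(\mathcal M)$ let $\Phi(\mu)$ be the unique probability measure on $\bar\Sigma$ with $$\Phi(\mu)({}_m[e_m,\dots,e_n])=\int p_{e_m}(y)\,p_{e_{m+1}}(w_{e_m}y)\cdots p_{e_n}(w_{e_{n-1}}\circ\cdots\circ w_{e_m}y)\,d\mu(y)$$ for all $m\le 0$, $n\ge m$ and $e_m,\dots,e_n\in\bar E$. Suppose that - $\mathcal M$ is contractive: there is $0<a<1$ with $\sum_{i(e)=j}p_e(y)\,d(w_ey,w_ez)\le a\,d(y,z)$ for all $y,z\in K_j$, $j\in N$; - $\mathcal M$ is uniformly continuous: $w_e|_{K_{i(e)}}$ and $p_e|_{K_{i(e)}}$ are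 uniformly continuous for every $e\in E$; - $\mathcal M$ is non-degenerate; - $b:=\sup_{j\in N}\sup_{y\in K_j}\sum_{i(e)=j}p_e(y)\,d(w_e(x_j),x_{t(e)})<\infty$. Then the following holds. (i) Suppose $\mathcal M$ has a dominating Markov chain, i.e. $\sum_{i(e)=j}\sup_{K_j}p_e<\infty$ for every $j\in N$. Then $E(\mathcal M)$ is non-empty if and only if there is $y\in K$ such that the probability measures $\alpha_n^y$ on $N$ given by $\alpha^y_n(\{j\}):=\frac1n\sum_{k=1}^n (U^*)^k\delta_y(K_j)$, $n\ge1$, are uniformly tight, i.e. for every $\epsilon>0$ there is a finite $V\subset N$ with $\alpha_n^y(N\setminus V)<\epsilon$ for all $n\ge1$. (ii) $\Phi$ is well defined on $P(\mathcal M)$ and it is the inverse of $F:E(\mathcal M)\to P(\mathcal M)$: $F$ maps $E(\mathcal M)$ bijectively onto $P(\mathcal M)$, $\Phi$ maps $P(\mathcal M)$ into $E(\mathcal M)$, $\Phi(F(\Lambda))=\Lambda$ for all $\Lambda\in E(\mathcal M)$, and $F(\Phi(\mu))=\mu$ for all $\mu\in P(\mathcal M)$. Moreover, the map $F:E(\mathcal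 M)\to P(\mathcal M)$ does not depend on the choice of the points $x_j\in K_j$ as long as $b$ remains finite: for another choice $x'_j\in K_j$ with finite $b$, the set $E(\mathcal M)$ and the measures $F(\Lambda)$, $\Lambda\in E(\mathcal M)$, are the same. -/

import Mathlib

open MeasureTheory Filter Topology
open scoped ENNReal

noncomputable section

/-- A countable Markov system `(K_{i(e)}, w_e, p_e)_{e ∈ E}` on a metric space `K` with vertex sets
`K_j = cell j`, `j ∈ N ⊆ ℕ`, `1 ∈ N`.  The maps `w_e` are taken with an arbitrary Borel extension
from `K_{i(e)}` to `K` and the probability functions `p_e` with their extension by zero. -/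
structure MarkovSystem (K : Type*) [MetricSpace K] [MeasurableSpace K] [BorelSpace K]
    (N : Set ℕ) (E : Type*) [Countable E] where
  one_mem : 1 ∈ N
  cell : N → Set K
  cell_measurable : ∀ j, MeasurableSet (cell j)
  cell_nonempty : ∀ j, (cell j).Nonempty
  cell_disjoint : Pairwise (fun j k => Disjoint (cell j) (cell k))
  cell_cover : ⋃ j, cell j = Set.univ
  i : E → N
  t : E → N
  i_surjective : Function.Surjective i
  w : E → K → K
  w_measurable : ∀ e, Measurable (w e)
  w_mapsTo : ∀ e, Set.MapsTo (w e) (cell (i e)) (cell (t e))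
  p : E → K → ℝ
  p_measurable : ∀ e, Measurable (p e)
  p_mem : ∀ e y, p e y ∈ Set.Icc (0 : ℝ) 1
  p_eq_zero : ∀ e y, y ∉ cell (i e) → p e y = 0
  p_pos : ∀ e, ∃ y ∈ cell (i e), 0 < p e y
  p_sum : ∀ j, ∀ y ∈ cell j, HasSum (fun e : {e : E // i e = j} => p e y) 1

/-- The extended alphabet `E ∪ {∞}` with `∞ = none`.  Every subset is a Borel set of its one-point
compactification topology. -/
def Alphabet (E : Type*) : Type _ := Option E

instance (E : Type*) : MeasurableSpace (Alphabet E) := ⊤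

instance (E : Type*) : DiscreteMeasurableSpace (Alphabet E) := ⟨fun _ => trivial⟩

instance (E : Type*) [Countable E] : Countable (Alphabet E) :=
  inferInstanceAs (Countable (Option E))

/-- A letter `e ∈ E` as an element of the extended alphabet. -/
def letter {E : Type*} (e : E) : Alphabet E := some e

/-- The code space of two-sided sequences over the extended alphabet, with the product
`σ`-algebra (which is the Borel `σ`-algebra, the alphabet having a countable base). -/
abbrev CodeSpace (E : Type*) : Type _ := ℤ → Alphabet E

/-- The left shift `(S σ)_{n-1} = σ_n`. -/
def shift {E : Type*} (σ : CodeSpace E) : CodeSpace E := fun n => σ (n + 1)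

/-- The cylinder set of all `σ` with `σ_m = l_0, σ_{m+1} = l_1, …` along the finite word `l`. -/
def cyl {E : Type*} (m : ℤ) (l : List (Alphabet E)) : Set (CodeSpace E) :=
  {σ | ∀ k (hk : k < l.length), σ (m + k) = l[k]}

/-- The `σ`-algebra generated by the cylinder sets over the coordinates `-n, …, 0`. -/
@[reducible] def pastSigmaFrom (E : Type*) (n : ℕ) : MeasurableSpace (CodeSpace E) :=
  MeasurableSpace.generateFrom
    {A | ∃ l : List (Alphabet E), l.length = n + 1 ∧ A = cyl (-(n : ℤ)) l}

/-- The `σ`-algebra generated by all the cylinder sets over `-n, …, 0`, `n ≥ 0`. -/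
@[reducible] def pastSigma (E : Type*) : MeasurableSpace (CodeSpace E) := ⨆ n : ℕ, pastSigmaFrom E n

theorem measurableSet_cyl {E : Type*} (m : ℤ) (l : List (Alphabet E)) :
    MeasurableSet (cyl m l) := by
  have h : cyl m l = ⋂ k : Fin l.length,
      (fun σ : CodeSpace E => σ (m + (k : ℕ))) ⁻¹' {l[(k : ℕ)]} := by
    ext σ
    simp only [cyl, Set.mem_ofPred_eq, Set.mem_iInter, Set.mem_preimage, Set.mem_singleton_iff]
    exact ⟨fun h k => h k k.2, fun h k hk => h ⟨k, hk⟩⟩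
  rw [h]
  exact MeasurableSet.iInter fun k => measurable_pi_apply _ (MeasurableSet.of_discrete)

theorem pastSigma_le (E : Type*) :
    pastSigma E ≤ (inferInstance : MeasurableSpace (CodeSpace E)) := by
  refine iSup_le fun n => MeasurableSpace.generateFrom_le ?_
  rintro A ⟨l, -, rfl⟩
  exact measurableSet_cyl _ _

/-- The shift invariant Borel probability measures on the code space. -/
def shiftInvariant (E : Type*) : Set (Measure (CodeSpace E)) :=
  {Λ | IsProbabilityMeasure Λ ∧ Λ.map shift = Λ}

/-- The indicator function of the cylinder set `_1[e]`. -/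
def nextIs {E : Type*} (e : E) : CodeSpace E → ℝ :=
  Set.indicator {σ | σ 1 = letter e} (fun _ => 1)

namespace MarkovSystem

variable {K : Type*} [MetricSpace K] [MeasurableSpace K] [BorelSpace K]
  {N : Set ℕ} {E : Type*} [Countable E]

/-! ### The Markov operator and the invariant measures -/

/-- The Markov operator `U f = ∑_e p_e · f ∘ w_e`. -/
def markovOp (M : MarkovSystem K N E) (f : K → ℝ≥0∞) : K → ℝ≥0∞ :=
  fun y => ∑' e, ENNReal.ofReal (M.p e y) * f (M.w e y)

/-- The adjoint operator `U^*` on measures. -/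
def adj (M : MarkovSystem K N E) (ν : Measure K) : Measure K :=
  Measure.sum fun e => (ν.withDensity fun y => ENNReal.ofReal (M.p e y)).map (M.w e)

/-- The defining property `(U^* ν)(f) = ∫ U f dν` of the adjoint operator. -/
theorem lintegral_adj (M : MarkovSystem K N E) (ν : Measure K) {f : K → ℝ≥0∞}
    (hf : Measurable f) : ∫⁻ y, f y ∂(M.adj ν) = ∫⁻ y, M.markovOp f y ∂ν := by
  have hp : ∀ e, Measurable fun y => ENNReal.ofReal (M.p e y) :=
    fun e => (M.p_measurable e).ennreal_ofReal
  have hfw : ∀ e, Measurable fun y => f (M.w e y) := fun e => hf.comp (M.w_measurable e)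
  simp only [adj, markovOp]
  have hm : ∀ e, AEMeasurable (fun y => ENNReal.ofReal (M.p e y) * f (M.w e y)) ν :=
    fun e => ((hp e).mul (hfw e)).aemeasurable
  rw [lintegral_sum_measure, lintegral_tsum hm]
  congr 1
  ext e
  rw [lintegral_map hf (M.w_measurable e),
    lintegral_withDensity_eq_lintegral_mul _ (hp e) (hfw e)]
  rfl

/-- `P(M)`, the invariant Borel probability measures. -/
def invariantMeasures (M : MarkovSystem K N E) : Set (Measure K) :=
  {μ | IsProbabilityMeasure μ ∧ M.adj μ = μ}

/-! ### Standing conditions -/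

/-- Contraction on average on each vertex set, with some rate `0 < a < 1`. -/
def Contractive (M : MarkovSystem K N E) : Prop :=
  ∃ a : ℝ, 0 < a ∧ a < 1 ∧ ∀ j, ∀ y ∈ M.cell j, ∀ z ∈ M.cell j,
    ∑' e : {e : E // M.i e = j}, ENNReal.ofReal (M.p e y) * edist (M.w e y) (M.w e z)
      ≤ ENNReal.ofReal a * edist y z

/-- All `w_e` and `p_e` are uniformly continuous on `K_{i(e)}`. -/
def UnifContinuous (M : MarkovSystem K N E) : Prop :=
  ∀ e, UniformContinuousOn (M.w e) (M.cell (M.i e)) ∧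
    UniformContinuousOn (M.p e) (M.cell (M.i e))

/-- The constant `b`, for the base points `x_j ∈ K_j`. -/
def bConst (M : MarkovSystem K N E) (x : N → K) : ℝ≥0∞ :=
  ⨆ j : N, ⨆ y ∈ M.cell j, ∑' e : {e : E // M.i e = j},
    ENNReal.ofReal (M.p e y) * edist (M.w e (x j)) (x (M.t e))

/-- `M` has a dominating Markov chain: `∑_{i(e) = j} sup_{K_j} p_e < ∞` for all `j`. -/
def HasDominatingChain (M : MarkovSystem K N E) : Prop :=
  ∀ j : N, (∑' e : {e : E // M.i e = j}, (⨆ y ∈ M.cell j, ENNReal.ofReal (M.p e y))) < ∞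

/-- The measure `α_n^y` on `N` with `α_n^y({j}) = (1/n) ∑_{k=1}^n (U^*)^k δ_y (K_j)`. -/
def alpha (M : MarkovSystem K N E) (y : K) (n : ℕ) : Measure N :=
  Measure.sum fun j : N =>
    ((n : ℝ≥0∞)⁻¹ * ∑ k ∈ Finset.Icc 1 n, (M.adj^[k] (Measure.dirac y)) (M.cell j)) •
      Measure.dirac j

/-- There is a starting point `y ∈ K` for which `(α_n^y)_{n ≥ 1}` is uniformly tight. -/
def TightCondition (M : MarkovSystem K N E) : Prop :=
  ∃ y : K, ∀ ε : ℝ≥0∞, 0 < ε → ∃ V : Finset N, ∀ n : ℕ, 1 ≤ n →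
    M.alpha y n (V : Set N)ᶜ < ε

/-! ### The coding map -/

/-- `i`, `t`, `w` and `p` on the extended alphabet: `i(∞) = t(∞) = 1`, `w_∞ = id`, `p_∞ = 0`. -/
def iExt (M : MarkovSystem K N E) (a : Alphabet E) : N := Option.elim a ⟨1, M.one_mem⟩ M.i

/-- See `iExt`. -/
def tExt (M : MarkovSystem K N E) (a : Alphabet E) : N := Option.elim a ⟨1, M.one_mem⟩ M.t

/-- See `iExt`. -/
def wExt (M : MarkovSystem K N E) (a : Alphabet E) : K → K := Option.elim a id M.w

/-- See `iExt`. -/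
def pExt (M : MarkovSystem K N E) (a : Alphabet E) : K → ℝ := Option.elim a (fun _ => 0) M.p

/-- The path space `Σ_G`. -/
def pathSpace (M : MarkovSystem K N E) : Set (CodeSpace E) :=
  {σ | ∀ n : ℤ, (∃ e : E, σ n = letter e) ∧ M.iExt (σ (n + 1)) = M.tExt (σ n)}

/-- `back σ n = w_{σ_0} ∘ w_{σ_{-1}} ∘ ⋯ ∘ w_{σ_{-n}}`. -/
def back (M : MarkovSystem K N E) (σ : CodeSpace E) : ℕ → K → K
  | 0 => M.wExt (σ 0)
  | n + 1 => fun y => back M σ n (M.wExt (σ (-((n : ℤ) + 1))) y)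

/-- `w_{σ_0} ∘ ⋯ ∘ w_{σ_{-n}} (x_{i(σ_{-n})})`. -/
def approx (M : MarkovSystem K N E) (x : N → K) (σ : CodeSpace E) (n : ℕ) : K :=
  M.back σ n (x (M.iExt (σ (-(n : ℤ)))))

/-- The set `D` of all paths along which the approximations converge. -/
def codingDomain (M : MarkovSystem K N E) (x : N → K) : Set (CodeSpace E) :=
  {σ | σ ∈ M.pathSpace ∧ ∃ y, Tendsto (M.approx x σ) atTop (𝓝 y)}

open Classical in
/-- The coding map `F`: the limit on `D`, and `x_{t(σ_0)}` elsewhere. -/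
def coding (M : MarkovSystem K N E) (x : N → K) (σ : CodeSpace E) : K :=
  if h : σ ∈ M.codingDomain x then h.2.choose else x (M.tExt (σ 0))

/-- The coding map on measures, `F(Λ)(B) = Λ(F⁻¹(B))`. -/
def codingMeasure (M : MarkovSystem K N E) (x : N → K) (Λ : Measure (CodeSpace E)) : Measure K :=
  Λ.map (M.coding x)

/-! ### Equilibrium states, asymptotic states, non-degeneracy -/

/-- `E(M)`, the equilibrium states. -/
def equilibriumStates (M : MarkovSystem K N E) (x : N → K) : Set (Measure (CodeSpace E)) :=
  {Λ | Λ ∈ shiftInvariant E ∧ Λ (M.codingDomain x) = 1 ∧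
    ∀ e : E, condExp (pastSigma E) Λ (nextIs e) =ᵐ[Λ] fun σ => M.p e (M.coding x σ)}

/-- The set `T_j` of all paths `σ` with `t(σ_0) = j`. -/
def endsAt (M : MarkovSystem K N E) (j : N) : Set (CodeSpace E) :=
  {σ | σ ∈ M.pathSpace ∧ M.tExt (σ 0) = j}

open Classical in
/-- The continuous extension of `p_e` from `K_{i(e)}` to its closure, and zero elsewhere. -/
def pBar (M : MarkovSystem K N E) (e : E) (y : K) : ℝ :=
  if y ∈ closure (M.cell (M.i e)) then extendFrom (M.cell (M.i e)) (M.p e) y else 0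

/-- The asymptotic states. -/
def asymptoticStates (M : MarkovSystem K N E) (x : N → K) : Set (Measure (CodeSpace E)) :=
  {Λ | Λ ∈ shiftInvariant E ∧ Λ (M.codingDomain x) = 1 ∧
    ∀ e : E, condExp (pastSigma E) Λ (nextIs e) =ᵐ[Λ]
      (M.endsAt (M.i e)).indicator fun σ => M.pBar e (M.coding x σ)}

/-- Non-degeneracy: every asymptotic state charges some `T_j ∩ F⁻¹(K_j)`. -/
def NonDegenerate (M : MarkovSystem K N E) (x : N → K) : Prop :=
  ∀ Λ ∈ M.asymptoticStates x, ∃ j : N, 0 < Λ (M.endsAt j ∩ M.coding x ⁻¹' M.cell j)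

/-! ### The map `Φ` -/

/-- `P_y^m(_m[e_m, …, e_n]) = p_{e_m}(y) p_{e_{m+1}}(w_{e_m} y) ⋯` for the word
`l = [e_m, …, e_n]`. -/
def pathProb (M : MarkovSystem K N E) : List (Alphabet E) → K → ℝ≥0∞
  | [], _ => 1
  | a :: l, y => ENNReal.ofReal (M.pExt a y) * pathProb M l (M.wExt a y)

/-- `Λ` is a probability measure that extends `φ_m(μ) = ∫ P_y^m dμ(y)` for all `m ≤ 0`.
The `φ_m(μ)` live on the `σ`-algebra generated by the cylinder sets that start at `m`, and these
are a `∩`-stable generator together with the empty set. -/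
def IsLift (M : MarkovSystem K N E) (μ : Measure K) (Λ : Measure (CodeSpace E)) : Prop :=
  IsProbabilityMeasure Λ ∧ ∀ m : ℤ, m ≤ 0 → ∀ l : List (Alphabet E), l ≠ [] →
    Λ (cyl m l) = ∫⁻ y, M.pathProb l y ∂μ

open Classical in
/-- `Φ(μ)`, the measure on the code space that extends all `φ_m(μ)`, `m ≤ 0`. -/
def lift (M : MarkovSystem K N E) (μ : Measure K) : Measure (CodeSpace E) :=
  if h : ∃ Λ, M.IsLift μ Λ then h.choose else 0

end MarkovSystem

end

open MeasureTheory Filter Topology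
open scoped ENNReal

noncomputable section

open ProbabilityTheory
open scoped NNReal

/-! A measure on two-sided paths is determined by its weights on finite words. For an invariant `μ`
the weights `∫ pathProb l dμ` are consistent on the right because the probabilities sum to one, and
on the left because `μ` is invariant. So `Φ(μ)` exists and is unique (`exists_isLift`,
`IsLift.unique`); existence is the Ionescu-Tulcea construction applied to two-sided sequences folded
at the origin.

Contraction on average gives the drift inequality `U V ≤ ρ V + b` for the distance `V` to the base
points, hence a bound `C` on the mean of `V` under invariant measures and along the chain. Starting
the approximation of the coded point one letter earlier then changes it by at most `ρ ^ (n + 1) * (2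
* C + b)` in the mean, so the approximations converge almost surely. `IsPathLimit` covers lifts of
invariant measures and limits of averaged chains together. Uniform continuity transfers the law of
the next letter to the limit of the approximations, which makes every such path limit with bounded
`C` an asymptotic state (`IsPathLimit.mem_asymptoticStates`).

For the lift of `μ`, the joint law of the coded point and the last letter is found by testing
against Lipschitz functions (`IsLift.map_codeLim_restrict`): on `σ_0 = a` it is the image of `p_a μ`
under `w_a`. Hence the coded point lies in `K_{t(σ_0)}` almost surely, where the extended and the
original probabilities agree; the lift is an equilibrium state, and summing over `a` gives `F(Φ(μ))
= U^* μ = μ`. Conversely, in an equilibrium state the law of the next letter forces the coded point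
into `K_{i(σ_1)}`, so `F ∘ S = w_{σ_1} ∘ F` almost surely. This yields the invariance of `F(Λ)` and
the word weights of `Λ`, that is, `Φ(F(Λ)) = Λ`. Lifts do not mention the base points, whence the
independence of their choice.

For (i), an equilibrium state supplies an invariant measure, and the maximal inequality then
produces a starting point with tight averages. In the other direction, tightness and the dominating
chain confine the next letter to a finite set up to `ε`, uniformly in time. Word weights of the
averages therefore stay consistent in an ultrafilter limit, and compactness is needed only for
numbers in `[0, ∞]`. The limit is an asymptotic state. By non-degeneracy it charges the almost
surely shift-invariant set of paths coded in the right vertex set, and conditioning on that set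
gives an equilibrium state. -/

/-! ### Sums over words of a given length -/

section Words

variable {A : Type*}

/-- The sum of `f` over all words of length `n`. -/
def wsum (n : ℕ) (f : List A → ℝ≥0∞) : ℝ≥0∞ := ∑' l : {l : List A // l.length = n}, f l.1

theorem wsum_zero (f : List A → ℝ≥0∞) : wsum 0 f = f [] := by
  unfold wsum
  rw [tsum_eq_single ⟨[], rfl⟩]
  rintro ⟨l, hl⟩ h
  exact absurd (Subtype.ext (List.length_eq_zero_iff.1 hl)) h

theorem wsum_succ (n : ℕ) (f : List A → ℝ≥0∞) :
    wsum (n + 1) f = ∑' a, wsum n fun l => f (a :: l) := by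
  unfold wsum
  rw [← ENNReal.tsum_prod (f := fun a (l : {l : List A // l.length = n}) => f (a :: l.1))]
  let e : A × {l : List A // l.length = n} ≃ {l : List A // l.length = n + 1} :=
    { toFun := fun q => ⟨q.1 :: q.2.1, by simp [q.2.2]⟩
      invFun := fun v => (v.1.head (by rintro h; simpa [h] using v.2), ⟨v.1.tail, by simp [v.2]⟩)
      left_inv := fun q => by simp
      right_inv := fun v => by simp }
  rw [← e.tsum_eq]
  rfl

theorem wsum_mono {n : ℕ} {f g : List A → ℝ≥0∞} (h : ∀ l : List A, l.length = n → f l ≤ g l) :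
    wsum n f ≤ wsum n g :=
  ENNReal.tsum_le_tsum fun l => h l.1 l.2

theorem wsum_congr {n : ℕ} {f g : List A → ℝ≥0∞} (h : ∀ l : List A, l.length = n → f l = g l) :
    wsum n f = wsum n g :=
  tsum_congr fun l => h l.1 l.2

theorem wsum_add (n : ℕ) (f g : List A → ℝ≥0∞) :
    wsum n (fun l => f l + g l) = wsum n f + wsum n g :=
  ENNReal.tsum_add

theorem wsum_mul_left (n : ℕ) (c : ℝ≥0∞) (f : List A → ℝ≥0∞) :
    wsum n (fun l => c * f l) = c * wsum n f :=
  ENNReal.tsum_mul_left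

theorem wsum_snoc (n : ℕ) (f : List A → ℝ≥0∞) :
    wsum (n + 1) f = wsum n fun l => ∑' a, f (l ++ [a]) := by
  induction n generalizing f with
  | zero => simp [wsum_succ, wsum_zero]
  | succ n ih =>
    rw [wsum_succ, wsum_succ]
    refine tsum_congr fun a => ?_
    rw [ih]
    rfl

theorem lintegral_wsum [Countable A] {X : Type*} [MeasurableSpace X] (μ : Measure X) (n : ℕ)
    {f : List A → X → ℝ≥0∞} (hf : ∀ l, Measurable (f l)) :
    ∫⁻ z, wsum n (fun l => f l z) ∂μ = wsum n fun l => ∫⁻ z, f l z ∂μ := by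
  exact lintegral_tsum fun l => (hf l.1).aemeasurable

theorem measurable_wsum [Countable A] {X : Type*} [MeasurableSpace X] (n : ℕ)
    {f : List A → X → ℝ≥0∞} (hf : ∀ l, Measurable (f l)) :
    Measurable fun z => wsum n fun l => f l z := by
  exact Measurable.tsum fun l => hf l.1

/-- A bound on all partial sums passes to the limit of the summands. -/
theorem wsum_le_wsum_add_of_tendsto {ι : Type*} {ω : Filter ι} [ω.NeBot] {n : ℕ}
    {f g : ι → List A → ℝ≥0∞} {f' g' : List A → ℝ≥0∞} {r : ι → List A → ℝ≥0∞} {B : ℝ≥0∞}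
    (hf : ∀ l, Tendsto (fun i => f i l) ω (𝓝 (f' l)))
    (hg : ∀ l, Tendsto (fun i => g i l) ω (𝓝 (g' l)))
    (h : ∀ i l, l.length = n → f i l ≤ g i l + r i l) (hr : ∀ i, wsum n (r i) ≤ B) :
    wsum n f' ≤ wsum n g' + B := by
  unfold wsum
  rw [ENNReal.tsum_eq_iSup_sum]
  refine iSup_le fun s => ?_
  have hs : ∑ l ∈ s, f' l.1 ≤ ∑ l ∈ s, g' l.1 + B := by
    refine le_of_tendsto_of_tendsto (tendsto_finsetSum s fun l _ => hf l.1)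
      ((tendsto_finsetSum s fun l _ => hg l.1).add tendsto_const_nhds) ?_
    refine Eventually.of_forall fun i => ?_
    calc ∑ l ∈ s, f i l.1 ≤ ∑ l ∈ s, (g i l.1 + r i l.1) :=
          Finset.sum_le_sum fun l _ => h i l.1 l.2
      _ = ∑ l ∈ s, g i l.1 + ∑ l ∈ s, r i l.1 := Finset.sum_add_distrib
      _ ≤ _ := by
        exact add_le_add le_rfl ((ENNReal.sum_le_tsum s).trans (hr i))
  exact hs.trans (add_le_add (ENNReal.sum_le_tsum s) le_rfl)

end Words

/-! ### Measures on sequence spaces from consistent weights of words -/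

section Extension

variable {A : Type*}

/-- A consistent family of weights of finite words comes from a measure on one-sided sequences. -/
theorem exists_measure_nat_of_word_weights [MeasurableSpace A] [DiscreteMeasurableSpace A]
    [Countable A] (r : List A → ℝ≥0∞) (h0 : r [] = 1)
    (hr : ∀ l, ∑' a, r (l ++ [a]) = r l) :
    ∃ P : Measure (ℕ → A), IsProbabilityMeasure P ∧
      ∀ (n : ℕ) (τ₀ : ℕ → A), P {τ | ∀ k < n, τ k = τ₀ k} = r ((List.range n).map τ₀) := by
  have hle : ∀ l, r l ≤ 1 := by
    intro l
    induction l using List.reverseRecOn with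
    | nil => exact h0.le
    | append_singleton l a ih =>
      exact (ENNReal.le_tsum (f := fun a => r (l ++ [a])) a).trans ((hr l).le.trans ih)
  have hne : ∀ l, r l ≠ ∞ := fun l => ((hle l).trans_lt ENNReal.one_lt_top).ne
  have hA : Nonempty A := by
    by_contra hA
    have := not_nonempty_iff.1 hA
    have h := hr []
    simp [h0] at h
  let a₀ : A := hA.some
  let w : ∀ n : ℕ, ((i : Finset.Iic n) → A) → List A := fun n u =>
    (List.range (n + 1)).map fun k => if h : k ≤ n then u ⟨k, Finset.mem_Iic.2 h⟩ else a₀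
  -- The conditional law of the next letter is a ratio of weights. Histories of weight zero get a
  -- Dirac mass, so that the kernel is Markov everywhere.
  let κ₀ : ∀ n : ℕ, ((i : Finset.Iic n) → A) → Measure A := fun n u =>
    if r (w n u) = 0 then Measure.dirac a₀
      else Measure.sum fun a => (r (w n u ++ [a]) / r (w n u)) • Measure.dirac a
  let κ : ∀ n : ℕ, Kernel ((i : Finset.Iic n) → A) A := fun n =>
    { toFun := κ₀ n
      measurable' := Measurable.of_discrete }
  have hκ : ∀ n, IsMarkovKernel (κ n) := by
    intro n
    refine ⟨fun u => ⟨?_⟩⟩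
    change κ₀ n u Set.univ = 1
    simp only [κ₀]
    split_ifs with h
    · simp
    · rw [Measure.sum_apply _ MeasurableSet.univ]
      simp only [Measure.smul_apply, measure_univ, smul_eq_mul, mul_one, div_eq_mul_inv]
      rw [ENNReal.tsum_mul_right, hr, ENNReal.mul_inv_cancel h (hne _)]
  have hκs : ∀ n u a, r (w n u) * κ n u {a} = r (w n u ++ [a]) := by
    intro n u a
    change r (w n u) * κ₀ n u {a} = _
    simp only [κ₀]
    split_ifs with h
    -- By consistency an extension weighs no more than the word, so extensions of a null word are
    -- null.
    · rw [h, zero_mul, eq_comm, ← nonpos_iff_eq_zero, ← h, ← hr (w n u)]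
      exact ENNReal.le_tsum a
    · rw [Measure.sum_apply _ (MeasurableSet.singleton _), tsum_eq_single a]
      · simp only [Measure.smul_apply, smul_eq_mul]
        rw [Measure.dirac_apply_of_mem (Set.mem_singleton a), mul_one]
        exact ENNReal.mul_div_cancel h (hne _)
      · intro b hb
        simp [Measure.dirac_apply' _ (MeasurableSet.singleton a), hb]
  let μ₀ : Measure A := Measure.sum fun a => r [a] • Measure.dirac a
  have hμ₀ : IsProbabilityMeasure μ₀ := by
    refine ⟨?_⟩
    have h := hr []
    simp only [List.nil_append] at h
    simp [μ₀, Measure.sum_apply _ MeasurableSet.univ, h, h0]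
  let P : Measure (ℕ → A) := Kernel.trajMeasure (X := fun _ => A) μ₀ κ
  have hP : IsProbabilityMeasure P := by
    change IsProbabilityMeasure (Kernel.trajMeasure (X := fun _ => A) μ₀ κ)
    infer_instance
  refine ⟨P, hP, fun n τ₀ => ?_⟩
  rcases n with _ | n
  · simp [h0]
  induction n with
  | zero =>
    have h1 : P.map (fun τ => τ 0) = μ₀ := by
      have h2 : P.map (Preorder.frestrictLe (π := fun _ => A) 0) =
          μ₀.map (MeasurableEquiv.piUnique fun _ : Finset.Iic 0 => A).symm := by
        simp only [P]
        rw [Kernel.trajMeasure, Measure.map_comp _ _ (by fun_prop), Kernel.traj_map_frestrictLe,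
          Kernel.partialTraj_self, Measure.id_comp]
      have h3 : (fun τ : ℕ → A => τ 0) = (MeasurableEquiv.piUnique fun _ : Finset.Iic 0 => A) ∘
          Preorder.frestrictLe (π := fun _ => A) 0 := rfl
      rw [h3, ← Measure.map_map (MeasurableEquiv.measurable _) (by fun_prop), h2,
        Measure.map_map (MeasurableEquiv.measurable _) (MeasurableEquiv.measurable _)]
      have h4 : (MeasurableEquiv.piUnique fun _ : Finset.Iic 0 => A) ∘
          (MeasurableEquiv.piUnique fun _ : Finset.Iic 0 => A).symm = id := by
        ext a
        exact (MeasurableEquiv.piUnique fun _ : Finset.Iic 0 => A).apply_symm_apply a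
      rw [h4, Measure.map_id]
    have h2 : {τ : ℕ → A | ∀ k < 0 + 1, τ k = τ₀ k} = (fun τ => τ 0) ⁻¹' {τ₀ 0} := by
      ext τ; simp
    rw [h2, ← Measure.map_apply (measurable_pi_apply 0) (MeasurableSet.singleton _), h1]
    rw [Measure.sum_apply _ (MeasurableSet.singleton _), tsum_eq_single (τ₀ 0)]
    · simp
    · intro b hb
      simp [Measure.dirac_apply' _ (MeasurableSet.singleton _), hb]
  | succ n ih =>
    have hcp := Kernel.map_frestrictLe_trajMeasure_compProd_eq_map_trajMeasure
      (X := fun _ => A) (κ := κ) (μ₀ := μ₀) (a := n)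
    let u : (i : Finset.Iic n) → A := fun i => τ₀ i
    have hw : w n u = (List.range (n + 1)).map τ₀ := by
      refine List.map_congr_left fun k hk => ?_
      have : k ≤ n := by simpa [Nat.lt_succ_iff] using hk
      simp [this, u]
    have hmeas : Measurable (fun τ : ℕ → A => (Preorder.frestrictLe (π := fun _ => A) n τ, τ (n + 1))) :=
      (Preorder.measurable_frestrictLe n).prodMk (measurable_pi_apply _)
    have h2 : {τ : ℕ → A | ∀ k < n + 1 + 1, τ k = τ₀ k} =
        (fun τ => (Preorder.frestrictLe (π := fun _ => A) n τ, τ (n + 1))) ⁻¹'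
          ({u} ×ˢ {τ₀ (n + 1)}) := by
      ext τ
      simp only [Set.mem_ofPred_eq, Set.mem_preimage, Set.mem_prod, Set.mem_singleton_iff]
      constructor
      · intro h
        refine ⟨funext fun i => h i ?_, h _ (by omega)⟩
        have := Finset.mem_Iic.1 i.2
        omega
      · rintro ⟨h, h'⟩ k hk
        rcases Nat.lt_succ_iff_lt_or_eq.1 hk with hk | rfl
        · exact congrFun h ⟨k, Finset.mem_Iic.2 (by omega)⟩
        · exact h'
    have h3 : (Preorder.frestrictLe (π := fun _ => A) n) ⁻¹' {u} =
        {τ : ℕ → A | ∀ k < n + 1, τ k = τ₀ k} := by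
      ext τ
      simp only [Set.mem_ofPred_eq, Set.mem_preimage, Set.mem_singleton_iff]
      constructor
      · intro h k hk
        exact congrFun h ⟨k, Finset.mem_Iic.2 (by omega)⟩
      · intro h
        refine funext fun i => h i ?_
        have := Finset.mem_Iic.1 i.2
        omega
    rw [h2, ← Measure.map_apply hmeas
      ((MeasurableSet.singleton _).prod (MeasurableSet.singleton _))]
    change (Measure.map _ (Kernel.trajMeasure (X := fun _ => A) μ₀ κ)) _ = _
    rw [← hcp, Measure.compProd_apply_prod (MeasurableSet.singleton _) (MeasurableSet.singleton _),
      lintegral_singleton, Measure.map_apply (Preorder.measurable_frestrictLe n)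
      (MeasurableSet.singleton _), h3]
    change κ n u _ * P _ = _
    rw [ih, mul_comm, ← hw, hκs, hw, List.range_succ (n := n + 1), List.map_append]
    rfl

end Extension

/-! ### Windows of a two-sided sequence -/

section Windows

variable {E : Type*}

/-- The word `σ_m σ_{m+1} ⋯` of length `n`. -/
def window (m : ℤ) : ℕ → CodeSpace E → List (Alphabet E)
  | 0, _ => []
  | n + 1, σ => σ m :: window (m + 1) n σ

@[simp] theorem length_window (m : ℤ) (n : ℕ) (σ : CodeSpace E) : (window m n σ).length = n := by
  induction n generalizing m with
  | zero => rfl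
  | succ n ih => simp [window, ih]

theorem mem_cyl_cons {m : ℤ} {a : Alphabet E} {l : List (Alphabet E)} {σ : CodeSpace E} :
    σ ∈ cyl m (a :: l) ↔ σ m = a ∧ σ ∈ cyl (m + 1) l := by
  simp only [cyl, Set.mem_ofPred_eq]
  constructor
  · intro h
    refine ⟨by simpa using! h 0 (by simp), fun k hk => ?_⟩
    have := h (k + 1) (by simpa using hk)
    simpa [add_assoc, add_comm, add_left_comm] using this
  · rintro ⟨h0, h⟩ k hk
    rcases k with _ | k
    · simpa using h0
    · have := h k (by simpa using hk)
      simpa [add_assoc, add_comm, add_left_comm] using this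

theorem mem_cyl_iff {m : ℤ} {l : List (Alphabet E)} {σ : CodeSpace E} :
    σ ∈ cyl m l ↔ window m l.length σ = l := by
  induction l generalizing m with
  | nil => simp [cyl, window]
  | cons a l ih => rw [mem_cyl_cons, ih]; simp [window]

theorem mem_cyl_window (m : ℤ) (n : ℕ) (σ : CodeSpace E) : σ ∈ cyl m (window m n σ) :=
  mem_cyl_iff.2 (by rw [length_window])

theorem window_add (m : ℤ) (n k : ℕ) (σ : CodeSpace E) :
    window m (n + k) σ = window m n σ ++ window (m + n) k σ := by
  induction n generalizing m with
  | zero => simp [window]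
  | succ n ih =>
    rw [show n + 1 + k = (n + k) + 1 by ring]
    simp only [window, List.cons_append, List.cons.injEq, true_and]
    rw [ih]
    congr 2
    push_cast
    ring

theorem window_succ_right (m : ℤ) (n : ℕ) (σ : CodeSpace E) :
    window m (n + 1) σ = window m n σ ++ [σ (m + n)] := window_add m n 1 σ

theorem mem_cyl_append {m : ℤ} {u v : List (Alphabet E)} {σ : CodeSpace E} :
    σ ∈ cyl m (u ++ v) ↔ σ ∈ cyl m u ∧ σ ∈ cyl (m + u.length) v := by
  simp only [mem_cyl_iff, List.length_append, window_add]
  constructor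
  · intro h
    exact List.append_inj h (by simp)
  · rintro ⟨h, h'⟩
    rw [h, h']

theorem mem_cyl_singleton {m : ℤ} {a : Alphabet E} {σ : CodeSpace E} :
    σ ∈ cyl m [a] ↔ σ m = a := by
  simp [mem_cyl_iff, window]

theorem window_shift (m : ℤ) (n : ℕ) (σ : CodeSpace E) :
    window m n (shift σ) = window (m + 1) n σ := by
  induction n generalizing m with
  | zero => rfl
  | succ n ih => simp [window, ih, shift]

theorem shift_mem_cyl {m : ℤ} {l : List (Alphabet E)} {σ : CodeSpace E} :
    shift σ ∈ cyl m l ↔ σ ∈ cyl (m + 1) l := by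
  simp [mem_cyl_iff, window_shift]

theorem measurable_shift : Measurable (shift : CodeSpace E → CodeSpace E) :=
  measurable_pi_lambda _ fun n => measurable_pi_apply (n + 1)

/-- A word over the larger window fixes all coordinates that the smaller one constrains, so the
cylinders are nested as soon as they meet. Along an increasing sequence of windows they therefore
form a `π`-system, up to the empty set. -/
theorem cyl_inter_cyl {m m' : ℤ} {l l' : List (Alphabet E)} (h : m ≤ m')
    (h' : m' + l'.length ≤ m + l.length) (hne : (cyl m l ∩ cyl m' l').Nonempty) :
    cyl m l ∩ cyl m' l' = cyl m l := by
  refine Set.inter_eq_left.2 fun σ hσ => ?_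
  obtain ⟨τ, hτ, hτ'⟩ := hne
  intro k hk
  rw [← hτ' k hk]
  obtain ⟨j, hj⟩ := Int.eq_ofNat_of_zero_le (sub_nonneg.2 h)
  have hjk : m' + k = m + ((j + k : ℕ) : ℤ) := by push_cast; omega
  have hlt : j + k < l.length := by omega
  rw [hjk, hσ _ hlt, hτ _ hlt]

/-- The map that lays out a one-sided sequence of pairs as a two-sided sequence. -/
def unfoldPairs (τ : ℕ → Alphabet E × Alphabet E) : CodeSpace E
  | Int.ofNat k => (τ k).1
  | Int.negSucc k => (τ k).2

/-- The word `b_n ⋯ b_0 a_0 ⋯ a_n` of the word of pairs `(a_n, b_n) ⋯ (a_0, b_0)`. -/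
def pairsWord : List (Alphabet E × Alphabet E) → List (Alphabet E)
  | [] => []
  | q :: l => q.2 :: (pairsWord l ++ [q.1])

theorem measurable_unfoldPairs : Measurable (unfoldPairs (E := E)) := by
  refine measurable_pi_lambda _ fun j => ?_
  rcases j with k | k
  · exact measurable_fst.comp (measurable_pi_apply k)
  · exact measurable_snd.comp (measurable_pi_apply k)

/-- A new pair adds one letter at each end of the central window `-n, …, n - 1`. The list is
reversed because `pairsWord` expects the outermost pair first. -/
theorem pairsWord_range (τ : ℕ → Alphabet E × Alphabet E) (n : ℕ) :
    pairsWord ((List.range n).map τ).reverse = window (-(n : ℤ)) (2 * n) (unfoldPairs τ) := by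
  induction n with
  | zero => rfl
  | succ n ih =>
    rw [List.range_succ, List.map_append, List.reverse_append]
    simp only [List.map_cons, List.map_nil, List.reverse_cons, List.reverse_nil, List.nil_append,
      List.singleton_append, pairsWord]
    have e1 : -((n + 1 : ℕ) : ℤ) = Int.negSucc n := rfl
    have e2 : Int.negSucc n + 1 = -(n : ℤ) := by omega
    have e3 : -(n : ℤ) + (2 * n : ℕ) = Int.ofNat n := by push_cast; simp; ring
    rw [ih, show 2 * (n + 1) = (2 * n + 1) + 1 by ring, window, window_succ_right, e1, e2, e3]
    rfl

theorem surjective_unfoldPairs : Function.Surjective (unfoldPairs (E := E)) := by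
  intro σ
  refine ⟨fun k => (σ (Int.ofNat k), σ (Int.negSucc k)), funext fun j => ?_⟩
  rcases j with k | k <;> rfl

variable [Countable E]

/-- There are only countably many words, so every preimage is a countable union of cylinders. The
`σ`-algebra is left free because the full one, the past and generated ones are all needed. -/
theorem measurable_comp_window {β : Type*} [MeasurableSpace β] {𝓜 : MeasurableSpace (CodeSpace E)}
    {m : ℤ} {n : ℕ} (h : ∀ l : List (Alphabet E), l.length = n → MeasurableSet[𝓜] (cyl m l))
    (φ : List (Alphabet E) → β) : Measurable[𝓜] fun σ => φ (window m n σ) := by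
  intro s _
  have : (fun σ : CodeSpace E => φ (window m n σ)) ⁻¹' s =
      ⋃ l : {l : List (Alphabet E) // l.length = n ∧ φ l ∈ s}, cyl m l.1 := by
    ext σ
    simp only [Set.mem_preimage, Set.mem_iUnion, mem_cyl_iff]
    constructor
    · intro hs
      exact ⟨⟨window m n σ, by simp, hs⟩, by simp⟩
    · rintro ⟨⟨l, rfl, hl⟩, h⟩
      simpa only [h] using hl
  rw [this]
  exact MeasurableSet.iUnion fun l => h _ l.2.1

theorem lintegral_window (Λ : Measure (CodeSpace E)) (m : ℤ) (n : ℕ)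
    (φ : List (Alphabet E) → ℝ≥0∞) :
    ∫⁻ σ, φ (window m n σ) ∂Λ = wsum n fun l => φ l * Λ (cyl m l) := by
  classical
  have h : ∀ σ : CodeSpace E, φ (window m n σ) =
      wsum n fun l => (cyl m l).indicator (fun _ => φ l) σ := by
    intro σ
    unfold wsum
    rw [tsum_eq_single ⟨window m n σ, by simp⟩]
    · exact (Set.indicator_of_mem (mem_cyl_window m n σ) fun _ => φ (window m n σ)).symm
    · rintro ⟨l, rfl⟩ hl
      refine Set.indicator_of_notMem (fun hσ => hl ?_) _
      exact Subtype.ext (mem_cyl_iff.1 hσ).symm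
  simp_rw [h]
  rw [lintegral_wsum _ _ fun l => measurable_const.indicator (measurableSet_cyl m l)]
  refine wsum_congr fun l _ => ?_
  rw [lintegral_indicator_const (measurableSet_cyl m l)]

theorem tsum_measure_inter_cyl_singleton (Λ : Measure (CodeSpace E)) (k : ℤ)
    {s : Set (CodeSpace E)} (hs : MeasurableSet s) :
    ∑' a, Λ (s ∩ cyl k [a]) = Λ s := by
  rw [← measure_iUnion]
  · congr 1
    ext σ
    simp [mem_cyl_singleton]
  · intro a b hab
    refine Set.disjoint_left.2 fun σ h h' => hab ?_
    rw [← mem_cyl_singleton.1 h.2, ← mem_cyl_singleton.1 h'.2]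
  · exact fun a => hs.inter (measurableSet_cyl k _)

theorem tsum_measure_cyl_append (Λ : Measure (CodeSpace E)) (m : ℤ) (l : List (Alphabet E)) :
    ∑' a, Λ (cyl m (l ++ [a])) = Λ (cyl m l) := by
  rw [← tsum_measure_inter_cyl_singleton Λ (m + l.length) (measurableSet_cyl m l)]
  refine tsum_congr fun a => ?_
  congr 1
  ext σ
  simp [mem_cyl_append]

theorem tsum_measure_cyl_cons (Λ : Measure (CodeSpace E)) (m : ℤ) (l : List (Alphabet E)) :
    ∑' a, Λ (cyl (m - 1) (a :: l)) = Λ (cyl m l) := by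
  rw [← tsum_measure_inter_cyl_singleton Λ (m - 1) (measurableSet_cyl m l)]
  refine tsum_congr fun a => ?_
  congr 1
  ext σ
  rw [Set.mem_inter_iff, mem_cyl_singleton, mem_cyl_cons, sub_add_cancel, and_comm]

/-! ### The `π`-systems of cylinder sets -/

theorem measurable_eval_of_windows {𝓜 : MeasurableSpace (CodeSpace E)} {m : ℤ} {n : ℕ}
    (h : ∀ l : List (Alphabet E), l.length = n → MeasurableSet[𝓜] (cyl m l)) {k : ℕ} (hk : k < n) :
    Measurable[𝓜] fun σ : CodeSpace E => σ (m + k) := by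
  -- The default letter is never read, since `k < n`.
  have h1 := measurable_comp_window (𝓜 := 𝓜) h (fun l => (l[k]?).getD (none : Option E))
  have h2 : ∀ σ : CodeSpace E, ((window m n σ)[k]?).getD (none : Option E) = σ (m + k) := by
    intro σ
    have h3 := mem_cyl_window m n σ k (by simpa using hk)
    rw [h3, List.getElem?_eq_getElem (by simpa using hk)]
    rfl
  simpa only [h2] using! h1

/-- Two probability measures on the code space that agree on the cylinder sets starting at
non-positive times are equal. -/
theorem measure_ext_of_cyl {Λ Λ' : Measure (CodeSpace E)} [IsProbabilityMeasure Λ]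
    [IsProbabilityMeasure Λ']
    (h : ∀ m : ℤ, m ≤ 0 → ∀ l : List (Alphabet E), l ≠ [] → Λ (cyl m l) = Λ' (cyl m l)) :
    Λ = Λ' := by
  refine ext_of_generate_finite
    {A | A = ∅ ∨ ∃ (n : ℕ) (l : List (Alphabet E)), l.length = 2 * n + 1 ∧ A = cyl (-(n : ℤ)) l}
    ?_ ?_ ?_ (by simp)
  · refine le_antisymm ?_ (MeasurableSpace.generateFrom_le ?_)
    · refine iSup_le fun j => measurable_iff_comap_le.1 ?_
      have h1 : j = -(j.natAbs : ℤ) + ((j + j.natAbs).toNat : ℕ) := by omega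
      rw [h1]
      refine measurable_eval_of_windows (n := 2 * j.natAbs + 1) (fun l hl => ?_) (by omega)
      exact MeasurableSpace.measurableSet_generateFrom (Or.inr ⟨_, l, hl, rfl⟩)
    · rintro A (rfl | ⟨n, l, -, rfl⟩)
      · exact MeasurableSet.empty
      · exact measurableSet_cyl _ _
  · rintro A (rfl | ⟨n, l, hl, rfl⟩) B (rfl | ⟨n', l', hl', rfl⟩) hne
    · simp at hne
    · simp at hne
    · simp at hne
    · rcases le_total n n' with hn | hn
      · rw [Set.inter_comm] at hne ⊢
        rw [cyl_inter_cyl (by omega) (by omega) hne]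
        exact Or.inr ⟨n', l', hl', rfl⟩
      · rw [cyl_inter_cyl (by omega) (by omega) hne]
        exact Or.inr ⟨n, l, hl, rfl⟩
  · rintro A (rfl | ⟨n, l, hl, rfl⟩)
    · simp
    · exact h _ (by simp) _ (by rintro rfl; simp at hl)

/-- A consistent and stationary family of weights of finite words comes from a measure on the code
space. -/
theorem exists_measure_of_word_weights (q : List (Alphabet E) → ℝ≥0∞) (h0 : q [] = 1)
    (hr : ∀ l, ∑' a, q (l ++ [a]) = q l) (hl : ∀ l, ∑' a, q (a :: l) = q l) :
    ∃ Λ : Measure (CodeSpace E), IsProbabilityMeasure Λ ∧ ∀ m l, Λ (cyl m l) = q l := by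
  have : DiscreteMeasurableSpace (Alphabet E × Alphabet E) := inferInstance
  -- Summing out one pair sums out the leftmost and the rightmost letter, so one-sided consistency
  -- for pairs combines `hl` and `hr`.
  obtain ⟨P, hP, hPq⟩ := exists_measure_nat_of_word_weights (A := Alphabet E × Alphabet E)
    (fun l => q (pairsWord l.reverse)) h0 (by
      intro l
      simp only [List.reverse_append, List.reverse_cons, List.reverse_nil, List.nil_append,
        List.singleton_append, pairsWord]
      rw [ENNReal.tsum_prod (f := fun a b => q (b :: (pairsWord l.reverse ++ [a])))]
      simp_rw [hl]
      exact hr _)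
  refine ⟨P.map unfoldPairs, Measure.isProbabilityMeasure_map measurable_unfoldPairs.aemeasurable,
    ?_⟩
  have key : ∀ (n : ℕ) (l : List (Alphabet E)), l.length = 2 * n →
      P.map unfoldPairs (cyl (-(n : ℤ)) l) = q l := by
    intro n l hn
    let σ : CodeSpace E := fun j => (l[(j + n).toNat]?).getD (none : Option E)
    have hσ : σ ∈ cyl (-(n : ℤ)) l := by
      intro k hk
      simp only [σ]
      rw [show (-(n : ℤ) + k + n).toNat = k by omega, List.getElem?_eq_getElem hk]
      rfl
    obtain ⟨τ, hτ⟩ := surjective_unfoldPairs σ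
    rw [Measure.map_apply measurable_unfoldPairs (measurableSet_cyl _ _)]
    have h1 : unfoldPairs ⁻¹' (cyl (-(n : ℤ)) l) = {τ' | ∀ k < n, τ' k = τ k} := by
      rw [← hτ] at hσ
      ext τ'
      simp only [Set.mem_preimage, Set.mem_ofPred_eq]
      constructor
      · intro h k hk
        have e : ∀ j : ℤ, -n ≤ j → j < n → unfoldPairs τ' j = unfoldPairs τ j := by
          intro j h1 h2
          have hj : j = -(n : ℤ) + ((j + n).toNat : ℕ) := by omega
          rw [hj, h _ (by omega), hσ _ (by omega)]
        exact Prod.ext (e (Int.ofNat k) (by simp) (by simpa using hk))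
          (e (Int.negSucc k) (by omega) (by omega))
      · intro h
        rw [mem_cyl_iff] at hσ ⊢
        rw [hn] at hσ ⊢
        rw [← hσ, ← pairsWord_range, ← pairsWord_range]
        congr 2
        exact List.map_congr_left fun k hk => h k (List.mem_range.1 hk)
    rw [h1, hPq, pairsWord_range, hτ, ← hn, mem_cyl_iff.1 hσ]
  have hright : ∀ (m : ℤ) (n k : ℕ),
      (∀ l : List (Alphabet E), l.length = n + k → P.map unfoldPairs (cyl m l) = q l) →
      ∀ l : List (Alphabet E), l.length = n → P.map unfoldPairs (cyl m l) = q l := by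
    intro m n k
    induction k with
    | zero => exact fun h => h
    | succ k ih =>
      intro h
      refine ih fun l hl => ?_
      rw [← tsum_measure_cyl_append, ← hr]
      exact tsum_congr fun a => h _ (by simp [hl]; ring)
  have hleft : ∀ (k : ℕ) (m : ℤ) (n : ℕ),
      (∀ l : List (Alphabet E), l.length = n + k → P.map unfoldPairs (cyl (m - k) l) = q l) →
      ∀ l : List (Alphabet E), l.length = n → P.map unfoldPairs (cyl m l) = q l := by
    intro k
    induction k with
    | zero => simp
    | succ k ih =>
      intro m n h
      refine ih m n fun l hl' => ?_
      rw [← tsum_measure_cyl_cons, ← hl]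
      refine tsum_congr fun a => ?_
      rw [← h (a :: l) (by simp [hl']; ring)]
      congr 2
      push_cast
      ring
  intro m l
  -- Any window sits inside a central one: `k` letters are added on the left and `j` on the right,
  -- and then summed out again.
  obtain ⟨n, k, j, h1, h2⟩ : ∃ n k j : ℕ, m - k = -(n : ℤ) ∧ l.length + k + j = 2 * n := by
    refine ⟨m.natAbs + l.length, (m + (m.natAbs + l.length)).toNat, ?_, ?_, ?_⟩
    · exact (2 * (m.natAbs + l.length : ℤ) - l.length - (m + (m.natAbs + l.length))).toNat
    · omega
    · omega
  refine hleft k m l.length (fun l' hl' => ?_) l rfl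
  refine hright (m - k) (l.length + k) j (fun l'' hl'' => ?_) l' hl'
  rw [h1]
  exact key n l'' (by omega)

end Windows

theorem tsum_alphabet {E : Type*} (f : Alphabet E → ℝ≥0∞) (h : f (none : Option E) = 0) :
    ∑' a, f a = ∑' e : E, f (letter e) := by
  refine (tsum_eq_tsum_of_ne_zero_bij (fun e => letter e.1) ?_ ?_ fun _ => rfl)
  · intro e e' h
    exact Subtype.ext (Option.some_injective _ h)
  · rintro (_ | e) ha
    · exact absurd h ha
    · exact ⟨⟨e, ha⟩, rfl⟩

namespace MarkovSystem

variable {K : Type*} [MetricSpace K] [MeasurableSpace K] [BorelSpace K]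
  {N : Set ℕ} {E : Type*} [Countable E] (M : MarkovSystem K N E)

/-! ### Letters -/

/-- The probability of the letter `a` at `z`, as an extended nonnegative real. -/
def prob (a : Alphabet E) (z : K) : ℝ≥0∞ := ENNReal.ofReal (M.pExt a z)

@[simp] theorem prob_letter (e : E) (z : K) : M.prob (letter e) z = ENNReal.ofReal (M.p e z) := rfl

@[simp] theorem prob_none (z : K) : M.prob (none : Option E) z = 0 := ENNReal.ofReal_zero

theorem measurable_prob (a : Alphabet E) : Measurable (M.prob a) := by
  rcases a with _ | e
  · exact measurable_const.ennreal_ofReal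
  · exact (M.p_measurable e).ennreal_ofReal

theorem measurable_wExt (a : Alphabet E) : Measurable (M.wExt a) := by
  rcases a with _ | e
  · exact measurable_id
  · exact M.w_measurable e

theorem mem_cell_of_prob_ne_zero {a : Alphabet E} {z : K} (h : M.prob a z ≠ 0) :
    z ∈ M.cell (M.iExt a) := by
  rcases a with _ | e
  · exact absurd (M.prob_none z) h
  · by_contra hz
    exact h (by change ENNReal.ofReal (M.p e z) = 0; rw [M.p_eq_zero e z hz, ENNReal.ofReal_zero])

theorem wExt_mem {a : Alphabet E} {z : K} (h : z ∈ M.cell (M.iExt a)) :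
    M.wExt a z ∈ M.cell (M.tExt a) := by
  rcases a with _ | e
  · exact h
  · exact M.w_mapsTo e h

theorem cell_unique {j k : N} {z : K} (hj : z ∈ M.cell j) (hk : z ∈ M.cell k) : j = k := by
  by_contra h
  exact Set.disjoint_left.1 (M.cell_disjoint h) hj hk

theorem exists_cell (z : K) : ∃ j, z ∈ M.cell j := by
  have := M.cell_cover ▸ Set.mem_univ z
  simpa using this

/-- The vertex `j` with `z ∈ K_j`. -/
def vertex (z : K) : N := (M.exists_cell z).choose

theorem mem_cell_vertex (z : K) : z ∈ M.cell (M.vertex z) := (M.exists_cell z).choose_spec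

theorem vertex_eq {j : N} {z : K} (h : z ∈ M.cell j) : M.vertex z = j :=
  M.cell_unique (M.mem_cell_vertex z) h

theorem measurable_vertex : Measurable M.vertex := by
  refine measurable_to_countable' fun j => ?_
  convert M.cell_measurable j using 1
  ext z
  exact ⟨fun h => h ▸ M.mem_cell_vertex z, fun h => M.vertex_eq h⟩

/-- Letters that do not leave `j` have probability zero at `z`. This permits sums over the whole
alphabet, with no bookkeeping of the vertex. -/
theorem tsum_alphabet_eq {j : N} {z : K} (hz : z ∈ M.cell j) (g : Alphabet E → ℝ≥0∞) :
    ∑' a, M.prob a z * g a =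
      ∑' e : {e : E // M.i e = j}, ENNReal.ofReal (M.p e z) * g (letter e.1) := by
  rw [tsum_alphabet _ (by simp)]
  refine (tsum_subtype_eq_of_support_subset
    (f := fun e : E => ENNReal.ofReal (M.p e z) * g (letter e)) (s := {e | M.i e = j}) ?_).symm
  intro e he
  have : M.prob (letter e) z ≠ 0 := fun h => he (by simp only [← prob_letter, h, zero_mul])
  exact M.cell_unique (M.mem_cell_of_prob_ne_zero this) hz

theorem tsum_prob (z : K) : ∑' a, M.prob a z = 1 := by
  have h := M.tsum_alphabet_eq (M.mem_cell_vertex z) (fun _ => 1)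
  simp only [mul_one] at h
  rw [h, ← ENNReal.ofReal_tsum_of_nonneg (fun e => (M.p_mem _ _).1)
    (M.p_sum _ z (M.mem_cell_vertex z)).summable, (M.p_sum _ z (M.mem_cell_vertex z)).tsum_eq,
    ENNReal.ofReal_one]

theorem prob_le_one (a : Alphabet E) (z : K) : M.prob a z ≤ 1 :=
  (ENNReal.le_tsum a).trans (M.tsum_prob z).le

theorem markovOp_eq (f : K → ℝ≥0∞) (z : K) :
    M.markovOp f z = ∑' a, M.prob a z * f (M.wExt a z) := by
  rw [tsum_alphabet _ (by simp)]
  rfl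

theorem measurable_markovOp {f : K → ℝ≥0∞} (hf : Measurable f) : Measurable (M.markovOp f) :=
  Measurable.tsum fun e => (M.p_measurable e).ennreal_ofReal.mul (hf.comp (M.w_measurable e))

theorem markovOp_mono {f g : K → ℝ≥0∞} (h : ∀ z, f z ≤ g z) (z : K) :
    M.markovOp f z ≤ M.markovOp g z :=
  ENNReal.tsum_le_tsum fun _ => mul_le_mul_right (h _) _

theorem markovOp_const (c : ℝ≥0∞) (z : K) : M.markovOp (fun _ => c) z = c := by
  rw [markovOp_eq, ENNReal.tsum_mul_right, tsum_prob, one_mul]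

theorem lintegral_markovOp {μ : Measure K} (hμ : M.adj μ = μ) {f : K → ℝ≥0∞}
    (hf : Measurable f) : ∫⁻ z, M.markovOp f z ∂μ = ∫⁻ z, f z ∂μ := by
  rw [← lintegral_adj M μ hf, hμ]

theorem isProbabilityMeasure_adj (ν : Measure K) [IsProbabilityMeasure ν] :
    IsProbabilityMeasure (M.adj ν) := by
  refine ⟨?_⟩
  have h := M.lintegral_adj ν (f := fun _ => 1) measurable_const
  simpa [markovOp_const] using h

theorem isProbabilityMeasure_iterate_adj (y : K) (k : ℕ) :
    IsProbabilityMeasure (M.adj^[k] (Measure.dirac y)) := by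
  induction k with
  | zero => rw [Function.iterate_zero_apply]; infer_instance
  | succ k ih => rw [Function.iterate_succ_apply']; exact M.isProbabilityMeasure_adj _

/-! ### Words -/

/-- The composition `w_{e_n} ∘ ⋯ ∘ w_{e_0}` along the word `e_0 ⋯ e_n`. -/
def wordMap : List (Alphabet E) → K → K
  | [], z => z
  | a :: l, z => wordMap l (M.wExt a z)

theorem pathProb_cons (a : Alphabet E) (l : List (Alphabet E)) (z : K) :
    M.pathProb (a :: l) z = M.prob a z * M.pathProb l (M.wExt a z) := rfl

theorem measurable_wordMap (l : List (Alphabet E)) : Measurable (M.wordMap l) := by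
  induction l with
  | nil => exact measurable_id
  | cons a l ih => exact ih.comp (M.measurable_wExt a)

theorem measurable_pathProb (l : List (Alphabet E)) : Measurable (M.pathProb l) := by
  induction l with
  | nil => exact measurable_const
  | cons a l ih => exact (M.measurable_prob a).mul (ih.comp (M.measurable_wExt a))

theorem wordMap_append (u v : List (Alphabet E)) (z : K) :
    M.wordMap (u ++ v) z = M.wordMap v (M.wordMap u z) := by
  induction u generalizing z with
  | nil => rfl
  | cons a u ih => exact ih _

theorem pathProb_append (u v : List (Alphabet E)) (z : K) :
    M.pathProb (u ++ v) z = M.pathProb u z * M.pathProb v (M.wordMap u z) := by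
  induction u generalizing z with
  | nil => simp [pathProb, wordMap]
  | cons a u ih => rw [List.cons_append, pathProb_cons, ih, pathProb_cons, mul_assoc]; rfl

theorem pathProb_singleton (a : Alphabet E) (z : K) : M.pathProb [a] z = M.prob a z := by
  rw [pathProb_cons]
  simp [pathProb]

theorem pathProb_le_one (l : List (Alphabet E)) (z : K) : M.pathProb l z ≤ 1 := by
  induction l generalizing z with
  | nil => exact le_rfl
  | cons a l ih => exact mul_le_one' (M.prob_le_one a z) (ih _)

theorem tsum_pathProb_append (l : List (Alphabet E)) (z : K) :
    ∑' a, M.pathProb (l ++ [a]) z = M.pathProb l z := by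
  simp_rw [pathProb_append, pathProb_singleton]
  rw [ENNReal.tsum_mul_left, tsum_prob, mul_one]

theorem wsum_pathProb_succ (n : ℕ) (φ : List (Alphabet E) → K → ℝ≥0∞) (z : K) :
    wsum (n + 1) (fun l => M.pathProb l z * φ l z) =
      ∑' a, M.prob a z * wsum n fun l => M.pathProb l (M.wExt a z) * φ (a :: l) z := by
  rw [wsum_succ]
  refine tsum_congr fun a => ?_
  rw [← wsum_mul_left]
  refine wsum_congr fun l _ => ?_
  rw [pathProb_cons, mul_assoc]

theorem wsum_pathProb_comp_succ (n : ℕ) (f : K → ℝ≥0∞) (z : K) :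
    wsum (n + 1) (fun l => M.pathProb l z * f (M.wordMap l z)) =
      M.markovOp (fun y => wsum n fun l => M.pathProb l y * f (M.wordMap l y)) z := by
  rw [M.wsum_pathProb_succ n fun l z => f (M.wordMap l z), markovOp_eq]
  rfl

/-- The integrand on the left is `U^n f`. -/
theorem lintegral_wsum_pathProb {μ : Measure K} (hμ : M.adj μ = μ) {f : K → ℝ≥0∞}
    (hf : Measurable f) (n : ℕ) :
    ∫⁻ z, wsum n (fun l => M.pathProb l z * f (M.wordMap l z)) ∂μ = ∫⁻ z, f z ∂μ := by
  induction n with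
  | zero => simp [wsum_zero, pathProb, wordMap]
  | succ n ih =>
    simp_rw [wsum_pathProb_comp_succ]
    rw [M.lintegral_markovOp hμ, ih]
    exact measurable_wsum n fun l =>
      (M.measurable_pathProb l).mul (hf.comp (M.measurable_wordMap l))

theorem wsum_pathProb (n : ℕ) (z : K) : wsum n (fun l => M.pathProb l z) = 1 := by
  induction n generalizing z with
  | zero => simp [wsum_zero, pathProb]
  | succ n ih =>
    have := M.wsum_pathProb_succ n (fun _ _ => 1) z
    simp only [mul_one] at this
    rw [this]
    simp_rw [ih, mul_one]
    exact M.tsum_prob z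

/-! ### Contraction along words -/

/-- Contraction on average with rate `ρ`, as a sum over the extended alphabet. -/
def ContractsBy (ρ : ℝ≥0∞) : Prop :=
  ∀ j, ∀ y ∈ M.cell j, ∀ z ∈ M.cell j,
    ∑' a, M.prob a y * edist (M.wExt a y) (M.wExt a z) ≤ ρ * edist y z

variable {M} in
theorem Contractive.contractsBy (h : M.Contractive) : ∃ ρ < 1, M.ContractsBy ρ := by
  obtain ⟨a, -, ha, h⟩ := h
  refine ⟨ENNReal.ofReal a, by simpa using ha, fun j y hy z hz => ?_⟩
  rw [M.tsum_alphabet_eq hy fun a => edist (M.wExt a y) (M.wExt a z)]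
  exact h j y hy z hz

variable {M} in
-- A letter of positive probability at `y` leaves `j`, so both images again share a vertex set and
-- the one-step contraction can be iterated.
theorem ContractsBy.wsum_le {ρ : ℝ≥0∞} (h : M.ContractsBy ρ) (n : ℕ) {j : N} {y z : K}
    (hy : y ∈ M.cell j) (hz : z ∈ M.cell j) :
    wsum n (fun l => M.pathProb l y * edist (M.wordMap l y) (M.wordMap l z)) ≤
      ρ ^ n * edist y z := by
  induction n generalizing j y z with
  | zero => simp [wsum_zero, pathProb, wordMap]
  | succ n ih =>
    rw [M.wsum_pathProb_succ n fun l y => edist (M.wordMap l y) (M.wordMap l z)]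
    calc _ ≤ ∑' a, ρ ^ n * (M.prob a y * edist (M.wExt a y) (M.wExt a z)) := by
          refine ENNReal.tsum_le_tsum fun a => ?_
          by_cases ha : M.prob a y = 0
          · simp [ha]
          · have hj := M.cell_unique (M.mem_cell_of_prob_ne_zero ha) hy
            subst hj
            rw [mul_left_comm]
            exact mul_le_mul_right (ih (M.wExt_mem hy) (M.wExt_mem hz)) _
      _ ≤ ρ ^ n * (ρ * edist y z) := by
          rw [ENNReal.tsum_mul_left]
          exact mul_le_mul_right (h _ _ hy _ hz) _
      _ = _ := by rw [pow_succ, mul_assoc]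

/-- The distance from `z` to the base point of its vertex set. -/
def baseDist (x : N → K) (z : K) : ℝ≥0∞ := edist z (x (M.vertex z))

/-- `K` need not be separable, so joint measurability of `edist` is unavailable. With countably many
base points, measurability in the first variable suffices. -/
theorem measurable_baseDist (x : N → K) : Measurable (M.baseDist x) := by
  have h : Measurable fun q : K × N => edist q.1 (x q.2) :=
    measurable_from_prod_countable_left fun j =>
      (measurable_edist_left : Measurable fun z => edist z (x j))
  exact h.comp (measurable_id.prodMk M.measurable_vertex)

theorem baseDist_eq {x : N → K} {j : N} {z : K} (h : z ∈ M.cell j) :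
    M.baseDist x z = edist z (x j) := by
  rw [baseDist, M.vertex_eq h]

variable {M} in
theorem ContractsBy.wsum_base_le {ρ : ℝ≥0∞} (h : M.ContractsBy ρ) {x : N → K}
    (hx : ∀ j, x j ∈ M.cell j) (n : ℕ) (z : K) :
    wsum n (fun l => M.pathProb l z * edist (M.wordMap l z) (M.wordMap l (x (M.vertex z)))) ≤
      ρ ^ n * M.baseDist x z :=
  h.wsum_le n (M.mem_cell_vertex z) (hx _)

theorem tsum_prob_mul_edist_base_le (x : N → K) {j : N} {z : K} (hz : z ∈ M.cell j) :
    ∑' a, M.prob a z * edist (M.wExt a (x j)) (x (M.tExt a)) ≤ M.bConst x := by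
  rw [M.tsum_alphabet_eq hz fun a => edist (M.wExt a (x j)) (x (M.tExt a))]
  exact le_iSup_of_le j (le_iSup₂_of_le z hz le_rfl)

variable {M} in
-- Triangle inequality through the image of the base point: the first leg contracts, the second is
-- bounded by `b`.
theorem ContractsBy.drift {ρ : ℝ≥0∞} (h : M.ContractsBy ρ) {x : N → K}
    (hx : ∀ j, x j ∈ M.cell j) (z : K) :
    ∑' a, M.prob a z * edist (M.wExt a z) (x (M.tExt a)) ≤ ρ * M.baseDist x z + M.bConst x := by
  calc _ ≤ ∑' a, (M.prob a z * edist (M.wExt a z) (M.wExt a (x (M.vertex z))) +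
        M.prob a z * edist (M.wExt a (x (M.vertex z))) (x (M.tExt a))) := by
        refine ENNReal.tsum_le_tsum fun a => ?_
        rw [← mul_add]
        exact mul_le_mul_right (edist_triangle _ _ _) _
    _ ≤ _ := by
        rw [ENNReal.tsum_add]
        exact add_le_add (h _ _ (M.mem_cell_vertex z) _ (hx _))
          (M.tsum_prob_mul_edist_base_le x (M.mem_cell_vertex z))

variable {M} in
theorem ContractsBy.markovOp_baseDist_le {ρ : ℝ≥0∞} (h : M.ContractsBy ρ) {x : N → K}
    (hx : ∀ j, x j ∈ M.cell j) (z : K) :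
    M.markovOp (M.baseDist x) z ≤ ρ * M.baseDist x z + M.bConst x := by
  refine le_trans (le_of_eq ?_) (h.drift hx z)
  rw [markovOp_eq]
  refine tsum_congr fun a => ?_
  by_cases ha : M.prob a z = 0
  · simp [ha]
  · rw [M.baseDist_eq (M.wExt_mem (M.mem_cell_of_prob_ne_zero ha))]

variable {M} in
/-- The distance to the base points is integrable with respect to invariant measures. -/
theorem ContractsBy.lintegral_baseDist_le {ρ : ℝ≥0∞} (h : M.ContractsBy ρ) (hρ : ρ < 1) {x : N → K}
    (hx : ∀ j, x j ∈ M.cell j) {μ : Measure K} [IsProbabilityMeasure μ] (hμ : M.adj μ = μ) :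
    ∫⁻ z, M.baseDist x z ∂μ ≤ (1 - ρ)⁻¹ * M.bConst x := by
  set b := M.bConst x
  set V := M.baseDist x
  have hV : Measurable V := M.measurable_baseDist x
  have hρt : ρ ≠ ∞ := (hρ.trans ENNReal.one_lt_top).ne
  -- Integrability of `V` is not yet known, so the drift inequality is iterated under a truncation.
  -- The cap `R` then dominates as `n → ∞` removes `ρ ^ n * V`, and `R → ∞` comes last.
  have step : ∀ (R : ℕ) (n : ℕ), ∫⁻ z, min (V z) R ∂μ ≤
      ∫⁻ z, min (ρ ^ n * V z + (∑ k ∈ Finset.range n, ρ ^ k) * b) R ∂μ := by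
    intro R n
    induction n with
    | zero => simp
    | succ n ih =>
      refine ih.trans ?_
      rw [← M.lintegral_markovOp hμ (((hV.const_mul _).add_const _).min measurable_const)]
      refine lintegral_mono fun z => le_min ?_ ?_
      · set c := (∑ k ∈ Finset.range n, ρ ^ k) * b
        calc _ ≤ M.markovOp (fun z => ρ ^ n * V z + c) z :=
              M.markovOp_mono (fun z => min_le_left _ _) z
          _ = ρ ^ n * M.markovOp V z + c := by
              simp only [markovOp_eq, mul_add, ENNReal.tsum_add, ENNReal.tsum_mul_right,
                tsum_prob, one_mul]
              rw [← ENNReal.tsum_mul_left]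
              simp only [mul_left_comm]
          _ ≤ ρ ^ n * (ρ * V z + b) + c := by
              gcongr
              exact h.markovOp_baseDist_le hx z
          _ = _ := by
              rw [Finset.sum_range_succ]
              simp only [c]
              ring
      · exact (M.markovOp_mono (fun z => min_le_right _ _) z).trans (M.markovOp_const _ z).le
  have hR : ∀ R : ℕ, ∫⁻ z, min (V z) R ∂μ ≤ (1 - ρ)⁻¹ * b := by
    intro R
    have h1 : Tendsto (fun n : ℕ => ∫⁻ z, min (ρ ^ n * V z + (1 - ρ)⁻¹ * b) R ∂μ) atTop
        (𝓝 (∫⁻ z, min (0 + (1 - ρ)⁻¹ * b) R ∂μ)) := by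
      refine tendsto_lintegral_of_dominated_convergence (fun _ => (R : ℝ≥0∞))
        (fun n => ((hV.const_mul _).add_const _).min measurable_const)
        (fun n => Eventually.of_forall fun z => min_le_right _ _) (by simp) ?_
      refine Eventually.of_forall fun z => ?_
      refine Tendsto.min (Tendsto.add ?_ tendsto_const_nhds) tendsto_const_nhds
      have : V z ≠ ∞ := edist_ne_top _ _
      simpa using ENNReal.Tendsto.mul_const (ENNReal.tendsto_pow_atTop_nhds_zero_of_lt_one hρ)
        (Or.inr this)
    refine (ge_of_tendsto h1 (Eventually.of_forall fun n => (step R n).trans ?_)).trans ?_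
    · refine lintegral_mono fun z => min_le_min (add_le_add le_rfl ?_) le_rfl
      gcongr
      rw [← ENNReal.tsum_geometric]
      exact ENNReal.sum_le_tsum _
    · simp
  have hsup : ∀ z, V z = ⨆ R : ℕ, min (V z) R := by
    intro z
    refine le_antisymm ?_ (iSup_le fun R => min_le_left _ _)
    obtain ⟨R, hR⟩ := ENNReal.exists_nat_gt (edist_ne_top z (x (M.vertex z)))
    exact le_iSup_of_le R (le_min le_rfl hR.le)
  rw [lintegral_congr hsup, lintegral_iSup (fun R => hV.min measurable_const)]
  · exact iSup_le hR
  · intro R R' hRR z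
    exact min_le_min le_rfl (by exact_mod_cast hRR)

variable {M} in
-- The drift inequality preserves the bound since `1 + ρ (1 - ρ)⁻¹ = (1 - ρ)⁻¹`. Uniformity in `k`
-- lets it pass to time averages.
theorem ContractsBy.lintegral_baseDist_iterate_le {ρ : ℝ≥0∞} (h : M.ContractsBy ρ) (hρ : ρ < 1)
    {x : N → K} (hx : ∀ j, x j ∈ M.cell j) (y : K) (k : ℕ) :
    ∫⁻ z, M.baseDist x z ∂(M.adj^[k] (Measure.dirac y)) ≤
      M.baseDist x y + (1 - ρ)⁻¹ * M.bConst x := by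
  induction k with
  | zero => simp [lintegral_dirac' _ (M.measurable_baseDist x)]
  | succ k ih =>
    rw [Function.iterate_succ_apply', M.lintegral_adj _ (M.measurable_baseDist x)]
    refine (lintegral_mono (h.markovOp_baseDist_le hx)).trans ?_
    have := M.isProbabilityMeasure_iterate_adj y k
    rw [lintegral_add_right _ measurable_const, lintegral_const_mul _ (M.measurable_baseDist x),
      lintegral_const, measure_univ, mul_one]
    have h1 : 1 + ρ * (1 - ρ)⁻¹ = (1 - ρ)⁻¹ := by
      rw [← ENNReal.tsum_geometric, ← ENNReal.tsum_mul_left]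
      conv_rhs => rw [tsum_eq_zero_add' ENNReal.summable]
      simp [pow_succ, mul_comm]
    calc _ ≤ ρ * (M.baseDist x y + (1 - ρ)⁻¹ * M.bConst x) + M.bConst x := by gcongr
      _ = ρ * M.baseDist x y + (1 + ρ * (1 - ρ)⁻¹) * M.bConst x := by ring
      _ ≤ _ := by
        rw [h1]
        exact add_le_add (mul_le_of_le_one_left' hρ.le) le_rfl

end MarkovSystem

/-! ### The past -/

section Past

variable {E : Type*}

theorem measurableSet_past_cyl_neg (n : ℕ) {l : List (Alphabet E)} (hl : l.length = n + 1) :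
    MeasurableSet[pastSigma E] (cyl (-(n : ℤ)) l) :=
  (le_iSup (fun n => pastSigmaFrom E n) n) _
    (MeasurableSpace.measurableSet_generateFrom ⟨l, hl, rfl⟩)

/-- The inverse of the left shift. -/
def unshift (σ : CodeSpace E) : CodeSpace E := fun n => σ (n - 1)

@[simp] theorem unshift_shift (σ : CodeSpace E) : unshift (shift σ) = σ := by
  funext n; simp [unshift, shift]

@[simp] theorem shift_unshift (σ : CodeSpace E) : shift (unshift σ) = σ := by
  funext n; simp [unshift, shift]

theorem shift_preimage_cyl (m : ℤ) (l : List (Alphabet E)) :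
    shift ⁻¹' cyl m l = cyl (m + 1) l := by
  ext σ; exact shift_mem_cyl

theorem unshift_preimage_cyl (m : ℤ) (l : List (Alphabet E)) :
    unshift ⁻¹' cyl m l = cyl (m - 1) l := by
  ext σ
  rw [Set.mem_preimage]
  conv_rhs => rw [← shift_unshift σ, shift_mem_cyl, sub_add_cancel]

theorem pastSigma_eq_generateFrom : pastSigma E = MeasurableSpace.generateFrom
    {A | A = ∅ ∨ ∃ (n : ℕ) (l : List (Alphabet E)), l.length = n + 1 ∧ A = cyl (-(n : ℤ)) l} := by
  refine le_antisymm (iSup_le fun n => MeasurableSpace.generateFrom_le ?_)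
    (MeasurableSpace.generateFrom_le ?_)
  · rintro A ⟨l, hl, rfl⟩
    exact MeasurableSpace.measurableSet_generateFrom (Or.inr ⟨n, l, hl, rfl⟩)
  · rintro A (rfl | ⟨n, l, hl, rfl⟩)
    · exact @MeasurableSet.empty _ (pastSigma E)
    · exact measurableSet_past_cyl_neg n hl

theorem isPiSystem_past : IsPiSystem
    {A | A = ∅ ∨ ∃ (n : ℕ) (l : List (Alphabet E)), l.length = n + 1 ∧ A = cyl (-(n : ℤ)) l} := by
  rintro A (rfl | ⟨n, l, hl, rfl⟩) B (rfl | ⟨n', l', hl', rfl⟩) hne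
  · simp at hne
  · simp at hne
  · simp at hne
  · rcases le_total n n' with hn | hn
    · rw [Set.inter_comm] at hne ⊢
      rw [cyl_inter_cyl (by omega) (by omega) hne]
      exact Or.inr ⟨n', l', hl', rfl⟩
    · rw [cyl_inter_cyl (by omega) (by omega) hne]
      exact Or.inr ⟨n, l, hl, rfl⟩

theorem nextIs_eq (e : E) : nextIs e = (cyl 1 [letter e]).indicator fun _ => (1 : ℝ) := by
  unfold nextIs
  congr 1
  ext σ
  simp [mem_cyl_singleton]

/-- A characterisation of the conditional probability of the next letter given the past. -/
theorem condExp_nextIs_ae_eq {Λ : Measure (CodeSpace E)} [IsProbabilityMeasure Λ] (e : E)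
    {g : CodeSpace E → ℝ} (hg0 : ∀ᵐ σ ∂Λ, 0 ≤ g σ) (hg1 : ∀ᵐ σ ∂Λ, g σ ≤ 1)
    (hgm : AEStronglyMeasurable[pastSigma E] g Λ)
    (h : ∀ A, MeasurableSet[pastSigma E] A →
      Λ (A ∩ cyl 1 [letter e]) = ∫⁻ σ in A, ENNReal.ofReal (g σ) ∂Λ) :
    condExp (pastSigma E) Λ (nextIs e) =ᵐ[Λ] g := by
  have hgi : Integrable g Λ := by
    refine Integrable.of_bound (hgm.mono (pastSigma_le E)) 1 ?_
    filter_upwards [hg0, hg1] with σ h0 h1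
    rwa [Real.norm_of_nonneg h0]
  symm
  refine ae_eq_condExp_of_forall_setIntegral_eq (pastSigma_le E) ?_ (fun _ _ _ => hgi.integrableOn)
    (fun A hA _ => ?_) hgm
  · rw [nextIs_eq]
    exact (integrable_const 1).indicator (measurableSet_cyl _ _)
  · rw [nextIs_eq, setIntegral_indicator (measurableSet_cyl _ _), setIntegral_const, smul_eq_mul,
      mul_one, measureReal_def, h A hA,
      integral_eq_lintegral_of_nonneg_ae (ae_restrict_of_ae hg0) hgi.aestronglyMeasurable.restrict]

theorem measure_inter_cyl_of_condExp {Λ : Measure (CodeSpace E)} [IsProbabilityMeasure Λ] (e : E)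
    {g : CodeSpace E → ℝ} (hg0 : ∀ᵐ σ ∂Λ, 0 ≤ g σ)
    (h : condExp (pastSigma E) Λ (nextIs e) =ᵐ[Λ] g)
    {A : Set (CodeSpace E)} (hA : MeasurableSet[pastSigma E] A) :
    Λ (A ∩ cyl 1 [letter e]) = ∫⁻ σ in A, ENNReal.ofReal (g σ) ∂Λ := by
  have hgi : Integrable g Λ := integrable_condExp.congr h
  have hi : Integrable (nextIs e) Λ := by
    rw [nextIs_eq]
    exact (integrable_const 1).indicator (measurableSet_cyl _ _)
  have h1 : ∫ σ in A, g σ ∂Λ = Λ.real (A ∩ cyl 1 [letter e]) := by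
    rw [← setIntegral_congr_ae₀ (pastSigma_le E _ hA).nullMeasurableSet
      (h.mono fun σ hσ _ => hσ), setIntegral_condExp (pastSigma_le E) hi hA, nextIs_eq,
      setIntegral_indicator (measurableSet_cyl _ _), setIntegral_const, smul_eq_mul, mul_one]
  rw [← ofReal_integral_eq_lintegral_ofReal hgi.integrableOn (ae_restrict_of_ae hg0), h1,
    ofReal_measureReal]

variable [Countable E]

theorem measurable_past_eval {k : ℤ} (hk : k ≤ 0) :
    Measurable[pastSigma E] fun σ : CodeSpace E => σ k := by
  have h1 : k = -(k.natAbs : ℤ) + ((0 : ℕ) : ℤ) := by omega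
  rw [h1]
  exact measurable_eval_of_windows (n := k.natAbs + 1)
    (fun l hl => measurableSet_past_cyl_neg _ hl) (by omega)

theorem measurableSet_past_cyl {m : ℤ} {l : List (Alphabet E)} (h : m + l.length ≤ 1) :
    MeasurableSet[pastSigma E] (cyl m l) := by
  have h1 : cyl m l = ⋂ k : Fin l.length,
      (fun σ : CodeSpace E => σ (m + (k : ℕ))) ⁻¹' {l[(k : ℕ)]} := by
    ext σ
    simp only [cyl, Set.mem_ofPred_eq, Set.mem_iInter, Set.mem_preimage, Set.mem_singleton_iff]
    exact ⟨fun h k => h k k.2, fun h k hk => h ⟨k, hk⟩⟩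
  rw [h1]
  exact MeasurableSet.iInter fun k =>
    measurable_past_eval (by have := k.2; omega) MeasurableSet.of_discrete

/-- The preimage of a cylinder ending at `0` is one ending at `-1`, still in the past. -/
theorem measurable_past_unshift : Measurable[pastSigma E, pastSigma E] (unshift (E := E)) := by
  refine measurable_iff_comap_le.2 ?_
  rw [MeasurableSpace.comap_iSup]
  refine iSup_le fun n => ?_
  rw [MeasurableSpace.comap_generateFrom]
  refine MeasurableSpace.generateFrom_le ?_
  rintro _ ⟨_, ⟨l, hl, rfl⟩, rfl⟩
  rw [unshift_preimage_cyl]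
  exact measurableSet_past_cyl (by omega)

/-- Two finite measures that agree on the past cylinder sets agree on the past. -/
theorem measure_eq_of_past_cyl {ν ν' : Measure (CodeSpace E)} [IsFiniteMeasure ν]
    (h : ∀ (n : ℕ) (l : List (Alphabet E)), l.length = n + 1 →
      ν (cyl (-(n : ℤ)) l) = ν' (cyl (-(n : ℤ)) l))
    {A : Set (CodeSpace E)} (hA : MeasurableSet[pastSigma E] A) : ν A = ν' A := by
  have huniv : ν Set.univ = ν' Set.univ := by
    rw [← tsum_measure_inter_cyl_singleton ν 0 MeasurableSet.univ,
      ← tsum_measure_inter_cyl_singleton ν' 0 MeasurableSet.univ]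
    refine tsum_congr fun a => ?_
    simpa using h 0 [a] rfl
  have h1 : ν.trim (pastSigma_le E) = ν'.trim (pastSigma_le E) := by
    refine @ext_of_generate_finite _ (pastSigma E) _ _ _ pastSigma_eq_generateFrom
      isPiSystem_past (isFiniteMeasure_trim _) ?_ ?_
    · rintro B (rfl | ⟨n, l, hl, rfl⟩)
      · simp
      · rw [trim_measurableSet_eq _ (measurableSet_past_cyl_neg n hl),
          trim_measurableSet_eq _ (measurableSet_past_cyl_neg n hl), h n l hl]
    · rw [trim_measurableSet_eq _ (@MeasurableSet.univ _ (pastSigma E)),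
        trim_measurableSet_eq _ (@MeasurableSet.univ _ (pastSigma E)), huniv]
  rw [← trim_measurableSet_eq (pastSigma_le E) hA, h1, trim_measurableSet_eq _ hA]

end Past

namespace MarkovSystem

variable {K : Type*} [MetricSpace K] [MeasurableSpace K] [BorelSpace K]
  {N : Set ℕ} {E : Type*} [Countable E] (M : MarkovSystem K N E)

/-! ### The coding map along words -/

/-- The image of the base point along a word. -/
def basePoint (x : N → K) : List (Alphabet E) → K
  | [] => x ⟨1, M.one_mem⟩
  | a :: l => M.wordMap (a :: l) (x (M.iExt a))

theorem basePoint_snoc (x : N → K) {l : List (Alphabet E)} (hl : l ≠ []) (a : Alphabet E) :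
    M.basePoint x (l ++ [a]) = M.wExt a (M.basePoint x l) := by
  rcases l with _ | ⟨b, l⟩
  · exact absurd rfl hl
  · change M.wordMap ((b :: l) ++ [a]) _ = _
    rw [wordMap_append]
    rfl

theorem back_eq (σ : CodeSpace E) (n : ℕ) (y : K) :
    M.back σ n y = M.wordMap (window (-(n : ℤ)) (n + 1) σ) y := by
  induction n generalizing y with
  | zero => simp [back, window, wordMap]
  | succ n ih =>
    simp only [back]
    rw [ih, window.eq_def _ (n + 1 + 1)]
    simp only [wordMap]
    push_cast
    rw [neg_add, neg_add_cancel_right]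

theorem approx_eq (x : N → K) (σ : CodeSpace E) (n : ℕ) :
    M.approx x σ n = M.basePoint x (window (-(n : ℤ)) (n + 1) σ) := by
  rw [approx, back_eq]
  rfl

/-- After the shift the letter `σ 1` is the last one applied. The depth rises by one because the
starting letter stays the same. -/
theorem approx_shift (x : N → K) (σ : CodeSpace E) (n : ℕ) :
    M.approx x (shift σ) (n + 1) = M.wExt (σ 1) (M.approx x σ n) := by
  rw [approx_eq, approx_eq, window_shift, window_succ_right, basePoint_snoc]
  · push_cast
    rw [neg_add, neg_add_cancel_right]
    congr 2
    ring
  · intro h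
    simpa using congrArg List.length h

theorem approx_mem {x : N → K} (hx : ∀ j, x j ∈ M.cell j) {σ : CodeSpace E}
    (hσ : σ ∈ M.pathSpace) (n : ℕ) : M.approx x σ n ∈ M.cell (M.tExt (σ 0)) := by
  have key : ∀ (n : ℕ), ∀ y ∈ M.cell (M.iExt (σ (-(n : ℤ)))),
      M.back σ n y ∈ M.cell (M.tExt (σ 0)) := by
    intro n
    induction n with
    | zero => exact fun y hy => M.wExt_mem (by simpa using hy)
    | succ n ih =>
      intro y hy
      refine ih _ ?_
      have h1 := (hσ (-((n : ℤ) + 1))).2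
      rw [show -((n : ℤ) + 1) + 1 = -(n : ℤ) by ring] at h1
      rw [h1]
      exact M.wExt_mem (by simpa using hy)
  exact key n _ (hx _)

/-- The approximation takes only countably many values, which replaces separability of `K`. -/
theorem stronglyMeasurable_approx (x : N → K) (n : ℕ) :
    StronglyMeasurable[pastSigma E] fun σ => M.approx x σ n := by
  rw [stronglyMeasurable_iff_measurable_separable]
  simp_rw [approx_eq]
  refine ⟨measurable_comp_window (fun l hl => measurableSet_past_cyl_neg n hl) _, ?_⟩
  refine Set.Countable.isSeparable ((Set.countable_range (M.basePoint x)).mono ?_)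
  rintro _ ⟨σ, rfl⟩
  exact ⟨_, rfl⟩

/-- The limit of the approximations, as a function of the past. -/
def codeLim (x : N → K) (σ : CodeSpace E) : K :=
  haveI : Nonempty K := ⟨x ⟨1, M.one_mem⟩⟩
  limUnder atTop (M.approx x σ)

theorem codeLim_eq {x : N → K} {σ : CodeSpace E} {y : K}
    (h : Tendsto (M.approx x σ) atTop (𝓝 y)) : M.codeLim x σ = y :=
  h.limUnder_eq

theorem tendsto_codeLim {x : N → K} {σ : CodeSpace E} (h : σ ∈ M.codingDomain x) :
    Tendsto (M.approx x σ) atTop (𝓝 (M.codeLim x σ)) := by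
  obtain ⟨y, hy⟩ := h.2
  rwa [M.codeLim_eq hy]

/-- Through `pathSpace` the domain also constrains the future, so `coding` need not be measurable
for the past. Its substitute `codeLim` reads only coordinates up to `0`. -/
theorem coding_eq_codeLim {x : N → K} {σ : CodeSpace E} (h : σ ∈ M.codingDomain x) :
    M.coding x σ = M.codeLim x σ := by
  rw [coding, dif_pos h]
  exact (M.codeLim_eq h.2.choose_spec).symm

theorem measurableSet_pathSpace : MeasurableSet M.pathSpace := by
  have : M.pathSpace = ⋂ n : ℤ, (fun σ : CodeSpace E => (σ n, σ (n + 1))) ⁻¹'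
      {q | (∃ e, q.1 = letter e) ∧ M.iExt q.2 = M.tExt q.1} := by
    ext σ
    simp only [pathSpace, Set.mem_iInter]
    rfl
  rw [this]
  exact MeasurableSet.iInter fun n =>
    ((measurable_pi_apply n).prodMk (measurable_pi_apply (n + 1))) MeasurableSet.of_discrete

/-- The approximations stay in `K_{t(σ_0)} = K_{i(σ_1)}`, so continuity of `w_{σ_1}` relative to
this set applies, provided that the limit lies in it too. -/
theorem codeLim_shift {x : N → K} (hx : ∀ j, x j ∈ M.cell j) (hu : M.UnifContinuous)
    {σ : CodeSpace E} (h : σ ∈ M.codingDomain x) (h' : shift σ ∈ M.codingDomain x)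
    (hm : M.codeLim x σ ∈ M.cell (M.tExt (σ 0))) :
    M.codeLim x (shift σ) = M.wExt (σ 1) (M.codeLim x σ) := by
  refine tendsto_nhds_unique ((M.tendsto_codeLim h').comp (tendsto_add_atTop_nat 1)) ?_
  have h1 : M.tExt (σ 0) = M.iExt (σ 1) := by simpa using (h.1 0).2.symm
  obtain ⟨e, he⟩ := (h.1 1).1
  have hc : ContinuousWithinAt (M.wExt (σ 1)) (M.cell (M.tExt (σ 0))) (M.codeLim x σ) := by
    rw [h1, he]
    rw [h1, he] at hm
    exact (hu e).1.continuousOn _ hm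
  have h2 := hc.tendsto.comp (tendsto_nhdsWithin_iff.2
    ⟨M.tendsto_codeLim h, Eventually.of_forall fun n => M.approx_mem hx h.1 n⟩)
  exact h2.congr fun n => (M.approx_shift x σ n).symm

theorem measure_cyl_none {Λ : Measure (CodeSpace E)} (h : ∀ᵐ σ ∂Λ, σ ∈ M.pathSpace) (n : ℤ) :
    Λ (cyl n [(none : Option E)]) = 0 := by
  refine measure_mono_null (t := M.pathSpaceᶜ) (fun σ hσ hp => ?_) h
  obtain ⟨e, he⟩ := (hp n).1
  rw [mem_cyl_singleton.1 hσ] at he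
  exact Option.some_ne_none e he.symm

/-! ### Measurability of the coded point and the law of the next letter -/

section Complete

variable [CompleteSpace K]

theorem stronglyMeasurable_codeLim (x : N → K) :
    StronglyMeasurable[pastSigma E] (M.codeLim x) := by
  have : Nonempty K := ⟨x ⟨1, M.one_mem⟩⟩
  exact @StronglyMeasurable.limUnder _ _ _ (pastSigma E) _ _ _ _ _ _ _
    (M.stronglyMeasurable_approx x)

theorem measurable_past_codeLim (x : N → K) : Measurable[pastSigma E] (M.codeLim x) :=
  (stronglyMeasurable_iff_measurable_separable.1 (M.stronglyMeasurable_codeLim x)).1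

theorem measurable_codeLim (x : N → K) : Measurable (M.codeLim x) :=
  (M.measurable_past_codeLim x).mono (pastSigma_le E) le_rfl

theorem measurableSet_codingDomain (x : N → K) : MeasurableSet (M.codingDomain x) :=
  M.measurableSet_pathSpace.inter (StronglyMeasurable.measurableSet_exists_tendsto fun n =>
    (M.stronglyMeasurable_approx x n).mono (pastSigma_le E))

theorem ae_mem_codingDomain {x : N → K} {Λ : Measure (CodeSpace E)} [IsProbabilityMeasure Λ]
    (h : Λ (M.codingDomain x) = 1) : ∀ᵐ σ ∂Λ, σ ∈ M.codingDomain x :=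
  (mem_ae_iff_prob_eq_one (M.measurableSet_codingDomain x)).2 h

theorem codingMeasure_eq {x : N → K} {Λ : Measure (CodeSpace E)} [IsProbabilityMeasure Λ]
    (h : Λ (M.codingDomain x) = 1) : M.codingMeasure x Λ = Λ.map (M.codeLim x) :=
  Measure.map_congr ((M.ae_mem_codingDomain h).mono fun _ hσ => M.coding_eq_codeLim hσ)

/-- The next letter is chosen with the probabilities at the coded point. -/
def StepLaw (x : N → K) (Λ : Measure (CodeSpace E)) : Prop :=
  ∀ a, ∀ A, MeasurableSet[pastSigma E] A →
    Λ (A ∩ cyl 1 [a]) = ∫⁻ σ in A, M.prob a (M.codeLim x σ) ∂Λ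

/-- Replaces conditional expectations by an identity on past sets, with `coding` exchanged for
`codeLim`. The letter `∞` may be included because it is almost surely never used. -/
theorem mem_equilibriumStates_iff {x : N → K} {Λ : Measure (CodeSpace E)} :
    Λ ∈ M.equilibriumStates x ↔
      Λ ∈ shiftInvariant E ∧ Λ (M.codingDomain x) = 1 ∧ M.StepLaw x Λ := by
  refine and_congr_right fun hΛ => and_congr_right fun hD => ?_
  have := hΛ.1
  have hD' := M.ae_mem_codingDomain hD
  have hae : ∀ e : E, (fun σ => M.p e (M.coding x σ)) =ᵐ[Λ] fun σ => M.p e (M.codeLim x σ) :=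
    fun e => hD'.mono fun σ hσ => by simp only [M.coding_eq_codeLim hσ]
  constructor
  · rintro h (_ | e) A hA
    · simp only [prob_none, lintegral_zero]
      exact measure_mono_null Set.inter_subset_right
        (M.measure_cyl_none (hD'.mono fun σ hσ => hσ.1) 1)
    · exact measure_inter_cyl_of_condExp e (Eventually.of_forall fun σ => (M.p_mem _ _).1)
        ((h e).trans (hae e)) hA
  · intro h e
    refine (condExp_nextIs_ae_eq e (Eventually.of_forall fun σ => (M.p_mem _ _).1)
      (Eventually.of_forall fun σ => (M.p_mem _ _).2) ?_ fun A hA => h (letter e) A hA).trans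
      (hae e).symm
    exact ((M.p_measurable e).comp (M.measurable_past_codeLim x)).aestronglyMeasurable

end Complete

end MarkovSystem

namespace MarkovSystem

variable {K : Type*} [MetricSpace K] [MeasurableSpace K] [BorelSpace K]
  {N : Set ℕ} {E : Type*} [Countable E] (M : MarkovSystem K N E)

/-! ### Limits of path measures -/

/-- `Λ` is the limit along `ω` of the path measures with the initial distributions `μ i`. -/
structure IsPathLimit {ι : Type*} (ω : Filter ι) (μ : ι → Measure K)
    (Λ : Measure (CodeSpace E)) : Prop where
  isProbabilityMeasure : IsProbabilityMeasure Λ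
  isProbabilityMeasure_initial : ∀ i, IsProbabilityMeasure (μ i)
  tendsto : ∀ m l, Tendsto (fun i => ∫⁻ z, M.pathProb l z ∂μ i) ω (𝓝 (Λ (cyl m l)))

/-- The vertex in which a word ends. -/
def endVertex : List (Alphabet E) → N
  | [] => ⟨1, M.one_mem⟩
  | [a] => M.tExt a
  | _ :: b :: l => endVertex (b :: l)

/-- A word that is possible from some point follows the edges of the graph, and then its map sends
the whole initial vertex set into the final one. -/
theorem wordMap_mem {a : Alphabet E} {l : List (Alphabet E)} {y z : K}
    (h : M.pathProb (a :: l) y ≠ 0) (hz : z ∈ M.cell (M.iExt a)) :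
    M.wordMap (a :: l) z ∈ M.cell (M.endVertex (a :: l)) := by
  induction l generalizing a y z with
  | nil => exact M.wExt_mem hz
  | cons b l ih =>
    rw [pathProb_cons] at h
    have h1 := M.wExt_mem (M.mem_cell_of_prob_ne_zero (left_ne_zero_of_mul h))
    have h2 := right_ne_zero_of_mul h
    have h3 := M.mem_cell_of_prob_ne_zero (a := b) (z := M.wExt a y) (left_ne_zero_of_mul h2)
    have h4 := M.wExt_mem hz
    rw [M.cell_unique h1 h3] at h4
    exact ih h2 h4

theorem vertex_eq_of_pathProb_ne_zero {a : Alphabet E} {l : List (Alphabet E)} {z : K}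
    (h : M.pathProb (a :: l) z ≠ 0) : M.vertex z = M.iExt a :=
  M.vertex_eq (M.mem_cell_of_prob_ne_zero (left_ne_zero_of_mul h))

variable {M}

/-- After the first letter `a`, both base points are compared with the trajectory of `w_a z`, and
the remaining `n + 1` letters contract each distance. The initial distances are, in the mean, at
most `ρ V + b` by the drift and `ρ V` by contraction. -/
theorem ContractsBy.wsum_increment_le {ρ : ℝ≥0∞} (h : M.ContractsBy ρ) (hρ : ρ < 1) {x : N → K}
    (hx : ∀ j, x j ∈ M.cell j) (n : ℕ) (z : K) :
    wsum (n + 2) (fun l => M.pathProb l z *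
      edist (M.basePoint x l.tail) (M.basePoint x l)) ≤
      ρ ^ (n + 1) * (2 * M.baseDist x z + M.bConst x) := by
  rw [M.wsum_pathProb_succ (n + 1) fun l _ => edist (M.basePoint x l.tail) (M.basePoint x l)]
  have key : ∀ a, M.prob a z * wsum (n + 1) (fun l => M.pathProb l (M.wExt a z) *
      edist (M.basePoint x (a :: l).tail) (M.basePoint x (a :: l))) ≤
      ρ ^ (n + 1) * (M.prob a z * edist (M.wExt a z) (x (M.tExt a)) +
        M.prob a z * edist (M.wExt a z) (M.wExt a (x (M.vertex z)))) := by
    intro a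
    by_cases ha : M.prob a z = 0
    · simp [ha]
    have hz := M.mem_cell_of_prob_ne_zero ha
    have hy := M.wExt_mem hz
    rw [← mul_add, mul_left_comm, mul_add, M.vertex_eq hz]
    refine mul_le_mul_right ?_ _
    refine le_trans ?_ (add_le_add (h.wsum_le (n + 1) hy (hx _))
      (h.wsum_le (n + 1) hy (M.wExt_mem (hx (M.iExt a)))))
    rw [← wsum_add]
    refine wsum_mono fun l hl => ?_
    rcases l with _ | ⟨c, l⟩
    · simp at hl
    rw [← mul_add]
    by_cases hP : M.pathProb (c :: l) (M.wExt a z) = 0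
    · simp [hP]
    have h1 := M.vertex_eq_of_pathProb_ne_zero hP
    rw [M.vertex_eq hy] at h1
    refine mul_le_mul_right ?_ _
    refine (edist_triangle_left _ _ (M.wordMap (c :: l) (M.wExt a z))).trans (le_of_eq ?_)
    rw [h1]
    rfl
  refine (ENNReal.tsum_le_tsum key).trans ?_
  rw [ENNReal.tsum_mul_left, ENNReal.tsum_add]
  refine mul_le_mul_right ?_ _
  calc _ ≤ (ρ * M.baseDist x z + M.bConst x) + ρ * M.baseDist x z :=
        add_le_add (h.drift hx z) (h _ _ (M.mem_cell_vertex z) _ (hx _))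
    _ ≤ (1 * M.baseDist x z + M.bConst x) + 1 * M.baseDist x z := by gcongr
    _ = _ := by ring

/-- With a modulus `δ` for `ε`, the choice `c = 1 / δ` makes the right side at least one for distant
points. In this linear form uniform continuity can be integrated against the contraction estimate.
-/
theorem UnifContinuous.prob_le (hu : M.UnifContinuous) (e : E) {ε : ℝ≥0∞} (hε : 0 < ε) :
    ∃ c : ℝ≥0∞, c ≠ ∞ ∧ ∀ j, ∀ y ∈ M.cell j, ∀ z ∈ M.cell j,
      M.prob (letter e) y ≤ M.prob (letter e) z + (ε + c * edist y z) := by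
  -- The cap at `1` allows `ε = ∞`.
  obtain ⟨δ, hδ, h⟩ := Metric.uniformContinuousOn_iff.1 (hu e).2 (min ε 1).toReal
    (ENNReal.toReal_pos (by simp [hε.ne']) (by simp))
  refine ⟨(ENNReal.ofReal δ)⁻¹, by simpa using hδ, fun j y hy z hz => ?_⟩
  by_cases hj : j = M.i e
  · subst hj
    by_cases hd : dist y z < δ
    · have h1 := h y hy z hz hd
      rw [Real.dist_eq] at h1
      refine le_trans ?_ (add_le_add le_rfl le_self_add)
      have h2 : M.p e y ≤ M.p e z + (min ε 1).toReal := by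
        have := (abs_lt.1 h1).2
        linarith
      calc M.prob (letter e) y ≤ ENNReal.ofReal (M.p e z + (min ε 1).toReal) :=
            ENNReal.ofReal_le_ofReal h2
        _ = M.prob (letter e) z + min ε 1 := by
            rw [ENNReal.ofReal_add (M.p_mem _ _).1 ENNReal.toReal_nonneg,
              ENNReal.ofReal_toReal (by simp)]
            rfl
        _ ≤ _ := add_le_add le_rfl (min_le_left _ _)
    · refine le_trans (M.prob_le_one _ _) (le_trans ?_ (le_add_self.trans le_add_self))
      rw [edist_dist, mul_comm, ← div_eq_mul_inv]
      rw [ENNReal.le_div_iff_mul_le (by simp [hδ]) (by simp), one_mul]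
      exact ENNReal.ofReal_le_ofReal (not_lt.1 hd)
  · have : M.prob (letter e) y = 0 := by
      by_contra h0
      exact hj (M.cell_unique hy (M.mem_cell_of_prob_ne_zero h0))
    rw [this]
    exact zero_le

/-- The approximations never leave `K_{t(σ_0)}`. If this is `K_{i(e)}`, uniform continuity carries
Cauchy filters to Cauchy filters, so `extendFrom` is a genuine limit; otherwise all values are zero.
-/
theorem UnifContinuous.tendsto_p_approx [CompleteSpace K] {x : N → K}
    (hu : M.UnifContinuous) (hx : ∀ j, x j ∈ M.cell j)
    (e : E) {σ : CodeSpace E} (hσ : σ ∈ M.codingDomain x) :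
    Tendsto (fun n => M.p e (M.approx x σ n)) atTop
      (𝓝 ((M.endsAt (M.i e)).indicator (fun σ => M.pBar e (M.coding x σ)) σ)) := by
  have happ := M.approx_mem hx hσ.1
  by_cases hT : σ ∈ M.endsAt (M.i e)
  · rw [Set.indicator_of_mem hT, M.coding_eq_codeLim hσ]
    rw [hT.2] at happ
    have hw : Tendsto (M.approx x σ) atTop (𝓝[M.cell (M.i e)] (M.codeLim x σ)) :=
      tendsto_nhdsWithin_iff.2 ⟨M.tendsto_codeLim hσ, Eventually.of_forall happ⟩
    have hcl : M.codeLim x σ ∈ closure (M.cell (M.i e)) :=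
      mem_closure_of_tendsto (M.tendsto_codeLim hσ) (Eventually.of_forall happ)
    rw [pBar, if_pos hcl]
    refine (tendsto_extendFrom ?_).comp hw
    have hne : (𝓝[M.cell (M.i e)] (M.codeLim x σ)).NeBot := mem_closure_iff_nhdsWithin_neBot.1 hcl
    have hca : Cauchy (𝓝[M.cell (M.i e)] (M.codeLim x σ)) :=
      cauchy_nhds.mono nhdsWithin_le_nhds
    exact cauchy_map_iff_exists_tendsto.1 (hca.map_of_le (hu e).2 inf_le_right)
  · rw [Set.indicator_of_notMem hT]
    refine tendsto_const_nhds.congr fun n => (M.p_eq_zero e _ fun h => hT ⟨hσ.1, ?_⟩).symm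
    exact M.cell_unique (happ n) h

namespace IsPathLimit

variable {ι : Type*} {ω : Filter ι} {μ : ι → Measure K} {Λ : Measure (CodeSpace E)}
  {ρ C : ℝ≥0∞} {x : N → K}

theorem wsum_error_le (h : M.IsPathLimit ω μ Λ) (hc : M.ContractsBy ρ)
    (hx : ∀ j, x j ∈ M.cell j) (hC : ∀ i, ∫⁻ z, M.baseDist x z ∂μ i ≤ C) (ε c : ℝ≥0∞) (n : ℕ)
    (i : ι) :
    wsum n (fun l => ∫⁻ z, M.pathProb l z *
      (ε + c * edist (M.wordMap l z) (M.wordMap l (x (M.vertex z)))) ∂μ i) ≤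
      ε + c * (ρ ^ n * C) := by
  have := h.isProbabilityMeasure_initial i
  have hV := M.measurable_baseDist x
  have hm : ∀ l, Measurable fun z => M.pathProb l z *
      (ε + c * edist (M.wordMap l z) (M.wordMap l (x (M.vertex z)))) := by
    intro l
    have h1 : Measurable fun q : K × N => edist q.1 (M.wordMap l (x q.2)) :=
      measurable_from_prod_countable_left fun j =>
        (measurable_edist_left : Measurable fun z => edist z (M.wordMap l (x j)))
    exact (M.measurable_pathProb l).mul (((h1.comp
      ((M.measurable_wordMap l).prodMk M.measurable_vertex)).const_mul _).const_add _)
  rw [← lintegral_wsum _ _ hm]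
  calc _ ≤ ∫⁻ z, ε + c * (ρ ^ n * M.baseDist x z) ∂μ i := by
        refine lintegral_mono fun z => ?_
        simp only [mul_add, wsum_add]
        refine add_le_add ?_ ?_
        · simp_rw [mul_comm _ ε]
          rw [wsum_mul_left, wsum_pathProb, mul_one]
        · simp_rw [mul_left_comm _ c]
          rw [wsum_mul_left]
          exact mul_le_mul_right (hc.wsum_base_le hx n z) _
    _ = ε + c * (ρ ^ n * ∫⁻ z, M.baseDist x z ∂μ i) := by
        rw [lintegral_add_left measurable_const, lintegral_const_mul _ (hV.const_mul _),
          lintegral_const_mul _ hV, lintegral_const, measure_univ, mul_one]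
    _ ≤ _ := by gcongr; exact hC i

variable [ω.NeBot]

/-- The limiting weight of a word does not depend on the time `m` at which the word starts. -/
theorem map_shift (h : M.IsPathLimit ω μ Λ) : Λ ∈ shiftInvariant E := by
  have := h.isProbabilityMeasure
  refine ⟨this, ?_⟩
  have := Measure.isProbabilityMeasure_map (μ := Λ) measurable_shift.aemeasurable
  refine measure_ext_of_cyl fun m _ l _ => ?_
  rw [Measure.map_apply measurable_shift (measurableSet_cyl _ _), shift_preimage_cyl]
  exact tendsto_nhds_unique (h.tendsto _ _) (h.tendsto _ _)

theorem ae_mem_pathSpace (h : M.IsPathLimit ω μ Λ) : ∀ᵐ σ ∂Λ, σ ∈ M.pathSpace := by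
  have h0 : ∀ m l, (∀ z, M.pathProb l z = 0) → Λ (cyl m l) = 0 := by
    intro m l hl
    have := h.tendsto m l
    simp only [hl, lintegral_zero] at this
    exact tendsto_nhds_unique this tendsto_const_nhds
  refine ae_all_iff.2 fun n => (Filter.Eventually.and ?_ ?_)
  · have h1 : Λ (cyl n [(none : Option E)]) = 0 := h0 _ _ fun z =>
    (M.pathProb_singleton _ z).trans (M.prob_none z)
    filter_upwards [measure_eq_zero_iff_ae_notMem.1 h1] with σ hσ
    rcases hn : σ n with _ | e
    · exact absurd (mem_cyl_singleton.2 hn) hσ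
    · exact ⟨e, rfl⟩
  · have h1 : ∀ a b, M.iExt b ≠ M.tExt a → Λ (cyl n [a, b]) = 0 := fun a b hab => h0 _ _ fun z => by
      by_contra hz
      exact hab (M.cell_unique (M.mem_cell_of_prob_ne_zero
        (left_ne_zero_of_mul (right_ne_zero_of_mul hz)))
        (M.wExt_mem (M.mem_cell_of_prob_ne_zero (left_ne_zero_of_mul hz))))
    have h2 : ∀ᵐ σ ∂Λ, ∀ a b, M.iExt b ≠ M.tExt a → σ ∉ cyl n [a, b] :=
      ae_all_iff.2 fun a => ae_all_iff.2 fun b => by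
        by_cases hab : M.iExt b = M.tExt a
        · exact Eventually.of_forall fun σ h => absurd hab h
        · filter_upwards [measure_eq_zero_iff_ae_notMem.1 (h1 a b hab)] with σ hσ _ using hσ
    filter_upwards [h2] with σ hσ
    by_contra hn
    exact hσ _ _ hn (by simp [mem_cyl_iff, window])

/-- The increment is a function of a finite window, so its integral is a sum over words, and the
bound for the `μ i` survives the limit as in Fatou's lemma. -/
theorem lintegral_edist_approx_le (h : M.IsPathLimit ω μ Λ) (hc : M.ContractsBy ρ) (hρ : ρ < 1)
    (hx : ∀ j, x j ∈ M.cell j) (hC : ∀ i, ∫⁻ z, M.baseDist x z ∂μ i ≤ C) (n : ℕ) :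
    ∫⁻ σ, edist (M.approx x σ n) (M.approx x σ (n + 1)) ∂Λ ≤
      ρ ^ (n + 1) * (2 * C + M.bConst x) := by
  have h1 : ∀ σ : CodeSpace E, edist (M.approx x σ n) (M.approx x σ (n + 1)) =
      (fun l => edist (M.basePoint x l.tail) (M.basePoint x l))
        (window (-((n + 1 : ℕ) : ℤ)) (n + 2) σ) := by
    intro σ
    rw [approx_eq, approx_eq]
    simp only [window, List.tail_cons]
    push_cast
    simp
  simp_rw [h1]
  rw [lintegral_window Λ _ _ fun l => edist (M.basePoint x l.tail) (M.basePoint x l)]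
  have h2 := wsum_le_wsum_add_of_tendsto (ω := ω) (n := n + 2)
    (f := fun i l => edist (M.basePoint x l.tail) (M.basePoint x l) *
      ∫⁻ z, M.pathProb l z ∂μ i)
    (f' := fun l => edist (M.basePoint x l.tail) (M.basePoint x l) *
      Λ (cyl (-((n + 1 : ℕ) : ℤ)) l))
    (g := fun _ _ => 0) (g' := fun _ => 0)
    (r := fun i l => edist (M.basePoint x l.tail) (M.basePoint x l) *
      ∫⁻ z, M.pathProb l z ∂μ i) (B := ρ ^ (n + 1) * (2 * C + M.bConst x))
    (fun l => ENNReal.Tendsto.const_mul (h.tendsto _ _) (Or.inr (edist_ne_top _ _)))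
    (fun l => tendsto_const_nhds) (fun i l _ => by simp) (fun i => ?_)
  · simpa [wsum] using h2
  · have := h.isProbabilityMeasure_initial i
    simp_rw [← lintegral_const_mul _ (M.measurable_pathProb _)]
    rw [← lintegral_wsum _ _ fun l => (M.measurable_pathProb l).const_mul _]
    calc _ ≤ ∫⁻ z, ρ ^ (n + 1) * (2 * M.baseDist x z + M.bConst x) ∂μ i := by
          refine lintegral_mono fun z => ?_
          simpa only [mul_comm] using hc.wsum_increment_le hρ hx n z
      _ = ρ ^ (n + 1) * (2 * ∫⁻ z, M.baseDist x z ∂μ i + M.bConst x) := by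
          have hV := M.measurable_baseDist x
          rw [lintegral_const_mul _ ((hV.const_mul _).add_const _),
            lintegral_add_right _ measurable_const, lintegral_const_mul _ hV, lintegral_const,
            measure_univ, mul_one]
      _ ≤ _ := by gcongr; exact hC i

/-- Up to a small error the next letter is chosen with the probabilities at the approximations. -/
theorem measure_inter_approx (h : M.IsPathLimit ω μ Λ) (hc : M.ContractsBy ρ)
    (hu : M.UnifContinuous) (hx : ∀ j, x j ∈ M.cell j)
    (hC : ∀ i, ∫⁻ z, M.baseDist x z ∂μ i ≤ C) (e : E) {ε : ℝ≥0∞} (hε : 0 < ε) :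
    ∃ c : ℝ≥0∞, c ≠ ∞ ∧ ∀ (n : ℕ) (l₀ : List (Alphabet E)), l₀.length = n + 1 → ∀ k : ℕ,
      Λ (cyl (-(n : ℤ)) l₀ ∩ cyl 1 [letter e]) ≤
        ∫⁻ σ in cyl (-(n : ℤ)) l₀, M.prob (letter e) (M.approx x σ (k + n)) ∂Λ +
          (ε + c * (ρ ^ (k + n + 1) * C)) ∧
      ∫⁻ σ in cyl (-(n : ℤ)) l₀, M.prob (letter e) (M.approx x σ (k + n)) ∂Λ ≤
        Λ (cyl (-(n : ℤ)) l₀ ∩ cyl 1 [letter e]) + (ε + c * (ρ ^ (k + n + 1) * C)) := by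
  classical
  obtain ⟨c, hct, hcp⟩ := hu.prob_le e hε
  refine ⟨c, hct, fun n l₀ hl₀ k => ?_⟩
  -- The window is prolonged by `k` letters into the past; `χ` selects the words that end in `l₀`.
  let m : ℤ := -((k + n : ℕ) : ℤ)
  let χ : List (Alphabet E) → ℝ≥0∞ := fun l => if l.drop k = l₀ then 1 else 0
  have hχ1 : ∀ l, χ l ≤ 1 := fun l => by simp only [χ]; split_ifs <;> simp
  let g : List (Alphabet E) → ℝ≥0∞ := fun l => M.prob (letter e) (M.basePoint x l)
  have hg1 : ∀ l, χ l * g l ≤ 1 := fun l => mul_le_one' (hχ1 l) (M.prob_le_one _ _)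
  have hχ : ∀ σ : CodeSpace E, χ (window m (k + n + 1) σ) =
      (cyl (-(n : ℤ)) l₀).indicator (fun _ => 1) σ := by
    intro σ
    have h1 : (window m (k + n + 1) σ).drop k = window (-(n : ℤ)) (n + 1) σ := by
      rw [add_assoc, window_add]
      rw [List.drop_left' (by simp)]
      congr 1
      simp only [m]
      push_cast
      ring
    simp only [χ, h1, Set.indicator_apply, mem_cyl_iff, hl₀]
  have hL : Λ (cyl (-(n : ℤ)) l₀ ∩ cyl 1 [letter e]) =
      wsum (k + n + 1) fun l => χ l * Λ (cyl m (l ++ [letter e])) := by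
    have h1 := lintegral_window (Λ.restrict (cyl 1 [letter e])) m (k + n + 1) χ
    simp_rw [hχ] at h1
    rw [lintegral_indicator_const (measurableSet_cyl _ _), one_mul,
      Measure.restrict_apply (measurableSet_cyl _ _)] at h1
    rw [h1]
    refine wsum_congr fun l hl => ?_
    rw [Measure.restrict_apply (measurableSet_cyl _ _)]
    congr 2
    ext σ
    rw [mem_cyl_append, hl, Set.mem_inter_iff]
    simp only [m]
    push_cast
    rw [show -((k : ℤ) + n) + (k + n + 1) = 1 by ring]
  have hR : ∫⁻ σ in cyl (-(n : ℤ)) l₀, M.prob (letter e) (M.approx x σ (k + n)) ∂Λ =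
      wsum (k + n + 1) fun l => χ l * g l * Λ (cyl m l) := by
    rw [← lintegral_window Λ m (k + n + 1) fun l => χ l * g l,
      ← lintegral_indicator (measurableSet_cyl _ _)]
    refine lintegral_congr fun σ => ?_
    rw [hχ]
    by_cases hσ : σ ∈ cyl (-(n : ℤ)) l₀
    · simp [hσ, g, m, approx_eq]
    · simp [hσ]
  rw [hL, hR]
  -- A possible word carries `z` and the base point into a common vertex set, where `hcp` compares
  -- the probabilities of `e` in both directions.
  have hpt : ∀ l : List (Alphabet E), l.length = k + n + 1 → ∀ z,
      M.pathProb (l ++ [letter e]) z ≤ g l * M.pathProb l z + M.pathProb l z *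
        (ε + c * edist (M.wordMap l z) (M.wordMap l (x (M.vertex z)))) ∧
      g l * M.pathProb l z ≤ M.pathProb (l ++ [letter e]) z + M.pathProb l z *
        (ε + c * edist (M.wordMap l z) (M.wordMap l (x (M.vertex z)))) := by
    intro l hl z
    rcases l with _ | ⟨a, l⟩
    · simp at hl
    rw [pathProb_append, pathProb_singleton]
    by_cases hP : M.pathProb (a :: l) z = 0
    · simp [hP]
    have hz : z ∈ M.cell (M.iExt a) := M.mem_cell_of_prob_ne_zero (left_ne_zero_of_mul hP)
    have h1 := M.wordMap_mem hP hz
    have h2 := M.wordMap_mem hP (hx (M.iExt a))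
    have hgl : g (a :: l) = M.prob (letter e) (M.wordMap (a :: l) (x (M.iExt a))) := rfl
    rw [M.vertex_eq hz, hgl, mul_comm _ (M.pathProb (a :: l) z), ← mul_add, ← mul_add]
    refine ⟨mul_le_mul_right (hcp _ _ h1 _ h2) _, mul_le_mul_right ?_ _⟩
    rw [edist_comm]
    exact hcp _ _ h2 _ h1
  have hintA : ∀ i l, χ l * ∫⁻ z, M.pathProb (l ++ [letter e]) z ∂μ i =
      ∫⁻ z, χ l * M.pathProb (l ++ [letter e]) z ∂μ i := fun i l =>
    (lintegral_const_mul _ (M.measurable_pathProb _)).symm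
  have hintB : ∀ i l, χ l * g l * ∫⁻ z, M.pathProb l z ∂μ i =
      ∫⁻ z, χ l * (g l * M.pathProb l z) ∂μ i := fun i l => by
    rw [← lintegral_const_mul _ (M.measurable_pathProb _)]
    simp_rw [mul_assoc]
  have hA := fun l => ENNReal.Tendsto.const_mul (a := χ l) (h.tendsto m (l ++ [letter e]))
    (Or.inr ((hχ1 l).trans_lt ENNReal.one_lt_top).ne)
  have hB := fun l => ENNReal.Tendsto.const_mul (a := χ l * g l) (h.tendsto m l)
    (Or.inr ((hg1 l).trans_lt ENNReal.one_lt_top).ne)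
  have herr := h.wsum_error_le hc hx hC ε c (k + n + 1)
  constructor
  · refine wsum_le_wsum_add_of_tendsto hA hB (fun i l hl => ?_) herr
    rw [hintA, hintB, ← lintegral_add_left
      (((M.measurable_pathProb l).const_mul _).const_mul _)]
    refine lintegral_mono fun z => ?_
    refine (mul_le_mul_right (hpt l hl z).1 _).trans ?_
    rw [mul_add]
    exact add_le_add le_rfl (mul_le_of_le_one_left' (hχ1 l))
  · refine wsum_le_wsum_add_of_tendsto hB hA (fun i l hl => ?_) herr
    rw [hintA, hintB, ← lintegral_add_left ((M.measurable_pathProb _).const_mul _)]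
    refine lintegral_mono fun z => ?_
    refine (mul_le_mul_right (hpt l hl z).2 _).trans ?_
    rw [mul_add]
    exact add_le_add le_rfl (mul_le_of_le_one_left' (hχ1 l))

variable [CompleteSpace K]

/-- The mean increments are summable, so almost surely the increments themselves are, and the
approximations form a Cauchy sequence. -/
theorem measure_codingDomain (h : M.IsPathLimit ω μ Λ) (hc : M.ContractsBy ρ) (hρ : ρ < 1)
    (hx : ∀ j, x j ∈ M.cell j) (hb : M.bConst x < ∞) (hC : ∀ i, ∫⁻ z, M.baseDist x z ∂μ i ≤ C)
    (hCt : C < ∞) : Λ (M.codingDomain x) = 1 := by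
  have := h.isProbabilityMeasure
  rw [← mem_ae_iff_prob_eq_one (M.measurableSet_codingDomain x)]
  have hm : ∀ n, Measurable fun σ => edist (M.approx x σ n) (M.approx x σ (n + 1)) := fun n =>
    (((M.stronglyMeasurable_approx x n).mono (pastSigma_le E)).edist
      ((M.stronglyMeasurable_approx x (n + 1)).mono (pastSigma_le E))).measurable
  have hfin : ∫⁻ σ, ∑' n, edist (M.approx x σ n) (M.approx x σ (n + 1)) ∂Λ ≠ ∞ := by
    rw [lintegral_tsum fun n => (hm n).aemeasurable]
    refine ne_top_of_le_ne_top ?_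
      (ENNReal.tsum_le_tsum fun n => h.lintegral_edist_approx_le hc hρ hx hC n)
    rw [ENNReal.tsum_mul_right]
    refine ENNReal.mul_ne_top ?_ (by finiteness)
    simp_rw [pow_succ]
    rw [ENNReal.tsum_mul_right, ENNReal.tsum_geometric]
    refine ENNReal.mul_ne_top (ENNReal.inv_ne_top.2 (tsub_pos_of_lt hρ).ne')
      (hρ.trans ENNReal.one_lt_top).ne
  filter_upwards [h.ae_mem_pathSpace, ae_lt_top (Measurable.tsum hm) hfin] with σ hσ hσ'
  exact ⟨hσ, cauchySeq_tendsto_of_complete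
    (cauchySeq_of_edist_le_of_tsum_ne_top _ (fun n => le_rfl) hσ'.ne)⟩

/-- A limit of path measures is an asymptotic state. -/
theorem mem_asymptoticStates (h : M.IsPathLimit ω μ Λ) (hc : M.ContractsBy ρ) (hρ : ρ < 1)
    (hu : M.UnifContinuous) (hx : ∀ j, x j ∈ M.cell j) (hb : M.bConst x < ∞)
    (hC : ∀ i, ∫⁻ z, M.baseDist x z ∂μ i ≤ C) (hCt : C < ∞) : Λ ∈ M.asymptoticStates x := by
  have := h.isProbabilityMeasure
  have hD := h.measure_codingDomain hc hρ hx hb hC hCt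
  have hD' := M.ae_mem_codingDomain hD
  refine ⟨h.map_shift, hD, fun e => ?_⟩
  set g : CodeSpace E → ℝ :=
    (M.endsAt (M.i e)).indicator fun σ => M.pBar e (M.coding x σ)
  have hlim : ∀ᵐ σ ∂Λ, Tendsto (fun n => M.p e (M.approx x σ n)) atTop (𝓝 (g σ)) :=
    hD'.mono fun σ hσ => hu.tendsto_p_approx hx e hσ
  have hmeas : ∀ n, Measurable[pastSigma E] fun σ => M.p e (M.approx x σ n) := fun n =>
    (M.p_measurable e).comp
      (stronglyMeasurable_iff_measurable_separable.1 (M.stronglyMeasurable_approx x n)).1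
  have hcyl : ∀ (n : ℕ) (l : List (Alphabet E)), l.length = n + 1 →
      Λ (cyl (-(n : ℤ)) l ∩ cyl 1 [letter e]) =
        ∫⁻ σ in cyl (-(n : ℤ)) l, ENNReal.ofReal (g σ) ∂Λ := by
    intro n l hl
    have hI : Tendsto (fun k => ∫⁻ σ in cyl (-(n : ℤ)) l,
        M.prob (letter e) (M.approx x σ (k + n)) ∂Λ) atTop
        (𝓝 (∫⁻ σ in cyl (-(n : ℤ)) l, ENNReal.ofReal (g σ) ∂Λ)) := by
      refine tendsto_lintegral_of_dominated_convergence (fun _ => 1)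
        (fun k => ((hmeas (k + n)).mono (pastSigma_le E) le_rfl).ennreal_ofReal)
        (fun k => Eventually.of_forall fun σ => M.prob_le_one _ _) (by simp) ?_
      filter_upwards [ae_restrict_of_ae hlim] with σ hσ
      exact ENNReal.tendsto_ofReal (hσ.comp (tendsto_add_atTop_nat n))
    -- The constant `c` depends on `ε` but not on `k`, so `k → ∞` is taken first, leaving the error
    -- `ε`.
    have herr : ∀ (ε c : ℝ≥0∞), c ≠ ∞ →
        Tendsto (fun k => ε + c * (ρ ^ (k + n + 1) * C)) atTop (𝓝 ε) := by
      intro ε c hct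
      have h1 : Tendsto (fun k => ρ ^ (k + n + 1)) atTop (𝓝 0) :=
        (ENNReal.tendsto_pow_atTop_nhds_zero_of_lt_one hρ).comp (tendsto_add_atTop_nat (n + 1))
      have h2 := (ENNReal.Tendsto.const_mul (a := c)
        (ENNReal.Tendsto.mul_const (b := C) h1 (Or.inr hCt.ne)) (Or.inr hct)).const_add ε
      simpa using h2
    refine le_antisymm ?_ ?_
    · refine ENNReal.le_of_forall_pos_le_add fun ε hε _ => ?_
      obtain ⟨c, hct, hcc⟩ := h.measure_inter_approx hc hu hx hC e (ENNReal.coe_pos.2 hε)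
      exact le_of_tendsto_of_tendsto tendsto_const_nhds (hI.add (herr ε c hct))
        (Eventually.of_forall fun k => (hcc n l hl k).1)
    · refine ENNReal.le_of_forall_pos_le_add fun ε hε _ => ?_
      obtain ⟨c, hct, hcc⟩ := h.measure_inter_approx hc hu hx hC e (ENNReal.coe_pos.2 hε)
      exact le_of_tendsto_of_tendsto hI (tendsto_const_nhds.add (herr ε c hct))
        (Eventually.of_forall fun k => (hcc n l hl k).2)
  refine condExp_nextIs_ae_eq e ?_ ?_ ?_ fun A hA => ?_
  · filter_upwards [hlim] with σ hσ
    exact ge_of_tendsto' hσ fun n => (M.p_mem _ _).1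
  · filter_upwards [hlim] with σ hσ
    exact le_of_tendsto' hσ fun n => (M.p_mem _ _).2
  -- The definition of `g` refers to whole paths through `endsAt`; a past-measurable version is the
  -- limit of the probabilities at the approximations.
  · exact ⟨_, @StronglyMeasurable.limUnder _ _ _ (pastSigma E) _ _ _ _ _ _ _
      fun n => (hmeas n).stronglyMeasurable, hlim.mono fun σ hσ => hσ.limUnder_eq.symm⟩
  · have h1 := measure_eq_of_past_cyl (ν := Λ.restrict (cyl 1 [letter e]))
      (ν' := Λ.withDensity fun σ => ENNReal.ofReal (g σ)) (fun n l hl => ?_) hA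
    · rwa [Measure.restrict_apply (pastSigma_le E _ hA),
        withDensity_apply _ (pastSigma_le E _ hA)] at h1
    · rw [Measure.restrict_apply (measurableSet_cyl _ _),
        withDensity_apply _ (measurableSet_cyl _ _), hcyl n l hl]

end IsPathLimit

end MarkovSystem

/-! ### Shift-invariant measures on cylinders -/

section Shift

variable {E : Type*} {Λ : Measure (CodeSpace E)}

theorem measurePreserving_shift (h : Λ ∈ shiftInvariant E) :
    MeasurePreserving (shift : CodeSpace E → CodeSpace E) Λ Λ :=
  ⟨measurable_shift, h.2⟩

theorem measure_cyl_eq_of_shiftInvariant (h : Λ ∈ shiftInvariant E) (m n : ℤ)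
    (l : List (Alphabet E)) : Λ (cyl m l) = Λ (cyl n l) := by
  have step : ∀ k : ℤ, Λ (cyl (k + 1) l) = Λ (cyl k l) := fun k => by
    rw [← shift_preimage_cyl, (measurePreserving_shift h).measure_preimage
      (measurableSet_cyl _ _).nullMeasurableSet]
  have key : ∀ k : ℤ, Λ (cyl k l) = Λ (cyl 0 l) := by
    intro k
    induction k using Int.induction_on with
    | zero => rfl
    | succ k ih => rw [step, ih]
    | pred k ih => rw [← ih, ← step, sub_add_cancel]
  rw [key, key n]

end Shift

namespace MarkovSystem

variable {K : Type*} [MetricSpace K] [MeasurableSpace K] [BorelSpace K] [CompleteSpace K]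
  {N : Set ℕ} {E : Type*} [Countable E] {M : MarkovSystem K N E} {x : N → K}
  {Λ : Measure (CodeSpace E)}

/-! ### Equilibrium states and invariant measures -/

theorem StepLaw.setLIntegral [IsFiniteMeasure Λ] (h : M.StepLaw x Λ) (a : Alphabet E)
    {g : CodeSpace E → ℝ≥0∞} (hg : Measurable[pastSigma E] g) :
    ∫⁻ σ in cyl 1 [a], g σ ∂Λ = ∫⁻ σ, g σ * M.prob a (M.codeLim x σ) ∂Λ := by
  have hp : Measurable fun σ => M.prob a (M.codeLim x σ) :=
    (M.measurable_prob a).comp (M.measurable_codeLim x)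
  have h1 : (Λ.restrict (cyl 1 [a])).trim (pastSigma_le E) =
      (Λ.withDensity fun σ => M.prob a (M.codeLim x σ)).trim (pastSigma_le E) := by
    refine @Measure.ext _ (pastSigma E) _ _ fun A hA => ?_
    rw [trim_measurableSet_eq _ hA, trim_measurableSet_eq _ hA,
      Measure.restrict_apply (pastSigma_le E _ hA), withDensity_apply _ (pastSigma_le E _ hA),
      h a A hA]
  rw [← lintegral_trim (pastSigma_le E) hg, h1, lintegral_trim (pastSigma_le E) hg,
    lintegral_withDensity_eq_lintegral_mul _ hp (hg.mono (pastSigma_le E) le_rfl)]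
  simp only [Pi.mul_apply, mul_comm]

/-- Where the coded point is outside `K_{i(a)}`, the letter `a` has probability zero and is almost
surely not chosen. -/
theorem StepLaw.ae_mem_cell (h : M.StepLaw x Λ) :
    ∀ᵐ σ ∂Λ, M.codeLim x σ ∈ M.cell (M.iExt (σ 1)) := by
  have h1 : ∀ a, ∀ᵐ σ ∂Λ, σ ∉ (M.codeLim x ⁻¹' (M.cell (M.iExt a))ᶜ) ∩ cyl 1 [a] := by
    intro a
    have hm : MeasurableSet[pastSigma E] (M.codeLim x ⁻¹' (M.cell (M.iExt a))ᶜ) :=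
      M.measurable_past_codeLim x (M.cell_measurable _).compl
    refine measure_eq_zero_iff_ae_notMem.1 ?_
    rw [h a _ hm]
    refine (setLIntegral_congr_fun (pastSigma_le E _ hm) fun σ hσ => ?_).trans lintegral_zero
    by_contra h0
    exact hσ (M.mem_cell_of_prob_ne_zero h0)
  filter_upwards [ae_all_iff.2 h1] with σ hσ
  by_contra hn
  exact hσ (σ 1) ⟨hn, mem_cyl_singleton.2 rfl⟩

theorem StepLaw.ae_codeLim_shift [IsProbabilityMeasure Λ] (h : M.StepLaw x Λ)
    (hx : ∀ j, x j ∈ M.cell j) (hu : M.UnifContinuous) (hS : Λ ∈ shiftInvariant E)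
    (hD : Λ (M.codingDomain x) = 1) :
    ∀ᵐ σ ∂Λ, M.codeLim x (shift σ) = M.wExt (σ 1) (M.codeLim x σ) := by
  have hD' := M.ae_mem_codingDomain hD
  filter_upwards [hD', (measurePreserving_shift hS).quasiMeasurePreserving.ae hD',
    h.ae_mem_cell] with σ h1 h2 h3
  refine M.codeLim_shift hx hu h1 h2 ?_
  have h4 := (h1.1 0).2
  rw [zero_add] at h4
  rwa [← h4]

/-- By the step law, the `a`-term of `U^* F(Λ)(B)` is the probability that `σ_1 = a` and the shifted
path is coded in `B`. Summation over `a` and shift invariance finish. -/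
theorem StepLaw.adj_map_codeLim [IsProbabilityMeasure Λ] (h : M.StepLaw x Λ)
    (hx : ∀ j, x j ∈ M.cell j) (hu : M.UnifContinuous) (hS : Λ ∈ shiftInvariant E)
    (hD : Λ (M.codingDomain x) = 1) : M.adj (Λ.map (M.codeLim x)) = Λ.map (M.codeLim x) := by
  have hm := M.measurable_codeLim x
  refine Measure.ext fun B hB => ?_
  have h1 : Measurable (B.indicator fun _ => (1 : ℝ≥0∞)) := measurable_const.indicator hB
  have hms : MeasurableSet (shift ⁻¹' (M.codeLim x ⁻¹' B)) := measurable_shift (hm hB)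
  calc M.adj (Λ.map (M.codeLim x)) B
      = ∫⁻ z, B.indicator (fun _ => 1) z ∂(M.adj (Λ.map (M.codeLim x))) := by
        rw [lintegral_indicator_const hB, one_mul]
    _ = ∫⁻ σ, ∑' a, M.prob a (M.codeLim x σ) *
          B.indicator (fun _ => 1) (M.wExt a (M.codeLim x σ)) ∂Λ := by
        rw [M.lintegral_adj _ h1, lintegral_map (M.measurable_markovOp h1) hm]
        simp_rw [markovOp_eq]
    _ = ∑' a, Λ (shift ⁻¹' (M.codeLim x ⁻¹' B) ∩ cyl 1 [a]) := by
        refine (lintegral_tsum fun a => (((M.measurable_prob a).comp hm).mul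
          (h1.comp ((M.measurable_wExt a).comp hm))).aemeasurable).trans ?_
        refine tsum_congr fun a => ?_
        have h2 := h.setLIntegral a
          (g := fun σ => B.indicator (fun _ => 1) (M.wExt a (M.codeLim x σ)))
          ((h1.comp (M.measurable_wExt a)).comp (M.measurable_past_codeLim x))
        refine (lintegral_congr fun σ => mul_comm _ _).trans (h2.symm.trans ?_)
        rw [← Measure.restrict_apply hms, ← lintegral_indicator_one hms]
        refine lintegral_congr_ae ?_
        filter_upwards [ae_restrict_of_ae (h.ae_codeLim_shift hx hu hS hD),
          ae_restrict_mem (measurableSet_cyl 1 [a])] with σ h3 h4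
        rw [← mem_cyl_singleton.1 h4, ← h3]
        rfl
    _ = Λ.map (M.codeLim x) B := by
        rw [tsum_measure_inter_cyl_singleton Λ 1 hms,
          (measurePreserving_shift hS).measure_preimage (hm hB).nullMeasurableSet,
          Measure.map_apply hm hB]

/-- One shift moves the first letter to time `0`, where its indicator, together with `g ∘ unshift`,
is a past-measurable weight for the remaining word. Hence the induction runs over all such `g`. -/
theorem StepLaw.setLIntegral_cyl [IsProbabilityMeasure Λ] (h : M.StepLaw x Λ)
    (hx : ∀ j, x j ∈ M.cell j) (hu : M.UnifContinuous) (hS : Λ ∈ shiftInvariant E)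
    (hD : Λ (M.codingDomain x) = 1) (l : List (Alphabet E)) {g : CodeSpace E → ℝ≥0∞}
    (hg : Measurable[pastSigma E] g) :
    ∫⁻ σ in cyl 1 l, g σ ∂Λ = ∫⁻ σ, g σ * M.pathProb l (M.codeLim x σ) ∂Λ := by
  induction l generalizing g with
  | nil =>
    have : (cyl 1 [] : Set (CodeSpace E)) = Set.univ := Set.eq_univ_of_forall fun σ => by
      simp [cyl]
    simp [this, pathProb]
  | cons a l ih =>
    have hPl : Measurable[pastSigma E] fun σ => M.pathProb l (M.wExt a (M.codeLim x σ)) :=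
      ((M.measurable_pathProb l).comp (M.measurable_wExt a)).comp (M.measurable_past_codeLim x)
    have hg' : Measurable[pastSigma E] ((cyl 0 [a]).indicator (g ∘ unshift)) :=
      (hg.comp measurable_past_unshift).indicator (measurableSet_past_cyl (by simp))
    have hgm := hg'.mono (pastSigma_le E) le_rfl
    calc ∫⁻ σ in cyl 1 (a :: l), g σ ∂Λ
        = ∫⁻ σ, (cyl 1 l).indicator ((cyl 0 [a]).indicator (g ∘ unshift)) (shift σ) ∂Λ := by
          rw [← lintegral_indicator (measurableSet_cyl _ _)]
          refine lintegral_congr fun σ => ?_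
          have h1 : σ ∈ cyl 1 (a :: l) ↔ shift σ ∈ cyl 1 l ∧ shift σ ∈ cyl 0 [a] := by
            rw [shift_mem_cyl, shift_mem_cyl, mem_cyl_cons, mem_cyl_singleton, zero_add, and_comm]
          by_cases h2 : shift σ ∈ cyl 1 l <;> by_cases h3 : shift σ ∈ cyl 0 [a] <;>
            simp [h1, h2, h3]
      _ = ∫⁻ σ, (cyl 0 [a]).indicator (g ∘ unshift) σ * M.pathProb l (M.codeLim x σ) ∂Λ := by
          rw [(measurePreserving_shift hS).lintegral_comp (hgm.indicator (measurableSet_cyl _ _)),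
            lintegral_indicator (measurableSet_cyl _ _), ih hg']
      _ = ∫⁻ σ, (cyl 0 [a]).indicator (g ∘ unshift) (shift σ) *
            M.pathProb l (M.codeLim x (shift σ)) ∂Λ :=
          ((measurePreserving_shift hS).lintegral_comp (hgm.mul
            ((M.measurable_pathProb l).comp (M.measurable_codeLim x)))).symm
      _ = ∫⁻ σ in cyl 1 [a], g σ * M.pathProb l (M.wExt a (M.codeLim x σ)) ∂Λ := by
          rw [← lintegral_indicator (measurableSet_cyl _ _)]
          refine lintegral_congr_ae ?_
          filter_upwards [h.ae_codeLim_shift hx hu hS hD] with σ h3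
          have h1 : shift σ ∈ cyl 0 [a] ↔ σ ∈ cyl 1 [a] := shift_mem_cyl
          by_cases h2 : σ ∈ cyl 1 [a]
          · rw [Set.indicator_of_mem (h1.2 h2), Set.indicator_of_mem h2, h3,
              mem_cyl_singleton.1 h2, Function.comp_apply, unshift_shift]
          · rw [Set.indicator_of_notMem fun h => h2 (h1.1 h), Set.indicator_of_notMem h2, zero_mul]
      _ = _ := by
          refine (h.setLIntegral a (hg.mul hPl)).trans ?_
          refine lintegral_congr fun σ => ?_
          rw [pathProb_cons, Pi.mul_apply]
          ring

theorem codingMeasure_mem_invariantMeasures (hx : ∀ j, x j ∈ M.cell j) (hu : M.UnifContinuous)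
    (hΛ : Λ ∈ M.equilibriumStates x) : M.codingMeasure x Λ ∈ M.invariantMeasures := by
  obtain ⟨hS, hD, hL⟩ := M.mem_equilibriumStates_iff.1 hΛ
  have := hS.1
  rw [M.codingMeasure_eq hD]
  exact ⟨Measure.isProbabilityMeasure_map (M.measurable_codeLim x).aemeasurable,
    hL.adj_map_codeLim hx hu hS hD⟩

theorem isLift_codingMeasure (hx : ∀ j, x j ∈ M.cell j) (hu : M.UnifContinuous)
    (hΛ : Λ ∈ M.equilibriumStates x) : M.IsLift (M.codingMeasure x Λ) Λ := by
  obtain ⟨hS, hD, hL⟩ := M.mem_equilibriumStates_iff.1 hΛ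
  have := hS.1
  refine ⟨this, fun m _ l _ => ?_⟩
  have h := hL.setLIntegral_cyl hx hu hS hD l (g := fun _ => 1) measurable_const
  simp only [one_mul, setLIntegral_one] at h
  rw [M.codingMeasure_eq hD, lintegral_map (M.measurable_pathProb l) (M.measurable_codeLim x), ← h,
    measure_cyl_eq_of_shiftInvariant hS m 1]

end MarkovSystem

/-! ### Lipschitz test functions -/

theorem LipschitzWith.coe_le_coe_add {K : Type*} [PseudoEMetricSpace K] {f : K → ℝ≥0}
    {c : ℝ≥0} (hf : LipschitzWith c f) (y z : K) :
    (f y : ℝ≥0∞) ≤ f z + c * edist y z := by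
  refine le_trans ?_ (add_le_add le_rfl (hf y z))
  have h1 := edist_triangle (f y) (f z) 0
  have h2 : ∀ r : ℝ≥0, edist r 0 = r := fun r => by
    rw [edist_nndist]; simp [NNReal.nndist_zero_eq_val']
  rw [h2, h2, add_comm] at h1
  exact h1

/-- Finite measures on a metric space that agree on bounded Lipschitz functions are equal. -/
theorem measure_ext_of_lipschitz {K : Type*} [MetricSpace K] [MeasurableSpace K] [BorelSpace K]
    {μ ν : Measure K} [IsFiniteMeasure μ] [IsFiniteMeasure ν]
    (h : ∀ (f : K → ℝ≥0) (c : ℝ≥0), LipschitzWith c f → (∀ z, f z ≤ 1) →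
      ∫⁻ z, f z ∂μ = ∫⁻ z, f z ∂ν) : μ = ν := by
  have hF : ∀ F : Set K, IsClosed F → μ F = ν F := by
    intro F hF
    have hpos : ∀ n : ℕ, (0 : ℝ) < 1 / (n + 1) := fun n => Nat.one_div_pos_of_nat
    have hlim : Tendsto (fun n : ℕ => (1 : ℝ) / (n + 1)) atTop (𝓝 0) :=
      tendsto_one_div_add_atTop_nhds_zero_nat
    refine tendsto_nhds_unique (tendsto_lintegral_thickenedIndicator_of_isClosed μ hF hpos hlim) ?_
    refine (tendsto_lintegral_thickenedIndicator_of_isClosed ν hF hpos hlim).congr fun n => ?_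
    exact (h _ _ (lipschitzWith_thickenedIndicator (hpos n) F)
      fun z => thickenedIndicator_le_one _ _ _).symm
  exact ext_of_generate_finite {F | IsClosed F}
    ((BorelSpace.measurable_eq (α := K)).trans borel_eq_generateFrom_isClosed) isPiSystem_isClosed
    (fun F hF' => hF F hF') (hF _ isClosed_univ)

/-! ### Lifts of invariant measures -/

namespace MarkovSystem

variable {K : Type*} [MetricSpace K] [MeasurableSpace K] [BorelSpace K]
  {N : Set ℕ} {E : Type*} [Countable E]

theorem exists_isLift (M : MarkovSystem K N E) {μ : Measure K} (hμ : μ ∈ M.invariantMeasures) :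
    ∃ Λ : Measure (CodeSpace E), IsProbabilityMeasure Λ ∧
      ∀ m l, Λ (cyl m l) = ∫⁻ z, M.pathProb l z ∂μ := by
  have := hμ.1
  refine exists_measure_of_word_weights (fun l => ∫⁻ z, M.pathProb l z ∂μ) ?_ (fun l => ?_)
    fun l => ?_
  · simp [pathProb]
  · rw [← lintegral_tsum fun a => (M.measurable_pathProb _).aemeasurable]
    simp_rw [tsum_pathProb_append]
  · rw [← lintegral_tsum fun a => (M.measurable_pathProb _).aemeasurable,
      ← M.lintegral_markovOp hμ.2 (M.measurable_pathProb l)]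
    simp_rw [markovOp_eq, pathProb_cons]

theorem IsLift.unique {M : MarkovSystem K N E} {μ : Measure K} {Λ Λ' : Measure (CodeSpace E)}
    (h : M.IsLift μ Λ) (h' : M.IsLift μ Λ') : Λ = Λ' := by
  have := h.1
  have := h'.1
  exact measure_ext_of_cyl fun m hm l hl => by rw [h.2 m hm l hl, h'.2 m hm l hl]

theorem existsUnique_isLift (M : MarkovSystem K N E) {μ : Measure K}
    (hμ : μ ∈ M.invariantMeasures) : ∃! Λ, M.IsLift μ Λ := by
  obtain ⟨Λ, hΛ, h⟩ := M.exists_isLift hμ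
  exact ⟨Λ, ⟨hΛ, fun m _ l _ => h m l⟩, fun Λ' h' => h'.unique ⟨hΛ, fun m _ l _ => h m l⟩⟩

theorem IsLift.lift_eq {M : MarkovSystem K N E} {μ : Measure K} {Λ : Measure (CodeSpace E)}
    (h : M.IsLift μ Λ) : M.lift μ = Λ := by
  rw [lift, dif_pos ⟨Λ, h⟩]
  exact (Exists.choose_spec (⟨Λ, h⟩ : ∃ Λ, M.IsLift μ Λ)).unique h

/-- The family is constant. Uniqueness identifies `Λ` with the measure of `exists_isLift`, whose
weights are known at every starting time, positive ones included. -/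
theorem IsLift.isPathLimit {M : MarkovSystem K N E} {μ : Measure K} {Λ : Measure (CodeSpace E)}
    (h : M.IsLift μ Λ) (hμ : μ ∈ M.invariantMeasures) :
    M.IsPathLimit (⊤ : Filter Unit) (fun _ => μ) Λ := by
  obtain ⟨Λ', hΛ', h'⟩ := M.exists_isLift hμ
  have : Λ = Λ' := h.unique ⟨hΛ', fun m _ l _ => h' m l⟩
  subst this
  exact ⟨hΛ', fun _ => hμ.1, fun m l => by rw [h' m l]; exact tendsto_const_nhds⟩

theorem basePoint_eq (M : MarkovSystem K N E) (x : N → K) {l : List (Alphabet E)} (hl : l ≠ [])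
    {z : K} (h : M.pathProb l z ≠ 0) : M.basePoint x l = M.wordMap l (x (M.vertex z)) := by
  rcases l with _ | ⟨a, l⟩
  · exact absurd rfl hl
  · rw [M.vertex_eq_of_pathProb_ne_zero h]
    rfl

variable {M : MarkovSystem K N E} {x : N → K} {Λ : Measure (CodeSpace E)} {μ : Measure K}
  {ρ : ℝ≥0∞}

theorem pBar_eq (hu : M.UnifContinuous) {e : E} {y : K} (hy : y ∈ M.cell (M.i e)) :
    M.pBar e y = M.p e y := by
  rw [pBar, if_pos (subset_closure hy)]
  exact extendFrom_eq (subset_closure hy) ((hu e).2.continuousOn y hy)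

theorem indicator_pBar_eq (hu : M.UnifContinuous) (e : E) {σ : CodeSpace E}
    (hσ : σ ∈ M.codingDomain x) (hm : M.codeLim x σ ∈ M.cell (M.tExt (σ 0))) :
    (M.endsAt (M.i e)).indicator (fun σ => M.pBar e (M.coding x σ)) σ =
      M.p e (M.codeLim x σ) := by
  by_cases hT : σ ∈ M.endsAt (M.i e)
  · rw [hT.2] at hm
    rw [Set.indicator_of_mem hT, M.coding_eq_codeLim hσ, pBar_eq hu hm]
  · rw [Set.indicator_of_notMem hT]
    exact (M.p_eq_zero e _ fun h => hT ⟨hσ.1, M.cell_unique hm h⟩).symm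

variable [CompleteSpace K]

/-- By invariance the right side equals an average over words of length `n + 1` ending in `a`,
evaluated at the true trajectory; the left side is the limit of the same averages with trajectories
started at base points. For Lipschitz `f` the two differ by at most `c * (ρ ^ (n + 1) * C)`. -/
theorem IsLift.setLIntegral_codeLim (h : M.IsLift μ Λ) (hμ : μ ∈ M.invariantMeasures)
    (hc : M.ContractsBy ρ) (hρ : ρ < 1) (hx : ∀ j, x j ∈ M.cell j) (hb : M.bConst x < ∞)
    (hD : Λ (M.codingDomain x) = 1) (a : Alphabet E) {f : K → ℝ≥0} {c : ℝ≥0}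
    (hf : LipschitzWith c f) (hf1 : ∀ z, f z ≤ 1) :
    ∫⁻ σ in cyl 0 [a], f (M.codeLim x σ) ∂Λ = ∫⁻ z, M.prob a z * f (M.wExt a z) ∂μ := by
  have := h.1
  have := hμ.1
  have hfm : Measurable fun z => (f z : ℝ≥0∞) := hf.continuous.measurable.coe_nnreal_ennreal
  have hcyl : ∀ m l, Λ (cyl m l) = ∫⁻ z, M.pathProb l z ∂μ := fun m l =>
    tendsto_nhds_unique ((h.isPathLimit hμ).tendsto m l) tendsto_const_nhds |>.symm ▸ rfl
  set C := ∫⁻ z, M.baseDist x z ∂μ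
  have hC : C ≠ ∞ := ne_top_of_le_ne_top (ENNReal.mul_ne_top
    (ENNReal.inv_ne_top.2 (tsub_pos_of_lt hρ).ne') hb.ne) (hc.lintegral_baseDist_le hρ hx hμ.2)
  let u : ℕ → ℝ≥0∞ := fun n => ∫⁻ σ in cyl 0 [a], f (M.approx x σ n) ∂Λ
  have hu : Tendsto u atTop (𝓝 (∫⁻ σ in cyl 0 [a], f (M.codeLim x σ) ∂Λ)) := by
    refine tendsto_lintegral_of_dominated_convergence (fun _ => 1) (fun n => hfm.comp
      ((M.stronglyMeasurable_approx x n).mono (pastSigma_le E)).measurable)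
      (fun n => Eventually.of_forall fun σ => ENNReal.coe_le_one_iff.2 (hf1 _)) (by simp) ?_
    filter_upwards [ae_restrict_of_ae (M.ae_mem_codingDomain hD)] with σ hσ
    exact ENNReal.tendsto_coe.2 ((hf.continuous.tendsto _).comp (M.tendsto_codeLim hσ))
  have hu1 : ∀ n, u n = ∫⁻ z, wsum n (fun l =>
      M.pathProb (l ++ [a]) z * f (M.basePoint x (l ++ [a]))) ∂μ := by
    intro n
    have h1 := lintegral_window (Λ.restrict (cyl 0 [a])) (-(n : ℤ)) n
      fun l => (f (M.basePoint x (l ++ [a])) : ℝ≥0∞)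
    rw [lintegral_wsum _ _ fun l => (M.measurable_pathProb _).mul_const _]
    refine Eq.trans (setLIntegral_congr_fun (measurableSet_cyl _ _) fun σ hσ => ?_) (h1.trans ?_)
    · rw [approx_eq, window_succ_right, neg_add_cancel, mem_cyl_singleton.1 hσ]
    · refine wsum_congr fun l hl => ?_
      rw [lintegral_mul_const _ (M.measurable_pathProb _), mul_comm,
        Measure.restrict_apply (measurableSet_cyl _ _), ← hcyl (-(n : ℤ))]
      congr 2
      ext σ
      rw [mem_cyl_append, hl, neg_add_cancel, Set.mem_inter_iff]
  have ht : ∀ n, ∫⁻ z, M.prob a z * f (M.wExt a z) ∂μ = ∫⁻ z, wsum n (fun l =>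
      M.pathProb (l ++ [a]) z * f (M.wordMap (l ++ [a]) z)) ∂μ := by
    intro n
    refine (M.lintegral_wsum_pathProb hμ.2 (f := fun z => M.prob a z * f (M.wExt a z))
      ((M.measurable_prob a).mul (hfm.comp (M.measurable_wExt a))) n).symm.trans ?_
    simp_rw [pathProb_append, wordMap_append, pathProb_singleton, mul_assoc]
    rfl
  have hpt : ∀ (l : List (Alphabet E)) (z : K),
      M.pathProb (l ++ [a]) z * f (M.basePoint x (l ++ [a])) ≤
        M.pathProb (l ++ [a]) z * f (M.wordMap (l ++ [a]) z) + c * (M.pathProb (l ++ [a]) z *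
          edist (M.wordMap (l ++ [a]) z) (M.wordMap (l ++ [a]) (x (M.vertex z)))) ∧
      M.pathProb (l ++ [a]) z * f (M.wordMap (l ++ [a]) z) ≤
        M.pathProb (l ++ [a]) z * f (M.basePoint x (l ++ [a])) + c * (M.pathProb (l ++ [a]) z *
          edist (M.wordMap (l ++ [a]) z) (M.wordMap (l ++ [a]) (x (M.vertex z)))) := by
    intro l z
    by_cases hP : M.pathProb (l ++ [a]) z = 0
    · simp [hP]
    rw [M.basePoint_eq x (by simp) hP, mul_left_comm, ← mul_add, ← mul_add]
    refine ⟨mul_le_mul_right ?_ _, mul_le_mul_right (hf.coe_le_coe_add _ _) _⟩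
    rw [edist_comm]
    exact hf.coe_le_coe_add _ _
  have herr : ∀ n z, wsum n (fun l => c * (M.pathProb (l ++ [a]) z *
      edist (M.wordMap (l ++ [a]) z) (M.wordMap (l ++ [a]) (x (M.vertex z))))) ≤
      c * (ρ ^ (n + 1) * M.baseDist x z) := by
    intro n z
    rw [wsum_mul_left]
    refine mul_le_mul_right (le_trans ?_ (hc.wsum_base_le hx (n + 1) z)) _
    -- Words ending in `a` are some of the words of length `n + 1`, for which the contraction bound
    -- is known.
    rw [wsum_snoc]
    exact wsum_mono fun l _ => ENNReal.le_tsum (f := fun a => M.pathProb (l ++ [a]) z *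
      edist (M.wordMap (l ++ [a]) z) (M.wordMap (l ++ [a]) (x (M.vertex z)))) a
  have herr' : ∀ n, ∫⁻ z, c * (ρ ^ (n + 1) * M.baseDist x z) ∂μ = c * (ρ ^ (n + 1) * C) :=
    fun n => by
      rw [lintegral_const_mul _ ((M.measurable_baseDist x).const_mul _),
        lintegral_const_mul _ (M.measurable_baseDist x)]
  have hm1 : ∀ n, Measurable fun z => wsum n fun l =>
      M.pathProb (l ++ [a]) z * f (M.basePoint x (l ++ [a])) := fun n =>
    measurable_wsum n fun l => (M.measurable_pathProb _).mul_const _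
  have hm2 : ∀ n, Measurable fun z => wsum n fun l =>
      M.pathProb (l ++ [a]) z * f (M.wordMap (l ++ [a]) z) := fun n =>
    measurable_wsum n fun l => (M.measurable_pathProb _).mul (hfm.comp (M.measurable_wordMap _))
  have hlim : Tendsto (fun n => c * (ρ ^ (n + 1) * C)) atTop (𝓝 0) := by
    have h1 : Tendsto (fun k => ρ ^ (k + 1)) atTop (𝓝 0) :=
      (ENNReal.tendsto_pow_atTop_nhds_zero_of_lt_one hρ).comp (tendsto_add_atTop_nat 1)
    simpa using ENNReal.Tendsto.const_mul (a := (c : ℝ≥0∞))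
      (ENNReal.Tendsto.mul_const (b := C) h1 (Or.inr hC)) (Or.inr ENNReal.coe_ne_top)
  refine le_antisymm ?_ ?_
  · refine le_of_tendsto_of_tendsto hu ((tendsto_const_nhds (x :=
      ∫⁻ z, M.prob a z * f (M.wExt a z) ∂μ)).add hlim |>.trans (by rw [add_zero]))
      (Eventually.of_forall fun n => ?_)
    simp only [hu1]
    rw [ht n, ← herr' n, ← lintegral_add_left (hm2 n)]
    refine lintegral_mono fun z => ?_
    refine (wsum_mono fun l _ => (hpt l z).1).trans ?_
    rw [wsum_add]
    exact add_le_add le_rfl (herr n z)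
  · refine ge_of_tendsto ((hu.add hlim).trans (by rw [add_zero]))
      (Eventually.of_forall fun n => ?_)
    simp only [hu1]
    rw [ht n, ← herr' n, ← lintegral_add_left (hm1 n)]
    refine lintegral_mono fun z => ?_
    refine (wsum_mono fun l _ => (hpt l z).2).trans ?_
    rw [wsum_add]
    exact add_le_add le_rfl (herr n z)

/-- The joint law of the coded point and the last letter under the lift of an invariant measure. -/
theorem IsLift.map_codeLim_restrict (h : M.IsLift μ Λ) (hμ : μ ∈ M.invariantMeasures)
    (hc : M.ContractsBy ρ) (hρ : ρ < 1) (hx : ∀ j, x j ∈ M.cell j) (hb : M.bConst x < ∞)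
    (hD : Λ (M.codingDomain x) = 1) (a : Alphabet E) :
    (Λ.restrict (cyl 0 [a])).map (M.codeLim x) = (μ.withDensity (M.prob a)).map (M.wExt a) := by
  have := h.1
  have := hμ.1
  have : IsFiniteMeasure (μ.withDensity (M.prob a)) := isFiniteMeasure_withDensity <|
    ne_top_of_le_ne_top ENNReal.one_ne_top
      ((lintegral_mono fun z => M.prob_le_one a z).trans (by simp))
  refine measure_ext_of_lipschitz fun f c hf hf1 => ?_
  have hfm : Measurable fun z => (f z : ℝ≥0∞) := hf.continuous.measurable.coe_nnreal_ennreal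
  rw [lintegral_map hfm (M.measurable_codeLim x), lintegral_map hfm (M.measurable_wExt a),
    h.setLIntegral_codeLim hμ hc hρ hx hb hD a hf hf1]
  exact (lintegral_withDensity_eq_lintegral_mul _ (M.measurable_prob a)
    (hfm.comp (M.measurable_wExt a))).symm

/-- The lift is an asymptotic state. On `σ_0 = a` its coded point is distributed as the image of
`p_a μ` under `w_a`, which lives on `K_{t(a)}`, so the extended probabilities are the original ones
there; the sum of these laws is `U^* μ`. -/
theorem IsLift.mem_equilibriumStates (h : M.IsLift μ Λ) (hμ : μ ∈ M.invariantMeasures)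
    (hcontr : M.Contractive) (hu : M.UnifContinuous) (hx : ∀ j, x j ∈ M.cell j)
    (hb : M.bConst x < ∞) : Λ ∈ M.equilibriumStates x ∧ M.codingMeasure x Λ = μ := by
  have := h.1
  have := hμ.1
  obtain ⟨ρ, hρ, hc⟩ := hcontr.contractsBy
  obtain ⟨hS, hD, hA⟩ := (h.isPathLimit hμ).mem_asymptoticStates hc hρ hu hx hb
    (fun _ => hc.lintegral_baseDist_le hρ hx hμ.2) (ENNReal.mul_lt_top
      (ENNReal.inv_lt_top.2 (tsub_pos_of_lt hρ)) hb)
  have hlaw := h.map_codeLim_restrict hμ hc hρ hx hb hD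
  have hm := M.measurable_codeLim x
  have hset : ∀ a, ∀ B : Set K, MeasurableSet B → Λ (M.codeLim x ⁻¹' B ∩ cyl 0 [a]) =
      (μ.withDensity (M.prob a)).map (M.wExt a) B := fun a B hB => by
    rw [← hlaw a, Measure.map_apply hm hB, Measure.restrict_apply (hm hB)]
  have hD' := M.ae_mem_codingDomain hD
  have hmem : ∀ᵐ σ ∂Λ, M.codeLim x σ ∈ M.cell (M.tExt (σ 0)) := by
    have h1 : ∀ a, ∀ᵐ σ ∂Λ, σ ∉ M.codeLim x ⁻¹' (M.cell (M.tExt a))ᶜ ∩ cyl 0 [a] := by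
      intro a
      refine measure_eq_zero_iff_ae_notMem.1 ?_
      have hB := (M.cell_measurable (M.tExt a)).compl
      rw [hset a _ hB, Measure.map_apply (M.measurable_wExt a) hB,
        withDensity_apply _ (M.measurable_wExt a hB)]
      refine (setLIntegral_congr_fun (M.measurable_wExt a hB) fun z hz => ?_).trans lintegral_zero
      by_contra h0
      exact hz (M.wExt_mem (M.mem_cell_of_prob_ne_zero h0))
    filter_upwards [ae_all_iff.2 h1] with σ hσ
    by_contra hn
    exact hσ (σ 0) ⟨hn, mem_cyl_singleton.2 rfl⟩
  refine ⟨⟨hS, hD, fun e => (hA e).trans ?_⟩, ?_⟩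
  · filter_upwards [hD', hmem] with σ h1 h2
    rw [indicator_pBar_eq hu e h1 h2, M.coding_eq_codeLim h1]
  · rw [M.codingMeasure_eq hD]
    refine Measure.ext fun B hB => ?_
    rw [Measure.map_apply hm hB, ← tsum_measure_inter_cyl_singleton Λ 0 (hm hB)]
    simp_rw [hset _ B hB]
    conv_rhs => rw [← hμ.2, adj, Measure.sum_apply _ hB]
    rw [tsum_alphabet]
    · rfl
    · have h0 : ∀ a, M.prob a = 0 → (μ.withDensity (M.prob a)).map (M.wExt a) B = 0 := by
        intro a ha
        rw [ha, withDensity_zero, Measure.map_zero, Measure.coe_zero, Pi.zero_apply]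
      exact h0 _ (funext fun z => M.prob_none z)

/-- The coding map and the lift are mutually inverse between the equilibrium states and the
invariant measures. -/
theorem coding_lift_bijective (hcontr : M.Contractive) (hu : M.UnifContinuous)
    (hx : ∀ j, x j ∈ M.cell j) (hb : M.bConst x < ∞) :
    Set.BijOn (M.codingMeasure x) (M.equilibriumStates x) M.invariantMeasures ∧
      Set.MapsTo M.lift M.invariantMeasures (M.equilibriumStates x) ∧
      Set.InvOn M.lift (M.codingMeasure x) (M.equilibriumStates x) M.invariantMeasures := by
  have h1 : Set.MapsTo (M.codingMeasure x) (M.equilibriumStates x) M.invariantMeasures :=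
    fun Λ hΛ => codingMeasure_mem_invariantMeasures hx hu hΛ
  have h2 : ∀ μ ∈ M.invariantMeasures, M.lift μ ∈ M.equilibriumStates x ∧
      M.codingMeasure x (M.lift μ) = μ := fun μ hμ => by
    obtain ⟨Λ, hΛ, -⟩ := M.existsUnique_isLift hμ
    rw [hΛ.lift_eq]
    exact hΛ.mem_equilibriumStates hμ hcontr hu hx hb
  have h3 : Set.InvOn M.lift (M.codingMeasure x) (M.equilibriumStates x) M.invariantMeasures :=
    ⟨fun Λ hΛ => (isLift_codingMeasure hx hu hΛ).lift_eq, fun μ hμ => (h2 μ hμ).2⟩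
  exact ⟨h3.bijOn h1 fun μ hμ => (h2 μ hμ).1, fun μ hμ => (h2 μ hμ).1, h3⟩

end MarkovSystem

namespace MarkovSystem

variable {K : Type*} [MetricSpace K] [MeasurableSpace K] [BorelSpace K]
  {N : Set ℕ} {E : Type*} [Countable E] (M : MarkovSystem K N E)

/-! ### The maximal inequality and tightness -/

/-- The functions of the maximal inequality: `G_n` dominates `∑_{k<n} U^k h - n c`. -/
def excess (h : K → ℝ≥0∞) (c : ℝ≥0∞) : ℕ → K → ℝ≥0∞
  | 0, _ => 0
  | n + 1, z => (h z + M.markovOp (excess h c n) z) - c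

variable {h : K → ℝ≥0∞} {c : ℝ≥0∞}

theorem measurable_excess (hh : Measurable h) (n : ℕ) : Measurable (M.excess h c n) := by
  induction n with
  | zero => exact measurable_const
  | succ n ih => exact (hh.add (M.measurable_markovOp ih)).sub_const c

theorem excess_le (hh : ∀ z, h z ≤ 1) (n : ℕ) (z : K) : M.excess h c n z ≤ n := by
  induction n generalizing z with
  | zero => simp [excess]
  | succ n ih =>
    refine tsub_le_self.trans ?_
    rw [Nat.cast_succ, add_comm]
    exact add_le_add ((M.markovOp_mono ih z).trans (M.markovOp_const _ z).le) (hh z)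

theorem excess_le_succ (n : ℕ) (z : K) : M.excess h c n z ≤ M.excess h c (n + 1) z := by
  induction n generalizing z with
  | zero => exact zero_le
  | succ n ih => exact tsub_le_tsub_right (add_le_add le_rfl (M.markovOp_mono ih z)) c

/-- Hopf's argument: where `G_n > 0`, one has `c + G_n = h + U G_{n-1} ≤ h + U G_n`. After
integration `G_n` and `U G_n` cancel by invariance, being bounded. -/
theorem mul_measure_excess_pos_le {μ : Measure K} [IsProbabilityMeasure μ] (hμ : M.adj μ = μ)
    (hh : Measurable h) (hh1 : ∀ z, h z ≤ 1) (n : ℕ) :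
    c * μ {z | 0 < M.excess h c n z} ≤ ∫⁻ z, h z ∂μ := by
  have hm := M.measurable_excess (c := c) hh n
  have hA : MeasurableSet {z | 0 < M.excess h c n z} := measurableSet_lt measurable_const hm
  have hfin : ∫⁻ z, M.excess h c n z ∂μ ≠ ∞ :=
    ne_top_of_le_ne_top (b := (n : ℝ≥0∞)) (by simp)
      ((lintegral_mono fun z => M.excess_le hh1 n z).trans (by simp))
  refine (ENNReal.add_le_add_iff_right hfin).1 ?_
  calc c * μ {z | 0 < M.excess h c n z} + ∫⁻ z, M.excess h c n z ∂μ
      = ∫⁻ z, {z | 0 < M.excess h c n z}.indicator (fun _ => c) z + M.excess h c n z ∂μ := by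
        rw [lintegral_add_right _ hm, lintegral_indicator_const hA]
    _ ≤ ∫⁻ z, h z + M.markovOp (M.excess h c n) z ∂μ := by
        refine lintegral_mono fun z => ?_
        by_cases hz : 0 < M.excess h c n z
        · rw [Set.indicator_of_mem (show z ∈ {z | 0 < M.excess h c n z} from hz)]
          rcases n with _ | n
          · simp [excess] at hz
          · refine le_trans ?_ (add_le_add le_rfl (M.markovOp_mono (M.excess_le_succ n) z))
            rw [excess, add_tsub_cancel_of_le (tsub_pos_iff_lt.1 hz).le]
        · rw [Set.indicator_of_notMem (show z ∉ {z | 0 < M.excess h c n z} from hz), zero_add,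
            nonpos_iff_eq_zero.1 (not_lt.1 hz)]
          exact zero_le
    _ = ∫⁻ z, h z ∂μ + ∫⁻ z, M.excess h c n z ∂μ := by
        rw [lintegral_add_left hh, M.lintegral_markovOp hμ hm]

/-- The maximal inequality for the Markov operator. -/
theorem mul_measure_exists_excess_pos_le {μ : Measure K} [IsProbabilityMeasure μ]
    (hμ : M.adj μ = μ) (hh : Measurable h) (hh1 : ∀ z, h z ≤ 1) :
    c * μ {z | ∃ n, 0 < M.excess h c n z} ≤ ∫⁻ z, h z ∂μ := by
  have h1 : {z | ∃ n, 0 < M.excess h c n z} = ⋃ n, {z | 0 < M.excess h c n z} := by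
    ext z; simp
  have h2 : Monotone fun n => {z | 0 < M.excess h c n z} :=
    monotone_nat_of_le_succ fun n z hz => lt_of_lt_of_le hz (M.excess_le_succ n z)
  rw [h1, h2.measure_iUnion, ENNReal.mul_iSup]
  exact iSup_le fun n => M.mul_measure_excess_pos_le hμ hh hh1 n

/-- For `ν = δ_y` with `G_n(y) = 0` this bounds the time average by `c`. The excess is taken for `U
h` because the averages start at time one. -/
theorem sum_lintegral_iterate_adj_le (hh : Measurable h) (n : ℕ) (ν : Measure K)
    [IsProbabilityMeasure ν] :
    ∑ k ∈ Finset.range n, ∫⁻ z, h z ∂(M.adj^[k + 1] ν) ≤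
      n * c + ∫⁻ z, M.excess (M.markovOp h) c n z ∂ν := by
  have hUh := M.measurable_markovOp hh
  induction n generalizing ν with
  | zero => simp
  | succ n ih =>
    have := M.isProbabilityMeasure_adj ν
    have hm := M.measurable_excess (c := c) hUh n
    rw [Finset.sum_range_succ']
    simp_rw [Function.iterate_succ_apply _ (_ + 1)]
    calc _ ≤ (n * c + ∫⁻ z, M.excess (M.markovOp h) c n z ∂(M.adj ν)) + ∫⁻ z, h z ∂(M.adj ν) :=
          add_le_add (ih (M.adj ν)) le_rfl
      _ = n * c + ∫⁻ z, M.markovOp h z + M.markovOp (M.excess (M.markovOp h) c n) z ∂ν := by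
          rw [M.lintegral_adj ν hm, M.lintegral_adj ν hh, lintegral_add_left hUh]
          ring
      _ ≤ n * c + ∫⁻ z, c + M.excess (M.markovOp h) c (n + 1) z ∂ν := by
          refine add_le_add le_rfl (lintegral_mono fun z => ?_)
          exact (le_add_tsub : _ ≤ c + (_ - c))
      _ = _ := by
          rw [lintegral_add_left measurable_const]
          simp
          ring

theorem map_vertex_apply (ν : Measure K) (S : Set N) :
    ν (M.vertex ⁻¹' S) = ∑' j, ν (M.cell j) * Measure.dirac j S := by
  have h1 : ∀ j, M.vertex ⁻¹' {j} = M.cell j := fun j => by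
    ext z
    exact ⟨fun h => h ▸ M.mem_cell_vertex z, fun h => M.vertex_eq h⟩
  rw [← Measure.map_apply M.measurable_vertex MeasurableSet.of_discrete,
    ← Measure.sum_smul_dirac (ν.map M.vertex), Measure.sum_apply _ MeasurableSet.of_discrete]
  refine tsum_congr fun j => ?_
  rw [Measure.smul_apply, smul_eq_mul, Measure.map_apply M.measurable_vertex
    MeasurableSet.of_discrete, h1]

theorem alpha_apply (y : K) (n : ℕ) (S : Set N) :
    M.alpha y n S = (n : ℝ≥0∞)⁻¹ * ∑ k ∈ Finset.range n,
      (M.adj^[k + 1] (Measure.dirac y)) (M.vertex ⁻¹' S) := by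
  rw [alpha, Measure.sum_apply _ MeasurableSet.of_discrete]
  simp only [Measure.smul_apply, smul_eq_mul, map_vertex_apply]
  rw [← Summable.tsum_finsetSum fun _ _ => ENNReal.summable, ← ENNReal.tsum_mul_left]
  refine tsum_congr fun j => ?_
  rw [mul_assoc, Finset.sum_mul, show Finset.Icc 1 n = Finset.Ico 1 (n + 1) by ext; simp,
    Finset.sum_Ico_eq_sum_range]
  simp only [add_tsub_cancel_right, add_comm 1]

theorem exists_finset_measure_vertex_lt (μ : Measure K) [IsProbabilityMeasure μ] {ε : ℝ≥0∞}
    (hε : 0 < ε) : ∃ V : Finset N, μ (M.vertex ⁻¹' (V : Set N)ᶜ) < ε := by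
  have h1 : ∑' j, μ (M.cell j) ≠ ∞ := by
    rw [← measure_iUnion (fun i j h => M.cell_disjoint h) M.cell_measurable, M.cell_cover]
    simp
  obtain ⟨V, hV⟩ := ((ENNReal.tendsto_tsum_compl_atTop_zero h1).eventually_lt_const hε).exists
  refine ⟨V, lt_of_le_of_lt (le_of_eq ?_) hV⟩
  rw [map_vertex_apply]
  refine Eq.trans (tsum_congr fun j => ?_)
    (tsum_subtype {j | j ∉ V} fun j => μ (M.cell j)).symm
  rw [Measure.dirac_apply' _ MeasurableSet.of_discrete]
  by_cases hj : j ∈ V <;> simp [hj]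

/-- An invariant probability measure yields a starting point with tight averages. -/
theorem tightCondition_of_invariant {μ : Measure K} (hμ : μ ∈ M.invariantMeasures) :
    M.TightCondition := by
  have := hμ.1
  -- The bad set for level `c r` will have measure at most `δ r`. As the `δ r` sum to less than one,
  -- some `y` avoids all bad sets; for this `V r` is chosen with `μ`-mass outside below `c r * δ r`.
  obtain ⟨δ, hδ, hδs⟩ := ENNReal.exists_pos_sum_of_countable' (one_ne_zero) ℕ
  let c : ℕ → ℝ≥0∞ := fun r => ((r : ℝ≥0∞) + 1)⁻¹
  have hc0 : ∀ r, c r ≠ 0 := fun r => by simp [c]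
  have hct : ∀ r, c r ≠ ∞ := fun r => by simp [c]
  choose V hV using fun r : ℕ => M.exists_finset_measure_vertex_lt μ
    (ENNReal.mul_pos (hc0 r) (hδ r).ne')
  let h : ℕ → K → ℝ≥0∞ := fun r => (M.vertex ⁻¹' ((V r : Set N)ᶜ)).indicator fun _ => 1
  have hms : ∀ r, MeasurableSet (M.vertex ⁻¹' ((V r : Set N)ᶜ)) := fun r =>
    M.measurable_vertex MeasurableSet.of_discrete
  have hm : ∀ r, Measurable (h r) := fun r => measurable_const.indicator (hms r)
  have hU1 : ∀ r z, M.markovOp (h r) z ≤ 1 := fun r z =>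
    (M.markovOp_mono (g := fun _ => 1) (fun z => Set.indicator_le_self' (by simp) z) z).trans
      (M.markovOp_const 1 z).le
  have hbad : ∀ r, μ {z | ∃ n, 0 < M.excess (M.markovOp (h r)) (c r) n z} ≤ δ r := by
    intro r
    have h1 := M.mul_measure_exists_excess_pos_le (c := c r) hμ.2 (M.measurable_markovOp (hm r))
      (hU1 r)
    rw [M.lintegral_markovOp hμ.2 (hm r), lintegral_indicator_const (hms r), one_mul] at h1
    exact (ENNReal.mul_le_mul_iff_right (hc0 r) (hct r)).1 (h1.trans (hV r).le)
  have hex : ∃ y, y ∉ ⋃ r, {z | ∃ n, 0 < M.excess (M.markovOp (h r)) (c r) n z} := by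
    by_contra hcon
    push Not at hcon
    have h1 := (measure_iUnion_le _).trans (ENNReal.tsum_le_tsum hbad)
    rw [Set.eq_univ_of_forall hcon, measure_univ] at h1
    exact absurd hδs (not_lt.2 h1)
  obtain ⟨y, hy⟩ := hex
  refine ⟨y, fun ε hε => ?_⟩
  obtain ⟨r, hr⟩ := ENNReal.exists_inv_nat_lt hε.ne'
  refine ⟨V r, fun n hn => lt_of_le_of_lt ?_ hr⟩
  have hG : M.excess (M.markovOp (h r)) (c r) n y = 0 := by
    by_contra h0
    exact hy (Set.mem_iUnion.2 ⟨r, n, pos_iff_ne_zero.2 h0⟩)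
  have h1 := M.sum_lintegral_iterate_adj_le (c := c r) (hm r) n (Measure.dirac y)
  rw [lintegral_dirac' _ (M.measurable_excess (M.measurable_markovOp (hm r)) n), hG,
    add_zero] at h1
  simp only [h, lintegral_indicator_const (hms r), one_mul] at h1
  rw [alpha_apply]
  have hn0 : (n : ℝ≥0∞) ≠ 0 := by simp; omega
  calc _ ≤ (n : ℝ≥0∞)⁻¹ * (n * c r) := by gcongr
    _ = c r := by
      rw [← mul_assoc, ENNReal.inv_mul_cancel hn0 (by simp), one_mul]
    _ ≤ _ := ENNReal.inv_le_inv.2 le_self_add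

end MarkovSystem

/-- Interchange of a limit and a sum under uniform smallness of the tails. -/
theorem tsum_eq_of_tendsto_of_tail {ι α : Type*} {ω : Filter ι} [ω.NeBot] {f : ι → α → ℝ≥0∞}
    {f' : α → ℝ≥0∞} {F : ι → ℝ≥0∞} {F' : ℝ≥0∞} (hf : ∀ a, Tendsto (fun i => f i a) ω (𝓝 (f' a)))
    (hF : Tendsto F ω (𝓝 F')) (hle : ∀ i, ∑' a, f i a ≤ F i)
    (htail : ∀ ε : ℝ≥0∞, 0 < ε → ∃ (Q : Finset α) (r : ι → ℝ≥0∞), Tendsto r ω (𝓝 ε) ∧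
      ∀ i, F i ≤ ∑ a ∈ Q, f i a + r i) : ∑' a, f' a = F' := by
  refine le_antisymm ?_ ?_
  · rw [ENNReal.tsum_eq_iSup_sum]
    exact iSup_le fun s => le_of_tendsto_of_tendsto (tendsto_finsetSum s fun a _ => hf a) hF
      (Eventually.of_forall fun i => (ENNReal.sum_le_tsum s).trans (hle i))
  · refine ENNReal.le_of_forall_pos_le_add fun ε hε _ => ?_
    obtain ⟨Q, r, hr, hQ⟩ := htail ε (ENNReal.coe_pos.2 hε)
    refine (le_of_tendsto_of_tendsto hF ((tendsto_finsetSum Q fun a _ => hf a).add hr)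
      (Eventually.of_forall hQ)).trans ?_
    exact add_le_add (ENNReal.sum_le_tsum Q) le_rfl

namespace MarkovSystem

variable {K : Type*} [MetricSpace K] [MeasurableSpace K] [BorelSpace K]
  {N : Set ℕ} {E : Type*} [Countable E] (M : MarkovSystem K N E)

/-! ### Limits of averaged distributions -/

/-- The average of the distributions at the times `1, …, n + 1` of the chain started at `y`. -/
def average (y : K) (n : ℕ) : Measure K :=
  ((n + 1 : ℕ) : ℝ≥0∞)⁻¹ • ∑ k ∈ Finset.range (n + 1), M.adj^[k + 1] (Measure.dirac y)

theorem lintegral_average (y : K) (n : ℕ) (f : K → ℝ≥0∞) :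
    ∫⁻ z, f z ∂(M.average y n) = ((n + 1 : ℕ) : ℝ≥0∞)⁻¹ *
      ∑ k ∈ Finset.range (n + 1), ∫⁻ z, f z ∂(M.adj^[k + 1] (Measure.dirac y)) := by
  rw [average, lintegral_smul_measure, lintegral_finsetSum_measure, smul_eq_mul]

theorem inv_mul_sum_le (n : ℕ) {u : ℕ → ℝ≥0∞} {C : ℝ≥0∞} (hu : ∀ k, u k ≤ C) :
    ((n + 1 : ℕ) : ℝ≥0∞)⁻¹ * ∑ k ∈ Finset.range (n + 1), u k ≤ C := by
  calc _ ≤ ((n + 1 : ℕ) : ℝ≥0∞)⁻¹ * ∑ k ∈ Finset.range (n + 1), C := by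
        gcongr with k
        exact hu k
    _ = C := by
      rw [Finset.sum_const, Finset.card_range, nsmul_eq_mul, ← mul_assoc,
        ENNReal.inv_mul_cancel (by simp) (by simp), one_mul]

instance isProbabilityMeasure_average (y : K) (n : ℕ) : IsProbabilityMeasure (M.average y n) := by
  refine ⟨?_⟩
  have h := M.lintegral_average y n fun _ => 1
  have hp := M.isProbabilityMeasure_iterate_adj y
  simp only [lintegral_const, measure_univ, one_mul, Finset.sum_const, Finset.card_range,
    nsmul_eq_mul, mul_one] at h
  rw [h, ENNReal.inv_mul_cancel (by simp) (by simp)]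

theorem average_vertex (y : K) (n : ℕ) (S : Set N) :
    M.average y n (M.vertex ⁻¹' S) = M.alpha y (n + 1) S := by
  rw [alpha_apply, average, Measure.smul_apply, smul_eq_mul, Measure.finsetSum_apply]

theorem mul_sum_range_shift_le {a : ℕ → ℝ≥0∞} (ha : ∀ k, a k ≤ 1) (c : ℝ≥0∞) (n : ℕ) :
    c * ∑ k ∈ Finset.range n, a (k + 1) ≤ c * ∑ k ∈ Finset.range n, a k + c ∧
      c * ∑ k ∈ Finset.range n, a k ≤ c * ∑ k ∈ Finset.range n, a (k + 1) + c := by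
  have hs : ∑ k ∈ Finset.range n, a (k + 1) + a 0 = ∑ k ∈ Finset.range n, a k + a n := by
    rw [← Finset.sum_range_succ', ← Finset.sum_range_succ]
  constructor
  · calc _ ≤ c * (∑ k ∈ Finset.range n, a (k + 1) + a 0) := by gcongr; exact le_self_add
      _ ≤ c * (∑ k ∈ Finset.range n, a k + 1) := by
        rw [hs]
        gcongr
        exact ha _
      _ = _ := by rw [mul_add, mul_one]
  · calc _ ≤ c * (∑ k ∈ Finset.range n, a k + a n) := by gcongr; exact le_self_add
      _ ≤ c * (∑ k ∈ Finset.range n, a (k + 1) + 1) := by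
        rw [← hs]
        gcongr
        exact ha _
      _ = _ := by rw [mul_add, mul_one]

/-- Applying `U` shifts the time sum by one, so only its first and last terms differ. -/
theorem lintegral_average_markovOp_le (y : K) (n : ℕ) {f : K → ℝ≥0∞} (hf : Measurable f)
    (hf1 : ∀ z, f z ≤ 1) :
    ∫⁻ z, M.markovOp f z ∂(M.average y n) ≤
        ∫⁻ z, f z ∂(M.average y n) + ((n + 1 : ℕ) : ℝ≥0∞)⁻¹ ∧
      ∫⁻ z, f z ∂(M.average y n) ≤
        ∫⁻ z, M.markovOp f z ∂(M.average y n) + ((n + 1 : ℕ) : ℝ≥0∞)⁻¹ := by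
  obtain ⟨ν, hν⟩ : ∃ ν : ℕ → Measure K, ∀ k, ν k = M.adj^[k + 1] (Measure.dirac y) :=
    ⟨_, fun _ => rfl⟩
  have hν1 : ∀ k, IsProbabilityMeasure (ν k) := fun k => by
    rw [hν]
    exact M.isProbabilityMeasure_iterate_adj y (k + 1)
  have hs : ∀ k, ν (k + 1) = M.adj (ν k) := fun k => by
    rw [hν, hν, Function.iterate_succ_apply' _ (k + 1)]
  have ha : ∀ k, ∫⁻ z, f z ∂(ν k) ≤ 1 := fun k =>
    (lintegral_mono hf1).trans_eq (by rw [lintegral_const, measure_univ, mul_one])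
  have hU : ∀ k, ∫⁻ z, M.markovOp f z ∂(ν k) = ∫⁻ z, f z ∂(ν (k + 1)) := fun k => by
    rw [hs, M.lintegral_adj _ hf]
  simp only [lintegral_average, ← hν, hU]
  exact mul_sum_range_shift_le ha _ _

/-- A single word contributes at most as much as all words of its length, and each application of
`U` costs one term of almost-invariance. -/
theorem lintegral_average_word_le (y : K) (n : ℕ) {f : K → ℝ≥0∞} (hf : Measurable f)
    (hf1 : ∀ z, f z ≤ 1) (l : List (Alphabet E)) :
    ∫⁻ z, M.pathProb l z * f (M.wordMap l z) ∂(M.average y n) ≤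
      ∫⁻ z, f z ∂(M.average y n) + l.length * ((n + 1 : ℕ) : ℝ≥0∞)⁻¹ := by
  induction l with
  | nil => simp [pathProb, wordMap]
  | cons a l ih =>
    have hm : Measurable fun z => M.pathProb l z * f (M.wordMap l z) :=
      (M.measurable_pathProb l).mul (hf.comp (M.measurable_wordMap l))
    have h1 : ∀ z, M.pathProb l z * f (M.wordMap l z) ≤ 1 := fun z =>
      mul_le_one' (M.pathProb_le_one l z) (hf1 _)
    calc _ ≤ ∫⁻ z, M.markovOp (fun z => M.pathProb l z * f (M.wordMap l z)) z
          ∂(M.average y n) := by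
          refine lintegral_mono fun z => ?_
          rw [markovOp_eq, pathProb_cons, mul_assoc]
          exact ENNReal.le_tsum (f := fun a => M.prob a z *
            (M.pathProb l (M.wExt a z) * f (M.wordMap l (M.wExt a z)))) a
      _ ≤ _ := (M.lintegral_average_markovOp_le y n hm h1).1
      _ ≤ _ := add_le_add ih le_rfl
      _ = _ := by
        rw [List.length_cons]
        push_cast
        ring

/-- The probability that the next letter is outside of `Q`. -/
def tailProb (Q : Finset (Alphabet E)) (z : K) : ℝ≥0∞ :=
  open Classical in ∑' a, M.prob a z * if a ∈ Q then 0 else 1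

theorem measurable_tailProb (Q : Finset (Alphabet E)) : Measurable (M.tailProb Q) :=
  Measurable.tsum fun a => (M.measurable_prob a).mul_const _

theorem tailProb_le_one (Q : Finset (Alphabet E)) (z : K) : M.tailProb Q z ≤ 1 := by
  rw [← M.tsum_prob z]
  refine ENNReal.tsum_le_tsum fun a => ?_
  split_ifs <;> simp

theorem tsum_prob_mul_le (Q : Finset (Alphabet E)) (z : K) {g : Alphabet E → ℝ≥0∞}
    (hg : ∀ a, g a ≤ 1) :
    ∑' a, M.prob a z * g a ≤ ∑ a ∈ Q, M.prob a z * g a + M.tailProb Q z := by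
  classical
  have h1 : ∑ a ∈ Q, M.prob a z * g a =
      ∑' a, if a ∈ Q then M.prob a z * g a else 0 := by
    rw [tsum_eq_sum (s := Q) fun a ha => by simp [ha]]
    exact Finset.sum_congr rfl fun a ha => by simp [ha]
  rw [h1, tailProb, ← ENNReal.tsum_add]
  refine ENNReal.tsum_le_tsum fun a => ?_
  by_cases ha : a ∈ Q
  · simp [ha]
  · simpa [ha] using mul_le_of_le_one_right' (hg a)

variable {M}

/-- At each vertex the summable suprema provide finitely many edges that work uniformly over its
vertex set; their union over `V` is finite. -/
theorem exists_finset_tailProb_le (hdom : M.HasDominatingChain) (V : Finset N) {ε : ℝ≥0∞}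
    (hε : 0 < ε) : ∃ Q : Finset (Alphabet E), ∀ z, M.vertex z ∈ V → M.tailProb Q z ≤ ε := by
  classical
  have h1 : ∀ j, ∃ s : Finset {e : E // M.i e = j},
      ∑' e : {e // e ∉ s}, (⨆ y ∈ M.cell j, ENNReal.ofReal (M.p e.1.1 y)) < ε := fun j =>
    ((ENNReal.tendsto_tsum_compl_atTop_zero (hdom j).ne).eventually_lt_const hε).exists
  choose s hs using h1
  refine ⟨V.biUnion fun j => (s j).image fun e => letter e.1, fun z hz => ?_⟩
  set j := M.vertex z
  refine le_trans ?_ (hs j).le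
  have hzj : z ∈ M.cell j := M.mem_cell_vertex z
  rw [tailProb, M.tsum_alphabet_eq hzj fun a => if a ∈ V.biUnion fun j =>
    (s j).image fun e => letter e.1 then 0 else 1]
  refine le_trans (ENNReal.tsum_le_tsum fun e => ?_) (tsum_subtype {e | e ∉ s j}
    fun e : {e : E // M.i e = j} => ⨆ y ∈ M.cell j, ENNReal.ofReal (M.p e.1 y)).ge
  by_cases he : e ∈ s j
  · rw [if_pos]
    · simp
    · exact Finset.mem_biUnion.2 ⟨j, hz, Finset.mem_image.2 ⟨e, he, rfl⟩⟩
  · rw [Set.indicator_of_mem (show e ∈ {e | e ∉ s j} from he)]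
    refine le_trans (mul_le_of_le_one_right' (by split_ifs <;> simp)) ?_
    exact le_iSup₂_of_le z hzj le_rfl

theorem exists_finset_lintegral_tailProb_le (hdom : M.HasDominatingChain) {y : K}
    (hy : ∀ ε : ℝ≥0∞, 0 < ε → ∃ V : Finset N, ∀ n : ℕ, 1 ≤ n → M.alpha y n (V : Set N)ᶜ < ε)
    {ε : ℝ≥0∞} (hε : 0 < ε) :
    ∃ Q : Finset (Alphabet E), ∀ n, ∫⁻ z, M.tailProb Q z ∂(M.average y n) ≤ ε := by
  have hε2 : 0 < ε / 2 := ENNReal.half_pos hε.ne'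
  obtain ⟨V, hV⟩ := hy _ hε2
  obtain ⟨Q, hQ⟩ := exists_finset_tailProb_le hdom V hε2
  refine ⟨Q, fun n => ?_⟩
  have hms : MeasurableSet (M.vertex ⁻¹' (V : Set N)ᶜ) :=
    M.measurable_vertex MeasurableSet.of_discrete
  calc _ ≤ ∫⁻ z, ε / 2 + (M.vertex ⁻¹' (V : Set N)ᶜ).indicator (fun _ => 1) z
        ∂(M.average y n) := by
        refine lintegral_mono fun z => ?_
        by_cases hz : M.vertex z ∈ V
        · exact (hQ z hz).trans le_self_add
        · rw [Set.indicator_of_mem (by simpa using hz)]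
          exact (M.tailProb_le_one Q z).trans le_add_self
    _ = ε / 2 + M.alpha y (n + 1) (V : Set N)ᶜ := by
        rw [lintegral_add_left measurable_const, lintegral_indicator_const hms, one_mul,
          average_vertex, lintegral_const, measure_univ, mul_one]
    _ ≤ ε / 2 + ε / 2 := add_le_add le_rfl (hV (n + 1) (by omega)).le
    _ = ε := ENNReal.add_halves ε

/-- Word weights converge along an ultrafilter by compactness of `[0, ∞]`. Consistency passes to the
limit because the letters outside a finite set carry mass at most `ε` uniformly in `n`, up to an
error that vanishes along the ultrafilter. -/
theorem exists_isPathLimit_average (hdom : M.HasDominatingChain) {y : K}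
    (hy : ∀ ε : ℝ≥0∞, 0 < ε → ∃ V : Finset N, ∀ n : ℕ, 1 ≤ n → M.alpha y n (V : Set N)ᶜ < ε) :
    ∃ Λ : Measure (CodeSpace E),
      M.IsPathLimit (hyperfilter ℕ : Filter ℕ) (M.average y) Λ := by
  let ω : Ultrafilter ℕ := hyperfilter ℕ
  have hω : (ω : Filter ℕ) ≤ atTop := Nat.hyperfilter_le_atTop
  have hinv : Tendsto (fun n : ℕ => ((n + 1 : ℕ) : ℝ≥0∞)⁻¹) ω (𝓝 0) :=
    (ENNReal.tendsto_inv_nat_nhds_zero.comp (tendsto_add_atTop_nat 1)).mono_left hω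
  let I : List (Alphabet E) → ℕ → ℝ≥0∞ := fun l n => ∫⁻ z, M.pathProb l z ∂(M.average y n)
  let q : List (Alphabet E) → ℝ≥0∞ := fun l => (ω.map (I l)).lim
  have hq : ∀ l, Tendsto (I l) ω (𝓝 (q l)) := fun l => (ω.map (I l)).le_nhds_lim
  have hP1 := M.pathProb_le_one
  have hPm := M.measurable_pathProb
  have h0 : q [] = 1 := by
    refine tendsto_nhds_unique (hq []) ?_
    have : I [] = fun _ => 1 := funext fun n => by simp [I, pathProb]
    rw [this]
    exact tendsto_const_nhds
  have hr : ∀ l, ∑' a, q (l ++ [a]) = q l := by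
    intro l
    have hI : ∀ n, ∑' a, I (l ++ [a]) n = I l n := fun n => by
      simp only [I]
      rw [← lintegral_tsum fun a => (hPm _).aemeasurable]
      simp_rw [tsum_pathProb_append]
    refine tsum_eq_of_tendsto_of_tail (fun a => hq _) (hq l) (fun n => (hI n).le) fun ε hε => ?_
    obtain ⟨Q, hQ⟩ := exists_finset_lintegral_tailProb_le hdom hy hε
    refine ⟨Q, fun n => ε + l.length * ((n + 1 : ℕ) : ℝ≥0∞)⁻¹, ?_, fun n => ?_⟩
    · simpa using (ENNReal.Tendsto.const_mul (a := (l.length : ℝ≥0∞)) hinv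
        (Or.inr (by simp))).const_add ε
    · have hm : Measurable fun z => M.pathProb l z * M.tailProb Q (M.wordMap l z) :=
        (hPm l).mul ((M.measurable_tailProb Q).comp (M.measurable_wordMap l))
      calc I l n ≤ ∫⁻ z, ∑ a ∈ Q, M.pathProb (l ++ [a]) z +
            M.pathProb l z * M.tailProb Q (M.wordMap l z) ∂(M.average y n) := by
            refine lintegral_mono fun z => ?_
            simp_rw [pathProb_append, pathProb_singleton]
            rw [← Finset.mul_sum, ← mul_add]
            have h1 := M.tsum_prob_mul_le Q (M.wordMap l z) (g := fun _ => 1) fun _ => le_rfl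
            simp only [mul_one, tsum_prob] at h1
            calc M.pathProb l z = M.pathProb l z * 1 := (mul_one _).symm
              _ ≤ _ := mul_le_mul_right h1 _
        _ = ∑ a ∈ Q, I (l ++ [a]) n +
            ∫⁻ z, M.pathProb l z * M.tailProb Q (M.wordMap l z) ∂(M.average y n) := by
            rw [lintegral_add_right _ hm, lintegral_finsetSum _ fun a _ => hPm _]
        _ ≤ _ := add_le_add le_rfl ((M.lintegral_average_word_le y n (M.measurable_tailProb Q)
            (M.tailProb_le_one Q) l).trans (add_le_add (hQ n) le_rfl))
  have hl : ∀ l, ∑' a, q (a :: l) = q l := by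
    intro l
    have hI : ∀ n, ∑' a, I (a :: l) n = ∫⁻ z, M.markovOp (M.pathProb l) z ∂(M.average y n) :=
      fun n => by
        simp only [I]
        rw [← lintegral_tsum fun a => (hPm _).aemeasurable]
        simp_rw [pathProb_cons, markovOp_eq]
    -- Summing out the first letter applies `U`, which the averages do not notice in the limit.
    have hF : Tendsto (fun n => ∫⁻ z, M.markovOp (M.pathProb l) z ∂(M.average y n)) ω
        (𝓝 (q l)) := by
      have h1 : Tendsto (fun n => I l n + ((n + 1 : ℕ) : ℝ≥0∞)⁻¹) ω (𝓝 (q l)) := by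
        simpa using (hq l).add hinv
      have h2 : Tendsto (fun n => I l n - ((n + 1 : ℕ) : ℝ≥0∞)⁻¹) ω (𝓝 (q l)) := by
        simpa using ENNReal.Tendsto.sub (hq l) hinv (Or.inr (by simp))
      refine tendsto_of_tendsto_of_tendsto_of_le_of_le h2 h1 (fun n => ?_) fun n => ?_
      · exact tsub_le_iff_right.2 (M.lintegral_average_markovOp_le y n (hPm l) (hP1 l)).2
      · exact (M.lintegral_average_markovOp_le y n (hPm l) (hP1 l)).1
    refine tsum_eq_of_tendsto_of_tail (fun a => hq _) hF (fun n => (hI n).le) fun ε hε => ?_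
    obtain ⟨Q, hQ⟩ := exists_finset_lintegral_tailProb_le hdom hy hε
    refine ⟨Q, fun n => ε, tendsto_const_nhds, fun n => ?_⟩
    calc _ ≤ ∫⁻ z, ∑ a ∈ Q, M.pathProb (a :: l) z + M.tailProb Q z ∂(M.average y n) := by
          refine lintegral_mono fun z => ?_
          rw [markovOp_eq]
          exact M.tsum_prob_mul_le Q z fun a => hP1 l _
      _ = ∑ a ∈ Q, I (a :: l) n + ∫⁻ z, M.tailProb Q z ∂(M.average y n) := by
          rw [lintegral_add_right _ (M.measurable_tailProb Q),
            lintegral_finsetSum _ fun a _ => hPm _]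
      _ ≤ _ := add_le_add le_rfl (hQ n)
  obtain ⟨Λ, hΛ, h⟩ := exists_measure_of_word_weights q h0 hr hl
  exact ⟨Λ, hΛ, fun n => inferInstance, fun m l => by rw [h]; exact hq l⟩

/-! ### From asymptotic states to equilibrium states -/

variable [CompleteSpace K] {x : N → K} {Λ : Measure (CodeSpace E)}

/-- Conditioning an asymptotic state on the paths that are coded in the right vertex set gives an
equilibrium state. -/
theorem exists_equilibriumState_of_asymptoticState (hu : M.UnifContinuous)
    (hx : ∀ j, x j ∈ M.cell j) (hΛ : Λ ∈ M.asymptoticStates x)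
    (hpos : ∃ j : N, 0 < Λ (M.endsAt j ∩ M.coding x ⁻¹' M.cell j)) :
    (M.equilibriumStates x).Nonempty := by
  obtain ⟨hS, hD, hA⟩ := hΛ
  have := hS.1
  have hD' := M.ae_mem_codingDomain hD
  have hsp := measurePreserving_shift hS
  let G : Set (CodeSpace E) := {σ | M.codeLim x σ ∈ M.cell (M.tExt (σ 0))}
  have hG : MeasurableSet[pastSigma E] G := by
    have h1 : G = ⋃ j, M.codeLim x ⁻¹' M.cell j ∩
        (fun σ : CodeSpace E => σ 0) ⁻¹' (M.tExt ⁻¹' {j}) := by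
      ext σ
      simp only [Set.mem_iUnion, Set.mem_inter_iff, Set.mem_preimage, Set.mem_singleton_iff]
      exact ⟨fun h => ⟨_, h, rfl⟩, fun ⟨j, h, hj⟩ => by subst hj; exact h⟩
    rw [h1]
    exact MeasurableSet.iUnion fun j =>
      (M.measurable_past_codeLim x (M.cell_measurable j)).inter
        (measurable_past_eval le_rfl MeasurableSet.of_discrete)
  have hGm := pastSigma_le E _ hG
  have hG0 : Λ G ≠ 0 := by
    obtain ⟨j, hj⟩ := hpos
    intro h0
    refine hj.ne' (measure_mono_null (t := G ∪ (M.codingDomain x)ᶜ) (fun σ hσ => ?_)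
      (measure_union_null h0 hD'))
    by_cases hσD : σ ∈ M.codingDomain x
    · left
      have h1 : M.coding x σ ∈ M.cell j := hσ.2
      rw [M.coding_eq_codeLim hσD, ← hσ.1.2] at h1
      exact h1
    · exact Or.inr hσD
  -- The inclusion holds because `w_{σ_1}` maps vertex sets into vertex sets; equality of the two
  -- measures upgrades it to almost sure invariance.
  have hGS : G =ᵐ[Λ] shift ⁻¹' G := by
    refine ae_eq_of_ae_subset_of_measure_ge ?_ (hsp.measure_preimage hGm.nullMeasurableSet).le
      hGm.nullMeasurableSet (measure_ne_top _ _)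
    filter_upwards [hD', hsp.quasiMeasurePreserving.ae hD'] with σ h1 h2 h3
    have h4 : M.tExt (σ 0) = M.iExt (σ 1) := by simpa using (h1.1 0).2.symm
    change M.codeLim x (shift σ) ∈ M.cell (M.tExt (σ (0 + 1)))
    rw [M.codeLim_shift hx hu h1 h2 h3, zero_add]
    refine M.wExt_mem ?_
    rw [← h4]
    exact h3
  have hac : ProbabilityTheory.cond Λ G ≪ Λ := cond_absolutelyContinuous
  have hprob : IsProbabilityMeasure (ProbabilityTheory.cond Λ G) := cond_isProbabilityMeasure hG0
  refine ⟨ProbabilityTheory.cond Λ G, M.mem_equilibriumStates_iff.2 ⟨⟨hprob, ?_⟩, ?_, ?_⟩⟩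
  · refine Measure.ext fun B hB => ?_
    rw [Measure.map_apply measurable_shift hB, cond_apply hGm, cond_apply hGm]
    congr 1
    rw [← hsp.measure_preimage (hGm.inter hB).nullMeasurableSet, Set.preimage_inter]
    exact measure_congr (hGS.inter (ae_eq_refl _))
  · rw [← mem_ae_iff_prob_eq_one (M.measurableSet_codingDomain x)]
    exact hac.ae_le hD'
  · rintro (_ | e) A hAm
    · simp only [prob_none, lintegral_zero]
      exact measure_mono_null Set.inter_subset_right (hac
        (M.measure_cyl_none (hD'.mono fun σ hσ => hσ.1) 1))
    · have h0 : ∀ᵐ σ ∂Λ, 0 ≤ (M.endsAt (M.i e)).indicator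
          (fun σ => M.pBar e (M.coding x σ)) σ := by
        filter_upwards [hD'] with σ hσ
        exact ge_of_tendsto' (hu.tendsto_p_approx hx e hσ) fun n => (M.p_mem _ _).1
      -- `G` belongs to the past, so conditioning on it leaves the law of the next letter unchanged.
      have h1 := measure_inter_cyl_of_condExp e h0 (hA e) (hG.inter hAm)
      change ProbabilityTheory.cond Λ G (A ∩ cyl 1 [letter e]) = _
      rw [cond_apply hGm, ← Set.inter_assoc, h1, ProbabilityTheory.cond,
        Measure.restrict_smul, lintegral_smul_measure, smul_eq_mul,
        Measure.restrict_restrict (pastSigma_le E _ hAm), Set.inter_comm A G]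
      congr 1
      refine lintegral_congr_ae ?_
      filter_upwards [ae_restrict_of_ae hD',
        ae_restrict_mem (hGm.inter (pastSigma_le E _ hAm))] with σ h2 h3
      rw [indicator_pBar_eq hu e h2 h3.1]
      rfl

theorem equilibriumStates_nonempty_of_tightCondition (hcontr : M.Contractive)
    (hu : M.UnifContinuous) (hx : ∀ j, x j ∈ M.cell j) (hnd : M.NonDegenerate x)
    (hb : M.bConst x < ∞) (hdom : M.HasDominatingChain) (ht : M.TightCondition) :
    (M.equilibriumStates x).Nonempty := by
  obtain ⟨ρ, hρ, hc⟩ := hcontr.contractsBy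
  obtain ⟨y, hy⟩ := ht
  obtain ⟨Λ, hΛ⟩ := exists_isPathLimit_average hdom hy
  have hC : ∀ n, ∫⁻ z, M.baseDist x z ∂(M.average y n) ≤
      M.baseDist x y + (1 - ρ)⁻¹ * M.bConst x := fun n => by
    rw [lintegral_average]
    exact inv_mul_sum_le n fun k => hc.lintegral_baseDist_iterate_le hρ hx y (k + 1)
  have hCt : M.baseDist x y + (1 - ρ)⁻¹ * M.bConst x < ∞ :=
    ENNReal.add_lt_top.2 ⟨edist_lt_top _ _, ENNReal.mul_lt_top
      (ENNReal.inv_lt_top.2 (tsub_pos_of_lt hρ)) hb⟩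
  have hA := hΛ.mem_asymptoticStates hc hρ hu hx hb hC hCt
  exact exists_equilibriumState_of_asymptoticState hu hx hA (hnd Λ hA)

end MarkovSystem

end

theorem corollary1 {K : Type*} [MetricSpace K] [CompleteSpace K] [MeasurableSpace K] [BorelSpace K]
    {N : Set ℕ} {E : Type*} [Countable E] (M : MarkovSystem K N E)
    (x : N → K) (hx : ∀ j, x j ∈ M.cell j)
    (hcontr : M.Contractive) (hunif : M.UnifContinuous) (hnd : M.NonDegenerate x)
    (hb : M.bConst x < ⊤) :
    (M.HasDominatingChain → ((M.equilibriumStates x).Nonempty ↔ M.TightCondition)) ∧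
    ((∀ μ ∈ M.invariantMeasures, ∃! Λ, M.IsLift μ Λ) ∧
      Set.BijOn (M.codingMeasure x) (M.equilibriumStates x) M.invariantMeasures ∧
      Set.MapsTo M.lift M.invariantMeasures (M.equilibriumStates x) ∧
      Set.InvOn M.lift (M.codingMeasure x) (M.equilibriumStates x) M.invariantMeasures) ∧
    (∀ x' : N → K, (∀ j, x' j ∈ M.cell j) → M.bConst x' < ⊤ →
      M.equilibriumStates x' = M.equilibriumStates x ∧
      ∀ Λ ∈ M.equilibriumStates x, M.codingMeasure x' Λ = M.codingMeasure x Λ) := by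
  have hbij := MarkovSystem.coding_lift_bijective hcontr hunif hx hb
  refine ⟨fun hdom => ⟨?_, ?_⟩, ⟨fun μ hμ => M.existsUnique_isLift hμ, hbij⟩,
    fun x' hx' hb' => ?_⟩
  · rintro ⟨Λ, hΛ⟩
    exact M.tightCondition_of_invariant (hbij.1.mapsTo hΛ)
  · exact MarkovSystem.equilibriumStates_nonempty_of_tightCondition hcontr hunif hx hnd hb hdom
  · have hbij' := MarkovSystem.coding_lift_bijective hcontr hunif hx' hb'
    -- `Λ` is the lift of its coded measure, a relation free of base points, so coding with `y'`
    -- recovers that same measure.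
    have heq : ∀ {y y' : N → K}, (∀ j, y j ∈ M.cell j) → M.bConst y < ⊤ →
        (∀ j, y' j ∈ M.cell j) → M.bConst y' < ⊤ → ∀ Λ ∈ M.equilibriumStates y,
        Λ ∈ M.equilibriumStates y' ∧ M.codingMeasure y' Λ = M.codingMeasure y Λ := by
      intro y y' hy _ hy' hby' Λ hΛ
      exact (MarkovSystem.isLift_codingMeasure hy hunif hΛ).mem_equilibriumStates
        (MarkovSystem.codingMeasure_mem_invariantMeasures hy hunif hΛ) hcontr hunif hy' hby'
    exact ⟨Set.Subset.antisymm (fun Λ hΛ => (heq hx' hb' hx hb Λ hΛ).1)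
      fun Λ hΛ => (heq hx hb hx' hb' Λ hΛ).1, fun Λ hΛ => (heq hx hb hx' hb' Λ hΛ).2⟩
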